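/- Let $n,m\ge 1$, $f_{ij}:\mathbb{R}^d\to\mathbb{R}$ ($i\in[n]$, $j\in[m]$), $f_i=\frac1m\sum_{j=1}^m f_{ij}$ and $f=\frac1n\sum_{i=1}^n f_i$. Let $L>0$, $\mu\ge 0$. Assume that every $f_{ij}$ is convex and $L$-smooth (differentiable with $L$-Lipschitz gradient), and that $f$ is $\mu$-quasi strongly convex: $f$ has a minimizer $x^*$ and $f(x^*)\ge f(x)+\langle\nabla f(x),x^*-x\rangle+\frac\mu2\|x-x^*\|^2$ for all $x\in\mathbb{R}^d$. Let $Q$ be a quantization operator with parameter $\omega>0$, i.e. a random map with $\mathbf{E}[Q(y)]=y$ and $\mathbf{E}\|Q(y)-y\|^2\le\omega\|y\|^2$ for all $y\in\mathbb{R}^d$. **Method (D-LSVRG-DIANA).** Let $\tau\ge0$ be an integer delay, $\gamma>0$, $\alpha>0$, $p\in(0,1)$, and let $x^0$, $h_i^0$, $w_i^0\in\mathbb{R}^d$ be given; put $e_i^0=0$. For $k=0,1,2,\dots$ every worker $i\in[n]$ picks $l$ uniformly from $[m]$ and computes $$\hat g_i^k=\nabla f_{il}(x^k)-\nabla f_{il}(w_i^k)+\nabla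 f_i(w_i^k),\quad \hat\Delta_i^k=Q(\hat g_i^k-h_i^k),\quad g_i^k=h_i^k+\hat\Delta_i^k,\quad h_i^{k+1}=h_i^k+\alpha\hat\Delta_i^k,$$ $w_i^{k+1}=x^k$ with probability $p$ and $w_i^{k+1}=w_i^k$ with probability $1-p$; $v_i^k=\gamma g_i^{k-\tau}$ if $k\ge\tau$ and $v_i^k=0$ if $k<\tau$; $e_i^{k+1}=e_i^k+\gamma g_i^k-v_i^k$; and $x^{k+1}=x^k-\frac1n\sum_{i=1}^n v_i^k$. All random choices (indices, quantizations, coins) are independent, over workers and iterations. Write $g^k=\frac1n\sum_i g_i^k$, $e^k=\frac1n\sum_i e_i^k$, $\tilde x^k=x^k-e^k$, and let $\mathcal F_k$ be the $\sigma$-algebra generated by all random choices of the iterations $0,\dots,k-1$. Put $$\sigma_{1,k}^2=\frac1n\sum_{i=1}^n\|h_i^k-\nabla f_i(x^*)\|^2,\quad \sigma_{2,k}^2=\frac1{nm}\sum_{i=1}^n\sum_{j=1}^m\|\nabla f_{ij}(w_i^k)-\nabla f_{ij}(x^*)\|^2,$$ $$A'=2L\Big(1+\frac{2\omega}n\Big),\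 B_1'=\frac{2\omega}n,\ B_2'=2\Big(1+\frac{2\omega}n\Big),\ \rho_1=\alpha,\ \rho_2=p,\ C_1=3L\alpha,\ C_2=Lp,\ G=2,\ D_1'=D_2=D_3=0,$$ $$F_1=\frac{12\gamma^2L\omega\tau(2+\alpha)}{n\alpha},\quad F_2=\frac{12\gamma^2\tau L(2+p)}p\Big(\frac{4\omega}{n(1-\alpha)}+1+\frac{2\omega}n\Big),\quad M_1=\frac{8\omega}{3n\alpha},\quad M_2=\frac{8(7+\frac{6\omega}n)}{9p},$$ $$\gamma_{\max}=\min\left\{\frac1{8L\left(\frac{37}9+\frac{24\omega}{3n}\right)},\ \frac1{8L\sqrt{\tau\left(2+\tau+\frac4{1-p}+\frac{4\omega}n\left(1+\frac3{1-\alpha}+\frac2{1-p}+\frac4{(1-\alpha)(1-p)}\right)\right)}}\right\}$$ (the second term being $+\infty$ if $\tau=0$), $\eta=\min\{\frac{\gamma\mu}2,\frac\alpha4,\frac p4\}$, $w_k=(1-\eta)^{-(k+1)}$, $W_K=\sum_{k=0}^Kw_k$, $\bar x^K=\frac1{W_K}\sum_{k=0}^Kw_kx^k$, $T^k=\|\tilde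 x^k-x^*\|^2+M_1\gamma^2\sigma_{1,k}^2+M_2\gamma^2\sigma_{2,k}^2$ and $\Phi_0=\frac4\gamma\left(T^0+\gamma F_1\sigma_{1,0}^2+\gamma F_2\sigma_{2,0}^2\right)$. Assume $\alpha\le\frac1{\omega+1}$ and $\gamma\le\gamma_{\max}$. Then: 1. (Parametric assumption.) For all $k,K\ge0$ all expectations below are finite, $\mathbf{E}[g^k\mid\mathcal F_k]=\mathbf{E}[g^k\mid x^k]=\nabla f(x^k)$ and, almost surely, $$\mathbf{E}[\|g^k\|^2\mid\mathcal F_k]\le 2A'(f(x^k)-f(x^*))+B_1'\sigma_{1,k}^2+B_2'\sigma_{2,k}^2+D_1',$$ $$\mathbf{E}[\sigma_{1,k+1}^2\mid\mathcal F_k]\le(1-\rho_1)\sigma_{1,k}^2+2C_1(f(x^k)-f(x^*))+G\rho_1\sigma_{2,k}^2+D_2,$$ $$\mathbf{E}[\sigma_{2,k+1}^2\mid\mathcal F_k]\le(1-\rho_2)\sigma_{2,k}^2+2C_2(f(x^k)-f(x^*)),$$ $$3L\sum_{k=0}^Kw_k\mathbf{E}\|e^k\|^2\le\frac14\sum_{k=0}^Kw_k\mathbf{E}[f(x^k)-f(x^*)]+F_1\sigma_{1,0}^2+F_2\sigma_{2,0}^2+\gamma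 D_3W_K.$$ 2. If $\mu>0$, then $\mathbf{E}[f(\bar x^K)-f(x^*)]\le\left(1-\min\{\frac{\gamma\mu}2,\frac\alpha4,\frac p4\}\right)^K\Phi_0$ for all $K\ge0$; if $\mu=0$, then $\mathbf{E}[f(\bar x^K)-f(x^*)]\le\Phi_0/K$ for all $K\ge1$. 3. There is an absolute constant $C>0$ (depending on none of the data) such that, if moreover $\mu>0$, $m\ge2$, $p=\frac1m$, $\alpha=\min\{\frac1{\omega+1},\frac12\}$ and $\gamma=\gamma_{\max}$, then with $\kappa=L/\mu$, for every $\varepsilon>0$, $$K\ge C\left(\omega+m+\kappa\Big(1+\frac\omega n\Big)+\kappa\sqrt{\tau\Big(\tau+\frac\omega n\Big)}\right)\ln\frac1\varepsilon\quad\text{implies}\quad\mathbf{E}[f(\bar x^K)-f(x^*)]\le\varepsilon\,\Phi_0.$$ -/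

import Mathlib

open MeasureTheory ProbabilityTheory

namespace DLSVRGDiana

/-- The space `ℝ^d` with its Euclidean norm. -/
abbrev Vec (d : ℕ) : Type := EuclideanSpace ℝ (Fin d)

/-- `f_i = (1/m) ∑_j f_{ij}`. -/
noncomputable def localObj {d n m : ℕ} (F : Fin n → Fin m → Vec d → ℝ) (i : Fin n) (x : Vec d) : ℝ :=
  (1 / (m : ℝ)) * ∑ j, F i j x

/-- `f = (1/n) ∑_i f_i`. -/
noncomputable def objective {d n m : ℕ} (F : Fin n → Fin m → Vec d → ℝ) (x : Vec d) : ℝ :=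
  (1 / (n : ℝ)) * ∑ i, localObj F i x

/-- `L`-smoothness: differentiable with `L`-Lipschitz gradient. -/
def LSmooth {d : ℕ} (L : ℝ) (φ : Vec d → ℝ) : Prop :=
  Differentiable ℝ φ ∧ ∀ x y, ‖gradient φ x - gradient φ y‖ ≤ L * ‖x - y‖

/-- `μ`-quasi strong convexity with respect to the minimizer `xs`. -/
def QuasiStronglyConvex {d : ℕ} (μ : ℝ) (φ : Vec d → ℝ) (xs : Vec d) : Prop :=
  (∀ x, φ xs ≤ φ x) ∧
    ∀ x, φ xs ≥ φ x + inner ℝ (gradient φ x) (xs - x) + μ / 2 * ‖x - xs‖ ^ 2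

/-- A quantization operator: the random map `y ↦ Q y s`, where the seed `s` has law `ν`, is unbiased
with variance at most `ω ‖y‖²`. -/
structure IsQuantization {d : ℕ} {Ξ : Type*} [MeasurableSpace Ξ] (ν : Measure Ξ)
    (Q : Vec d → Ξ → Vec d) (ω : ℝ) : Prop where
  omega_pos : 0 < ω
  measurable : Measurable (fun q : Vec d × Ξ => Q q.1 q.2)
  integrable : ∀ y, Integrable (Q y) ν
  unbiased : ∀ y, ∫ s, Q y s ∂ν = y
  sq_integrable : ∀ y, Integrable (fun s => ‖Q y s - y‖ ^ 2) ν
  variance_le : ∀ y, ∫ s, ‖Q y s - y‖ ^ 2 ∂ν ≤ ω * ‖y‖ ^ 2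

/-- The law of a coin that shows `true` with probability `p`. -/
noncomputable def coinLaw (p : ℝ) : Measure Bool :=
  ENNReal.ofReal p • Measure.dirac true + ENNReal.ofReal (1 - p) • Measure.dirac false

/-- The randomness `ζ k i = (l, s, b)` used by worker `i` at iteration `k`: a uniform index `l ∈ [m]`,
a quantization seed `s` with law `ν` and a coin `b` with success probability `p`. The three are
independent, and so are the triples of different workers and iterations. -/
structure IsSampling {n m : ℕ} {Ξ Ω : Type*} [MeasurableSpace Ξ] [MeasurableSpace Ω]
    (P : Measure Ω) (ν : Measure Ξ) (p : ℝ) (ζ : ℕ → Fin n → Ω → Fin m × Ξ × Bool) : Prop where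
  measurable : ∀ k i, Measurable (ζ k i)
  law : ∀ k i, P.map (ζ k i) = (uniformOn (Set.univ : Set (Fin m))).prod (ν.prod (coinLaw p))
  indep : iIndepFun (fun q : ℕ × Fin n => ζ q.1 q.2) P

/-- The input of the method: the functions `f_{ij}`, the quantization map `Q`, the learning rates
`γ`, `α`, the delay `τ`, and the starting vectors `x⁰`, `h_i⁰`, `w_i⁰`. -/
structure Input (d n m : ℕ) (Ξ : Type*) where
  F : Fin n → Fin m → Vec d → ℝ
  Q : Vec d → Ξ → Vec d
  γ : ℝ
  α : ℝ
  τ : ℕ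
  x₀ : Vec d
  h₀ : Fin n → Vec d
  w₀ : Fin n → Vec d

/-- The state at the beginning of iteration `k`: `x^k`, `e_i^k`, `h_i^k`, `w_i^k`, and the memory
`past t i = g_i^t` for `t < k`. -/
structure State (d n : ℕ) where
  x : Vec d
  e : Fin n → Vec d
  h : Fin n → Vec d
  w : Fin n → Vec d
  past : ℕ → Fin n → Vec d

/-- The average `(1/n) ∑_i u_i`. -/
noncomputable def avg {d n : ℕ} (u : Fin n → Vec d) : Vec d := (1 / (n : ℝ)) • ∑ i, u i

/-- `x̃ = x - e`. -/
noncomputable def State.xTilde {d n : ℕ} (S : State d n) : Vec d := S.x - avg S.e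

variable {d n m : ℕ} {Ξ : Type*}

def Input.init (A : Input d n m Ξ) : State d n where
  x := A.x₀
  e := fun _ => 0
  h := A.h₀
  w := A.w₀
  past := fun _ _ => 0

/-- `ĝ_i = ∇f_{il}(x) - ∇f_{il}(w_i) + ∇f_i(w_i)`. -/
noncomputable def Input.gHat (A : Input d n m Ξ) (S : State d n) (z : Fin n → Fin m × Ξ × Bool)
    (i : Fin n) : Vec d :=
  gradient (A.F i (z i).1) S.x - gradient (A.F i (z i).1) (S.w i) + gradient (localObj A.F i) (S.w i)

/-- `Δ̂_i = Q(ĝ_i - h_i)`. -/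
noncomputable def Input.delta (A : Input d n m Ξ) (S : State d n) (z : Fin n → Fin m × Ξ × Bool)
    (i : Fin n) : Vec d :=
  A.Q (A.gHat S z i - S.h i) (z i).2.1

/-- `g_i = h_i + Δ̂_i`. -/
noncomputable def Input.gLocal (A : Input d n m Ξ) (S : State d n) (z : Fin n → Fin m × Ξ × Bool)
    (i : Fin n) : Vec d :=
  S.h i + A.delta S z i

/-- The memory after the stochastic gradients of iteration `k` have been stored. -/
noncomputable def Input.memory (A : Input d n m Ξ) (k : ℕ) (S : State d n)
    (z : Fin n → Fin m × Ξ × Bool) : ℕ → Fin n → Vec d :=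
  Function.update S.past k (A.gLocal S z)

/-- The delayed contribution `v_i^k = γ g_i^{k-τ}` for `k ≥ τ`, and `v_i^k = 0` for `k < τ`. -/
noncomputable def Input.v (A : Input d n m Ξ) (k : ℕ) (S : State d n)
    (z : Fin n → Fin m × Ξ × Bool) (i : Fin n) : Vec d :=
  if A.τ ≤ k then A.γ • A.memory k S z (k - A.τ) i else 0

/-- One iteration of D-LSVRG-DIANA. -/
noncomputable def Input.step (A : Input d n m Ξ) (k : ℕ) (S : State d n)
    (z : Fin n → Fin m × Ξ × Bool) : State d n where
  x := S.x - avg (A.v k S z)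
  e := fun i => S.e i + A.γ • A.gLocal S z i - A.v k S z i
  h := fun i => S.h i + A.α • A.delta S z i
  w := fun i => if (z i).2.2 then S.x else S.w i
  past := A.memory k S z

/-- The state at the beginning of iteration `k`, as a function of the realization of the randomness. -/
noncomputable def Input.state (A : Input d n m Ξ) (z : ℕ → Fin n → Fin m × Ξ × Bool) :
    ℕ → State d n
  | 0 => A.init
  | k + 1 => A.step k (A.state z k) (z k)

/-- `σ_1² = (1/n) ∑_i ‖h_i - ∇f_i(x*)‖²`. -/
noncomputable def sigma1Sq (F : Fin n → Fin m → Vec d → ℝ) (xs : Vec d) (h : Fin n → Vec d) : ℝ :=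
  (1 / (n : ℝ)) * ∑ i, ‖h i - gradient (localObj F i) xs‖ ^ 2

/-- `σ_2² = (1/(nm)) ∑_i ∑_j ‖∇f_{ij}(w_i) - ∇f_{ij}(x*)‖²`. -/
noncomputable def sigma2Sq (F : Fin n → Fin m → Vec d → ℝ) (xs : Vec d) (w : Fin n → Vec d) : ℝ :=
  (1 / ((n : ℝ) * m)) * ∑ i, ∑ j, ‖gradient (F i j) (w i) - gradient (F i j) xs‖ ^ 2

/-- `T = ‖x̃ - x*‖² + M₁ γ² σ_1² + M₂ γ² σ_2²`. -/
noncomputable def Input.lyapunov (A : Input d n m Ξ) (xs : Vec d) (M₁ M₂ : ℝ) (S : State d n) : ℝ :=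
  ‖S.xTilde - xs‖ ^ 2 + M₁ * A.γ ^ 2 * sigma1Sq A.F xs S.h + M₂ * A.γ ^ 2 * sigma2Sq A.F xs S.w

section Processes

variable {Ω : Type*} (A : Input d n m Ξ) (ζ : ℕ → Fin n → Ω → Fin m × Ξ × Bool)

/-- The random state at the beginning of iteration `k`. -/
noncomputable def Input.run (k : ℕ) (ω : Ω) : State d n := A.state (fun t i => ζ t i ω) k

/-- The iterate `x^k`. -/
noncomputable def Input.xProc (k : ℕ) (ω : Ω) : Vec d := (A.run ζ k ω).x

/-- The error `e^k = (1/n) ∑_i e_i^k`. -/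
noncomputable def Input.eProc (k : ℕ) (ω : Ω) : Vec d := avg (A.run ζ k ω).e

/-- The stochastic gradient `g^k = (1/n) ∑_i g_i^k`. -/
noncomputable def Input.gProc (k : ℕ) (ω : Ω) : Vec d :=
  avg (A.gLocal (A.run ζ k ω) (fun i => ζ k i ω))

/-- `σ_{1,k}²`. -/
noncomputable def Input.sigma1Proc (xs : Vec d) (k : ℕ) (ω : Ω) : ℝ :=
  sigma1Sq A.F xs (A.run ζ k ω).h

/-- `σ_{2,k}²`. -/
noncomputable def Input.sigma2Proc (xs : Vec d) (k : ℕ) (ω : Ω) : ℝ :=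
  sigma2Sq A.F xs (A.run ζ k ω).w

/-- The σ-algebra of all the randomness drawn before the stochastic gradient `g^k`. -/
@[reducible] def history [MeasurableSpace Ξ] (ζ : ℕ → Fin n → Ω → Fin m × Ξ × Bool) (k : ℕ) :
    MeasurableSpace Ω :=
  ⨆ t : {t : ℕ // t < k}, ⨆ i : Fin n, MeasurableSpace.comap (ζ t i) inferInstance

end Processes

/-- `η = min{γμ/2, ρ₁/4, ρ₂/4}`. -/
noncomputable def eta (γ μ ρ₁ ρ₂ : ℝ) : ℝ := min (γ * μ / 2) (min (ρ₁ / 4) (ρ₂ / 4))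

/-- `w_k = (1 - η)^{-(k+1)}`. -/
noncomputable def weight (η : ℝ) (k : ℕ) : ℝ := ((1 - η) ^ (k + 1))⁻¹

/-- `W_K = ∑_{k=0}^K w_k`. -/
noncomputable def weightSum (η : ℝ) (K : ℕ) : ℝ := ∑ k ∈ Finset.range (K + 1), weight η k

/-- The weighted average `x̄^K = (1/W_K) ∑_{k=0}^K w_k x^k`. -/
noncomputable def xBar {Ω : Type*} (η : ℝ) (x : ℕ → Ω → Vec d) (K : ℕ) (ω : Ω) : Vec d :=
  (1 / weightSum η K) • ∑ k ∈ Finset.range (K + 1), weight η k • x k ω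

/-- The constants of the parametric assumption. -/
structure Constants where
  A' : ℝ
  B₁' : ℝ
  B₂' : ℝ
  C₁ : ℝ
  C₂ : ℝ
  F₁ : ℝ
  F₂ : ℝ
  G : ℝ
  D₁' : ℝ
  D₂ : ℝ
  D₃ : ℝ
  ρ₁ : ℝ
  ρ₂ : ℝ

/-- The parametric assumption on a method with iterates `x`, stochastic gradients `g`, errors `e` and
variance sequences `s₁ k = σ_{1,k}²`, `s₂ k = σ_{2,k}²`, where `ℱ k` is the information available
before `g k` is drawn. Since `s₁ k` and `s₂ k` are functions of the past, but not of `x k` alone, the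
conditional moment bounds are conditional on `ℱ k`. -/
structure ParametricAssumption {Ω : Type*} [mΩ : MeasurableSpace Ω] (P : Measure Ω)
    (ℱ : ℕ → MeasurableSpace Ω) (f : Vec d → ℝ) (xs : Vec d) (L μ γ : ℝ)
    (x g e : ℕ → Ω → Vec d) (s₁ s₂ : ℕ → Ω → ℝ) (c : Constants) : Prop where
  nonneg : 0 ≤ c.A' ∧ 0 ≤ c.B₁' ∧ 0 ≤ c.B₂' ∧ 0 ≤ c.C₁ ∧ 0 ≤ c.C₂ ∧ 0 ≤ c.F₁ ∧ 0 ≤ c.F₂ ∧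
    0 ≤ c.G ∧ 0 ≤ c.D₁' ∧ 0 ≤ c.D₂ ∧ 0 ≤ c.D₃
  rho_mem : c.ρ₁ ∈ Set.Icc (0 : ℝ) 1 ∧ c.ρ₂ ∈ Set.Icc (0 : ℝ) 1
  filtration : Monotone ℱ ∧ ∀ k, ℱ k ≤ mΩ
  adapted : ∀ k, StronglyMeasurable[ℱ k] (x k) ∧ StronglyMeasurable[ℱ k] (e k) ∧
    StronglyMeasurable[ℱ k] (s₁ k) ∧ StronglyMeasurable[ℱ k] (s₂ k)
  sigma_nonneg : ∀ k ω, 0 ≤ s₁ k ω ∧ 0 ≤ s₂ k ω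
  integrable : ∀ k, Integrable (g k) P ∧ Integrable (fun ω => ‖g k ω‖ ^ 2) P ∧
    Integrable (fun ω => ‖e k ω‖ ^ 2) P ∧ Integrable (fun ω => f (x k ω)) P ∧
    Integrable (s₁ k) P ∧ Integrable (s₂ k) P
  unbiased : ∀ k, P[g k | ℱ k] =ᵐ[P] fun ω => gradient f (x k ω)
  unbiased_iterate : ∀ k,
    P[g k | MeasurableSpace.comap (x k) inferInstance] =ᵐ[P] fun ω => gradient f (x k ω)
  second_moment : ∀ k, P[fun ω => ‖g k ω‖ ^ 2 | ℱ k] ≤ᵐ[P] fun ω =>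
    2 * c.A' * (f (x k ω) - f xs) + c.B₁' * s₁ k ω + c.B₂' * s₂ k ω + c.D₁'
  sigma1_rec : ∀ k, P[s₁ (k + 1) | ℱ k] ≤ᵐ[P] fun ω =>
    (1 - c.ρ₁) * s₁ k ω + 2 * c.C₁ * (f (x k ω) - f xs) + c.G * c.ρ₁ * s₂ k ω + c.D₂
  sigma2_rec : ∀ k, P[s₂ (k + 1) | ℱ k] ≤ᵐ[P] fun ω =>
    (1 - c.ρ₂) * s₂ k ω + 2 * c.C₂ * (f (x k ω) - f xs)
  error_sum : ∀ K : ℕ,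
    3 * L * ∑ k ∈ Finset.range (K + 1), weight (eta γ μ c.ρ₁ c.ρ₂) k * ∫ ω, ‖e k ω‖ ^ 2 ∂P ≤
      1 / 4 * ∑ k ∈ Finset.range (K + 1),
        weight (eta γ μ c.ρ₁ c.ρ₂) k * ∫ ω, (f (x k ω) - f xs) ∂P
      + c.F₁ * ∫ ω, s₁ 0 ω ∂P + c.F₂ * ∫ ω, s₂ 0 ω ∂P
      + γ * c.D₃ * weightSum (eta γ μ c.ρ₁ c.ρ₂) K

/-- The largest admissible stepsize
`min{1/(8L(37/9 + 24ω/(3n))), 1/(8L√(τ(2 + τ + 4/(1-p) + (4ω/n)(1 + 3/(1-α) + 2/(1-p) + 4/((1-α)(1-p))))))}`,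
written as the reciprocal of a maximum, so that the second term imposes no restriction if `τ = 0`. -/
noncomputable def stepBound (L ω α p : ℝ) (n τ : ℕ) : ℝ :=
  1 / (8 * L * max (37 / 9 + 24 * ω / (3 * n))
    (√(τ * (2 + τ + 4 / (1 - p) + 4 * ω / n *
      (1 + 3 / (1 - α) + 2 / (1 - p) + 4 / ((1 - α) * (1 - p)))))))

/-- The constants with which the method satisfies the parametric assumption. -/
noncomputable def constants (L ω γ α p : ℝ) (n τ : ℕ) : Constants where
  A' := 2 * L * (1 + 2 * ω / n)
  B₁' := 2 * ω / n
  B₂' := 2 * (1 + 2 * ω / n)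
  C₁ := 3 * L * α
  C₂ := L * p
  F₁ := 12 * γ ^ 2 * L * ω * τ * (2 + α) / (n * α)
  F₂ := 12 * γ ^ 2 * τ * L * (2 + p) / p * (4 * ω / (n * (1 - α)) + 1 + 2 * ω / n)
  G := 2
  D₁' := 0
  D₂ := 0
  D₃ := 0
  ρ₁ := α
  ρ₂ := p

noncomputable def M₁ (ω α : ℝ) (n : ℕ) : ℝ := 8 * ω / (3 * n * α)

noncomputable def M₂ (ω p : ℝ) (n : ℕ) : ℝ := 8 * (7 + 6 * ω / n) / (9 * p)

/-- `4 (T⁰ + γ F₁ σ_{1,0}² + γ F₂ σ_{2,0}²) / γ`. -/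
noncomputable def Input.initialGap (A : Input d n m Ξ) (xs : Vec d) (L ω p : ℝ) : ℝ :=
  4 * (A.lyapunov xs (M₁ ω A.α n) (M₂ ω p n) A.init
      + A.γ * (constants L ω A.γ A.α p n A.τ).F₁ * sigma1Sq A.F xs A.h₀
      + A.γ * (constants L ω A.γ A.α p n A.τ).F₂ * sigma2Sq A.F xs A.w₀) / A.γ

end DLSVRGDiana

open DLSVRGDiana

/-! The delayed method is compared with undelayed SGD through the virtual iterate `x̃ = x - e`. The
delayed contributions cancel in its update, so `x̃^{k+1} = x̃^k - γ g^k` (`Input.xTilde_succ`),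
while `e^k` is `γ` times the sum of the at most `τ` most recent `g^t` (`Input.eProc_eq`).

Conditionally on the history, the indices, seeds and coins of one iteration are fresh. Integrating
them out makes `g^k` unbiased and bounds its second moment by the optimality gap, `σ₁²` and `σ₂²`;
both variances contract up to multiples of the gap (and of `σ₂²`, for `σ₁²`). The ingredients are
cocoercivity of the component gradients, the bias-variance decomposition, independence of the
workers and `α (ω + 1) ≤ 1`. For the error, each `g^t` is split into its conditional mean and a
noise term. The noises of different iterations are orthogonal, so only the gradients pay the extra
factor `τ`. Quasi strong convexity then gives a descent inequality for `‖x̃ - x*‖²` perturbed by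
`‖e‖²`. In expectation all of this is a system of scalar recursions, `MomentBounds`, proved in
`StandingAssumptions.momentBounds`.

The rest is deterministic. Summing the recursions against the weights `w_k` and using the two
stepsize conditions gives the error inequality of the parametric assumption. It also bounds the
weighted sum of the gaps, but only by `25/2 Φ₀`, since little of the left-hand side survives the
absorption. The unweighted sum loses less and is bounded by `Φ₀` itself (`MomentBounds.sum_gap_le`).
`weighted_average_le` recovers the rate with constant exactly `Φ₀`: while `(1-η)^K ≥ 2η` the
unweighted bound suffices, and afterwards `(1-η)^K W_K ≥ 25/2` absorbs the factor. Jensen's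
inequality passes to `x̄^K`. For the complexity, `η` is bounded below by the reciprocal of `200`
times the stated quantity. -/

namespace DLSVRGDiana

/-! ### Smooth convex functions: quadratic bounds and cocoercivity. -/

section Analysis

variable {d : ℕ}

lemma hasDerivAt_comp_line {φ : Vec d → ℝ} (hφ : Differentiable ℝ φ) (x v : Vec d) (t : ℝ) :
    HasDerivAt (fun t : ℝ => φ (x + t • v)) (inner ℝ (gradient φ (x + t • v)) v) t := by
  have h1 : HasDerivAt (fun t : ℝ => x + t • v) v t := by
    simpa using ((hasDerivAt_id t).smul_const v).const_add x
  have h2 := (hφ (x + t • v)).hasFDerivAt.comp_hasDerivAt t h1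
  rwa [← inner_gradient_left] at h2

/-- Quadratic upper bound for functions with a Lipschitz gradient. -/
lemma LSmooth.le_quadratic {L : ℝ} {φ : Vec d → ℝ} (h : LSmooth L φ) (x y : Vec d) :
    φ y ≤ φ x + inner ℝ (gradient φ x) (y - x) + L / 2 * ‖y - x‖ ^ 2 := by
  set v := y - x with hv
  -- The defect in the quadratic bound along the segment; the Lipschitz condition makes its
  -- derivative nonpositive.
  let ψ : ℝ → ℝ := fun t => φ (x + t • v) - t * inner ℝ (gradient φ x) v - L / 2 * ‖v‖ ^ 2 * t ^ 2
  have hd : ∀ t, HasDerivAt ψ (inner ℝ (gradient φ (x + t • v)) v - inner ℝ (gradient φ x) v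
      - L * ‖v‖ ^ 2 * t) t := by
    intro t
    have h1 := hasDerivAt_comp_line h.1 x v t
    have h2 := (hasDerivAt_id t).mul_const (inner ℝ (gradient φ x) v)
    have h3 := ((hasDerivAt_id t).pow 2).const_mul (L / 2 * ‖v‖ ^ 2)
    refine ((h1.sub h2).sub h3).congr_deriv ?_
    simp only [id_eq, Nat.cast_ofNat, one_mul, mul_one, Nat.add_one_sub_one, pow_one]
    ring
  have hanti : AntitoneOn ψ (Set.Icc 0 1) := by
    refine antitoneOn_of_deriv_nonpos (convex_Icc 0 1)
      (fun t _ => (hd t).continuousAt.continuousWithinAt)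
      (fun t _ => (hd t).differentiableAt.differentiableWithinAt) ?_
    intro t ht
    rw [interior_Icc] at ht
    rw [(hd t).deriv, ← inner_sub_left]
    have h1 := real_inner_le_norm (gradient φ (x + t • v) - gradient φ x) v
    have h2 := h.2 (x + t • v) x
    rw [add_sub_cancel_left, norm_smul, Real.norm_of_nonneg ht.1.le] at h2
    have h3 := mul_le_mul_of_nonneg_right h2 (norm_nonneg v)
    nlinarith
  have := hanti (Set.left_mem_Icc.2 zero_le_one) (Set.right_mem_Icc.2 zero_le_one) zero_le_one
  simp only [ψ, one_smul, zero_smul, add_zero] at this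
  rw [show x + v = y by rw [hv]; abel] at this
  linarith

lemma gradient_inequality {φ : Vec d → ℝ} (hc : ConvexOn ℝ Set.univ φ) (hφ : Differentiable ℝ φ)
    (x y : Vec d) : φ x + inner ℝ (gradient φ x) (y - x) ≤ φ y := by
  have h1 := hasDerivAt_comp_line hφ x (y - x) 0
  have h2 : ConvexOn ℝ Set.univ (fun t : ℝ => φ (x + t • (y - x))) := by
    have := hc.comp_affineMap (AffineMap.lineMap x y : ℝ →ᵃ[ℝ] Vec d)
    simp only [Set.preimage_univ] at this
    refine this.congr fun t _ => ?_
    simp [AffineMap.lineMap_apply, add_comm]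
  have h3 := h2.le_slope_of_hasDerivAt (Set.mem_univ 0) (Set.mem_univ 1) zero_lt_one h1
  rw [slope_def_field, zero_smul, one_smul, add_zero, sub_zero, div_one,
    add_sub_cancel] at h3
  linarith

/-- Cocoercivity of the gradient of a convex smooth function. -/
lemma norm_gradient_sub_sq_le {L : ℝ} (hL : 0 < L) {φ : Vec d → ℝ}
    (hc : ConvexOn ℝ Set.univ φ) (h : LSmooth L φ) (x y : Vec d) :
    ‖gradient φ x - gradient φ y‖ ^ 2 ≤
      2 * L * (φ x - φ y - inner ℝ (gradient φ y) (x - y)) := by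
  set u := gradient φ x - gradient φ y with hu
  -- A gradient step of length `1 / L` from `x` for the convex function `φ - ⟨∇φ(y), ·⟩`, whose
  -- minimizer is `y`. Smoothness bounds `φ z` from above and convexity bounds it from below.
  set z := x - (1 / L) • u with hz
  have h1 := h.le_quadratic x z
  have h2 := gradient_inequality hc h.1 y z
  have e1 : z - x = -((1 / L) • u) := by rw [hz]; abel
  have e2 : z - y = (x - y) - (1 / L) • u := by rw [hz]; abel
  rw [e1, norm_neg, norm_smul, inner_neg_right, inner_smul_right, mul_pow, Real.norm_eq_abs,
    sq_abs] at h1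
  rw [e2, inner_sub_right, inner_smul_right] at h2
  have e3 : inner ℝ (gradient φ x) u - inner ℝ (gradient φ y) u = ‖u‖ ^ 2 := by
    rw [← inner_sub_left, ← hu, real_inner_self_eq_norm_sq]
  have e4 : L / 2 * ((1 / L) ^ 2 * ‖u‖ ^ 2) = 1 / (2 * L) * ‖u‖ ^ 2 := by field_simp
  have e5 : 1 / L * inner ℝ (gradient φ x) u - 1 / L * inner ℝ (gradient φ y) u
      = 2 * (1 / (2 * L) * ‖u‖ ^ 2) := by rw [← mul_sub, e3]; field_simp
  have h6 : 1 / (2 * L) * ‖u‖ ^ 2 ≤ φ x - φ y - inner ℝ (gradient φ y) (x - y) := by linarith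
  calc ‖u‖ ^ 2 = 2 * L * (1 / (2 * L) * ‖u‖ ^ 2) := by field_simp
    _ ≤ _ := by gcongr

lemma LSmooth.continuous_gradient {L : ℝ} (hL : 0 < L) {φ : Vec d → ℝ} (h : LSmooth L φ) :
    Continuous (gradient φ) := by
  refine (LipschitzWith.of_dist_le_mul (K := ⟨L, hL.le⟩) fun x y => ?_).continuous
  rw [dist_eq_norm, dist_eq_norm]
  exact h.2 x y

/-- Convexity of the squared norm for averages. -/
lemma norm_sum_sq_le {ι E : Type*} [SeminormedAddCommGroup E] (s : Finset ι) (u : ι → E) :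
    ‖∑ i ∈ s, u i‖ ^ 2 ≤ s.card * ∑ i ∈ s, ‖u i‖ ^ 2 :=
  (pow_le_pow_left₀ (norm_nonneg _) (norm_sum_le s u) 2).trans
    (sq_sum_le_card_mul_sum_sq (s := s) (f := fun i => ‖u i‖))

lemma norm_avg_sq_le {n : ℕ} (hn : 1 ≤ n) (u : Fin n → Vec d) :
    ‖avg u‖ ^ 2 ≤ (1 / (n : ℝ)) * ∑ i, ‖u i‖ ^ 2 := by
  have hn' : (0 : ℝ) < n := by exact_mod_cast hn
  have h := norm_sum_sq_le Finset.univ u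
  rw [Finset.card_univ, Fintype.card_fin] at h
  rw [avg, norm_smul, mul_pow, Real.norm_of_nonneg (by positivity)]
  calc (1 / (n : ℝ)) ^ 2 * ‖∑ i, u i‖ ^ 2 ≤ (1 / (n : ℝ)) ^ 2 * (n * ∑ i, ‖u i‖ ^ 2) := by gcongr
    _ = _ := by field_simp

end Analysis

/-! ### The finite-sum objective and its gradients. -/

section FiniteSum

variable {d n m : ℕ} {F : Fin n → Fin m → Vec d → ℝ} {xs : Vec d} {L μ : ℝ}

lemma hasGradientAt_average {N : ℕ} {φ : Fin N → Vec d → ℝ} (h : ∀ i, Differentiable ℝ (φ i))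
    (x : Vec d) : HasGradientAt (fun y => (1 / (N : ℝ)) * ∑ i, φ i y)
      (avg fun i => gradient (φ i) x) x := by
  rw [hasGradientAt_iff_hasFDerivAt]
  have h1 := (HasFDerivAt.fun_sum fun i (_ : i ∈ Finset.univ) =>
    (h i x).hasGradientAt.hasFDerivAt).const_mul (1 / (N : ℝ))
  refine h1.congr_fderiv ?_
  simp [avg, map_smul, map_sum]

lemma differentiable_localObj (hs : ∀ i j, LSmooth L (F i j)) (i : Fin n) :
    Differentiable ℝ (localObj F i) :=
  fun x => (hasGradientAt_average (fun j => (hs i j).1) x).differentiableAt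

lemma gradient_localObj (hs : ∀ i j, LSmooth L (F i j)) (i : Fin n) (x : Vec d) :
    gradient (localObj F i) x = avg fun j => gradient (F i j) x :=
  (hasGradientAt_average (fun j => (hs i j).1) x).gradient

lemma hasGradientAt_objective (hs : ∀ i j, LSmooth L (F i j)) (x : Vec d) :
    HasGradientAt (objective F) (avg fun i => gradient (localObj F i) x) x :=
  hasGradientAt_average (differentiable_localObj hs) x

lemma gradient_objective (hs : ∀ i j, LSmooth L (F i j)) (x : Vec d) :
    gradient (objective F) x = avg fun i => gradient (localObj F i) x :=
  (hasGradientAt_objective hs x).gradient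

lemma differentiable_objective (hs : ∀ i j, LSmooth L (F i j)) :
    Differentiable ℝ (objective F) := fun x => (hasGradientAt_objective hs x).differentiableAt

lemma gradient_objective_minimizer (hq : QuasiStronglyConvex μ (objective F) xs) :
    gradient (objective F) xs = 0 := by
  have h : IsLocalMin (objective F) xs := Filter.Eventually.of_forall hq.1
  rw [gradient, h.fderiv_eq_zero, map_zero]

lemma objective_eq_sum (x : Vec d) :
    objective F x = 1 / ((n : ℝ) * m) * ∑ i, ∑ j, F i j x := by
  simp only [objective, localObj, ← Finset.mul_sum]
  rw [one_div_mul_eq_div, one_div_mul_eq_div, one_div_mul_eq_div, div_div, mul_comm (m : ℝ)]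

lemma inner_gradient_objective (hs : ∀ i j, LSmooth L (F i j)) (x v : Vec d) :
    inner ℝ (gradient (objective F) x) v
      = 1 / ((n : ℝ) * m) * ∑ i, ∑ j, inner ℝ (gradient (F i j) x) v := by
  rw [gradient_objective hs]
  simp only [gradient_localObj hs, avg, inner_smul_left, sum_inner, ← Finset.smul_sum]
  simp only [map_div₀, map_one, map_natCast]
  field_simp

lemma convexOn_objective (hc : ∀ i j, ConvexOn ℝ Set.univ (F i j)) :
    ConvexOn ℝ Set.univ (objective F) := by
  refine ⟨convex_univ, fun x _ y _ a b ha hb hab => ?_⟩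
  simp only [objective_eq_sum, smul_eq_mul]
  calc 1 / ((n : ℝ) * m) * ∑ i, ∑ j, F i j (a • x + b • y)
      ≤ 1 / ((n : ℝ) * m) * ∑ i, ∑ j, (a * F i j x + b * F i j y) := by
        gcongr with i _ j _
        exact (hc i j).2 (Set.mem_univ x) (Set.mem_univ y) ha hb hab
    _ = _ := by simp only [Finset.sum_add_distrib, ← Finset.mul_sum]; ring

/-- The average squared deviation of the component gradients from those at the minimizer. -/
lemma average_gradient_deviation_le (hL : 0 < L) (hc : ∀ i j, ConvexOn ℝ Set.univ (F i j))
    (hs : ∀ i j, LSmooth L (F i j)) (hq : QuasiStronglyConvex μ (objective F) xs) (x : Vec d) :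
    1 / ((n : ℝ) * m) * ∑ i, ∑ j, ‖gradient (F i j) x - gradient (F i j) xs‖ ^ 2 ≤
      2 * L * (objective F x - objective F xs) := by
  have h0 := inner_gradient_objective hs xs (x - xs)
  rw [gradient_objective_minimizer hq, inner_zero_left] at h0
  calc _ ≤ 1 / ((n : ℝ) * m) * ∑ i, ∑ j,
        2 * L * (F i j x - F i j xs - inner ℝ (gradient (F i j) xs) (x - xs)) := by
        gcongr with i _ j _
        exact norm_gradient_sub_sq_le hL (hc i j) (hs i j) x xs
    _ = 2 * L * (objective F x - objective F xs
          - 1 / ((n : ℝ) * m) * ∑ i, ∑ j, inner ℝ (gradient (F i j) xs) (x - xs)) := by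
        simp only [objective_eq_sum, ← Finset.mul_sum, Finset.sum_sub_distrib]; ring
    _ = _ := by rw [← h0, sub_zero]

/-- As `∇f(x*) = 0`, the gradient is a double average of the deviations `∇f_{ij}(x) - ∇f_{ij}(x*)`,
and Jensen's inequality applies to each average. -/
lemma norm_gradient_objective_sq_le (hn : 1 ≤ n) (hm : 1 ≤ m) (hL : 0 < L)
    (hc : ∀ i j, ConvexOn ℝ Set.univ (F i j)) (hs : ∀ i j, LSmooth L (F i j))
    (hq : QuasiStronglyConvex μ (objective F) xs) (x : Vec d) :
    ‖gradient (objective F) x‖ ^ 2 ≤ 2 * L * (objective F x - objective F xs) := by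
  refine le_trans ?_ (average_gradient_deviation_le hL hc hs hq x)
  have h1 : gradient (objective F) x
      = avg fun i => avg fun j => gradient (F i j) x - gradient (F i j) xs := by
    rw [← sub_zero (gradient (objective F) x), ← gradient_objective_minimizer hq,
      gradient_objective hs, gradient_objective hs]
    simp only [gradient_localObj hs, avg, Finset.sum_sub_distrib, smul_sub]
  rw [h1]
  calc _ ≤ (1 / (n : ℝ)) * ∑ i,
        ‖avg fun j => gradient (F i j) x - gradient (F i j) xs‖ ^ 2 := norm_avg_sq_le hn _
    _ ≤ (1 / (n : ℝ)) * ∑ i, (1 / (m : ℝ)) * ∑ j, ‖gradient (F i j) x - gradient (F i j) xs‖ ^ 2 := by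
        gcongr with i _
        exact norm_avg_sq_le hm _
    _ = _ := by rw [← Finset.mul_sum]; field_simp

/-- Square integrability of an iterate thereby gives integrability of its optimality gap. -/
lemma objective_sub_le (hn : 1 ≤ n) (hm : 1 ≤ m) (hs : ∀ i j, LSmooth L (F i j))
    (hq : QuasiStronglyConvex μ (objective F) xs) (x : Vec d) :
    objective F x - objective F xs ≤ L / 2 * ‖x - xs‖ ^ 2 := by
  have hn' : (n : ℝ) ≠ 0 := by positivity
  have hm' : (m : ℝ) ≠ 0 := by positivity
  have h0 := inner_gradient_objective hs xs (x - xs)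
  rw [gradient_objective_minimizer hq, inner_zero_left] at h0
  have h1 : objective F x ≤ 1 / ((n : ℝ) * m) * ∑ i, ∑ j,
      (F i j xs + inner ℝ (gradient (F i j) xs) (x - xs) + L / 2 * ‖x - xs‖ ^ 2) := by
    rw [objective_eq_sum]
    gcongr with i _ j _
    exact (hs i j).le_quadratic xs x
  simp only [Finset.sum_add_distrib, mul_add, ← h0, ← objective_eq_sum] at h1
  simp only [Finset.sum_const, Finset.card_univ, Fintype.card_fin, nsmul_eq_mul] at h1
  have h2 : 1 / ((n : ℝ) * m) * (n * (m * (L / 2 * ‖x - xs‖ ^ 2))) = L / 2 * ‖x - xs‖ ^ 2 := by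
    field_simp
  linarith

/-- The quasi strong convexity modulus is at most the smoothness constant, unless the space is
trivial. -/
lemma modulus_mul_norm_sq_le (hn : 1 ≤ n) (hm : 1 ≤ m) (hL : 0 < L)
    (hc : ∀ i j, ConvexOn ℝ Set.univ (F i j)) (hs : ∀ i j, LSmooth L (F i j))
    (hq : QuasiStronglyConvex μ (objective F) xs) (v : Vec d) :
    μ * ‖v‖ ^ 2 ≤ L * ‖v‖ ^ 2 := by
  have h1 := hq.2 (xs + v)
  have h2 := norm_gradient_objective_sq_le hn hm hL hc hs hq (xs + v)
  rw [show xs - (xs + v) = -v by abel, show xs + v - xs = v by abel, inner_neg_right] at h1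
  have h3 := real_inner_le_norm (gradient (objective F) (xs + v)) v
  set G := ‖gradient (objective F) (xs + v)‖
  -- Quasi strong convexity gives `gap + μ/2 ‖v‖² ≤ G ‖v‖`. With `G² ≤ 2L gap` this yields `Lμ‖v‖² ≤
  -- 2LG‖v‖ - G²`, which is at most `L²‖v‖²`.
  have h4 : 0 ≤ (G - L * ‖v‖) ^ 2 := sq_nonneg _
  have h5 : L * (μ * ‖v‖ ^ 2) ≤ L * (L * ‖v‖ ^ 2) := by nlinarith
  exact le_of_mul_le_mul_left h5 hL

end FiniteSum

/-! ### Scalar recursions and their weighted sums. -/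

section Sequences

lemma weight_pos {θ : ℝ} (hθ : θ < 1) (k : ℕ) : 0 < weight θ k :=
  inv_pos.2 (pow_pos (by linarith) _)

lemma one_sub_mul_weight {θ : ℝ} (hθ : θ < 1) (k : ℕ) :
    (1 - θ) * weight θ k = ((1 - θ) ^ k)⁻¹ := by
  have : (1 - θ) ≠ 0 := by linarith
  rw [weight, pow_succ]
  field_simp

/-- A weighted sum of a sequence that contracts up to a perturbation `b`. -/
lemma weighted_sum_le {θ ρ : ℝ} (hθ : θ < 1) {s b : ℕ → ℝ}
    (hrec : ∀ k, s (k + 1) ≤ (1 - ρ) * s k + b k) (N : ℕ) :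
    (ρ - θ) * ∑ k ∈ Finset.range N, weight θ k * s k + ((1 - θ) ^ N)⁻¹ * s N ≤
      s 0 + ∑ k ∈ Finset.range N, weight θ k * b k := by
  induction N with
  | zero => simp
  | succ N ih =>
    rw [Finset.sum_range_succ, Finset.sum_range_succ]
    -- The recursion times `w_N` telescopes, because `(1 - θ) w_N` is the factor of `s N` in the
    -- induction hypothesis; the excess `ρ - θ` is kept in the sum.
    have h1 := mul_le_mul_of_nonneg_left (hrec N) (weight_pos hθ N).le
    have h2 := one_sub_mul_weight hθ N
    have h3 : ((1 - θ) ^ (N + 1))⁻¹ = weight θ N := rfl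
    rw [h3]
    rw [← h2] at ih
    linarith

/-- Exchanging a weighted sum with a sum over a window of length `τ`. -/
lemma weighted_window_sum_le {w b : ℕ → ℝ} {τ : ℕ} {c : ℝ} (hw : ∀ k, 0 ≤ w k)
    (hb : ∀ k, 0 ≤ b k) (hc : 0 ≤ c) (hwc : ∀ t k, t < k → k ≤ t + τ → w k ≤ c * w t) (N : ℕ) :
    ∑ k ∈ Finset.range N, w k * ∑ t ∈ Finset.Ico (k - τ) k, b t ≤
      c * τ * ∑ t ∈ Finset.range N, w t * b t := by
  calc ∑ k ∈ Finset.range N, w k * ∑ t ∈ Finset.Ico (k - τ) k, b t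
      ≤ ∑ k ∈ Finset.range N, ∑ t ∈ Finset.Ico (k - τ) k, c * (w t * b t) := by
        refine Finset.sum_le_sum fun k _ => ?_
        rw [Finset.mul_sum]
        refine Finset.sum_le_sum fun t ht => ?_
        rw [Finset.mem_Ico] at ht
        have := mul_le_mul_of_nonneg_right (hwc t k ht.2 (by omega)) (hb t)
        linarith
    -- A fixed `t` lies only in the windows of `k = t + 1, …, t + τ`, hence the factor `τ`.
    _ = ∑ t ∈ Finset.range N, ∑ k ∈ (Finset.Ioc t (t + τ)).filter (· < N), c * (w t * b t) := by
        refine Finset.sum_comm' fun k t => ?_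
        simp only [Finset.mem_range, Finset.mem_Ico, Finset.mem_filter, Finset.mem_Ioc]
        omega
    _ ≤ ∑ t ∈ Finset.range N, (τ : ℝ) * (c * (w t * b t)) := by
        refine Finset.sum_le_sum fun t _ => ?_
        rw [Finset.sum_const, nsmul_eq_mul]
        have h1 : ((Finset.Ioc t (t + τ)).filter (· < N)).card ≤ τ := by
          refine (Finset.card_filter_le _ _).trans ?_
          simp
        have h2 : 0 ≤ c * (w t * b t) := mul_nonneg hc (mul_nonneg (hw t) (hb t))
        gcongr
    _ = _ := by simp only [Finset.mul_sum]; refine Finset.sum_congr rfl fun t _ => by ring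

/-- Bernoulli's inequality: over at most `τ` steps the weight grows by a factor at most `(1 -
θ)^{-τ} ≤ (1 - θτ)⁻¹ ≤ c`. -/
lemma weight_le_mul_weight {θ c : ℝ} {τ : ℕ} (hθ0 : 0 ≤ θ) (hθ : θ < 1) (hc : 0 ≤ c)
    (h : 1 ≤ c * (1 - θ * τ)) (t k : ℕ) (htk : t < k) (hk : k ≤ t + τ) :
    weight θ k ≤ c * weight θ t := by
  obtain ⟨j, rfl⟩ := Nat.exists_eq_add_of_lt htk
  have h1 : 1 + (τ : ℝ) * (-θ) ≤ (1 + -θ) ^ τ := one_add_mul_le_pow (by linarith) τ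
  rw [← sub_eq_add_neg] at h1
  have h2 : (1 - θ) ^ τ ≤ (1 - θ) ^ (j + 1) :=
    pow_le_pow_of_le_one (by linarith) (by linarith) (by omega)
  have h3 : 1 ≤ c * (1 - θ) ^ (j + 1) := by
    refine h.trans (mul_le_mul_of_nonneg_left ?_ hc)
    linarith
  have hpos : 0 < (1 - θ) ^ (t + j + 1 + 1) := pow_pos (by linarith) _
  have hpos' : 0 < (1 - θ) ^ (t + 1) := pow_pos (by linarith) _
  rw [weight, weight, inv_le_iff_one_le_mul₀ hpos]
  have h4 : (1 - θ) ^ (t + j + 1 + 1) = (1 - θ) ^ (t + 1) * (1 - θ) ^ (j + 1) := by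
    rw [← pow_add]; congr 1; omega
  rw [h4]
  calc 1 ≤ c * (1 - θ) ^ (j + 1) := h3
    _ = _ := by field_simp

/-- The recursive bounds satisfied by the expectations of `f(x^k) - f(x*)`, `σ_{1,k}²`, `σ_{2,k}²`,
`‖e^k‖²`, `‖x̃^k - x*‖²` and `‖g^k‖²`, where `a` stands for `ω / n`. -/
structure MomentBounds (L μ γ α p a : ℝ) (τ : ℕ) (r s₁ s₂ E D q : ℕ → ℝ) : Prop where
  r_nonneg : ∀ k, 0 ≤ r k
  s₁_nonneg : ∀ k, 0 ≤ s₁ k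
  s₂_nonneg : ∀ k, 0 ≤ s₂ k
  D_nonneg : ∀ k, 0 ≤ D k
  q_nonneg : ∀ k, 0 ≤ q k
  q_le : ∀ k, q k ≤ 4 * L * (1 + 2 * a) * r k + 2 * a * s₁ k + 2 * (1 + 2 * a) * s₂ k
  s₁_rec : ∀ k, s₁ (k + 1) ≤ (1 - α) * s₁ k + (4 * L * α * r k + 2 * α * s₂ k)
  s₂_rec : ∀ k, s₂ (k + 1) ≤ (1 - p) * s₂ k + 2 * L * p * r k
  E_le : ∀ k, E k ≤ γ ^ 2 * ∑ t ∈ Finset.Ico (k - τ) k, (4 * L * τ * r t + 2 * q t)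
  D_rec : ∀ k, D (k + 1) ≤ (1 - γ * μ / 2) * D k + (3 * L * γ * E k + γ ^ 2 * q k - γ * r k)

/-- Bounds for the weighted sums of all the sequences in `MomentBounds`. -/
lemma MomentBounds.weighted_sums {L μ γ α p a : ℝ} {τ : ℕ} {r s₁ s₂ E D q : ℕ → ℝ}
    (H : MomentBounds L μ γ α p a τ r s₁ s₂ E D q) (hL : 0 < L)
    (hα : 0 < α) (hp : 0 < p) {θ κ c : ℝ} (hθ0 : 0 ≤ θ) (hθ : θ < 1)
    (hθμ : θ ≤ γ * μ / 2) (hκ : 0 ≤ κ) (hκα : α ≤ κ * (α - θ)) (hκp : p ≤ κ * (p - θ))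
    (hc : 0 ≤ c) (hcτ : 1 ≤ c * (1 - θ * τ)) (N : ℕ) :
    ∃ S₁ S₂ T Q : ℝ, S₁ ≤ κ * (s₁ 0 / α + 4 * L * (∑ k ∈ Finset.range N, weight θ k * r k) + 2 * S₂) ∧
      S₂ ≤ κ * (s₂ 0 / p + 2 * L * ∑ k ∈ Finset.range N, weight θ k * r k) ∧
      Q ≤ 4 * L * (1 + 2 * a) * (∑ k ∈ Finset.range N, weight θ k * r k) + 2 * a * S₁
        + 2 * (1 + 2 * a) * S₂ ∧
      (∑ k ∈ Finset.range N, weight θ k * E k ≤ T) ∧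
      T = c * γ ^ 2 * τ * (4 * L * τ * (∑ k ∈ Finset.range N, weight θ k * r k) + 2 * Q) ∧
      γ * (∑ k ∈ Finset.range N, weight θ k * r k) ≤
        D 0 + 3 * L * γ * (∑ k ∈ Finset.range N, weight θ k * E k) + γ ^ 2 * Q := by
  have hw := fun k => (weight_pos hθ k).le
  have hpow : 0 ≤ ((1 - θ) ^ N)⁻¹ := inv_nonneg.2 (pow_nonneg (by linarith) _)
  set R := ∑ k ∈ Finset.range N, weight θ k * r k with hR
  set S₁ := ∑ k ∈ Finset.range N, weight θ k * s₁ k with hS₁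
  set S₂ := ∑ k ∈ Finset.range N, weight θ k * s₂ k with hS₂
  set Q := ∑ k ∈ Finset.range N, weight θ k * q k with hQ
  have hS₁0 : 0 ≤ S₁ := Finset.sum_nonneg fun k _ => mul_nonneg (hw k) (H.s₁_nonneg k)
  have hS₂0 : 0 ≤ S₂ := Finset.sum_nonneg fun k _ => mul_nonneg (hw k) (H.s₂_nonneg k)
  refine ⟨S₁, S₂, _, Q, ?_, ?_, ?_, ?_, rfl, ?_⟩
  · have h1 := weighted_sum_le hθ H.s₁_rec N
    have h2 : ∑ k ∈ Finset.range N, weight θ k * (4 * L * α * r k + 2 * α * s₂ k)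
        = 4 * L * α * R + 2 * α * S₂ := by
      rw [hR, hS₂, Finset.mul_sum, Finset.mul_sum, ← Finset.sum_add_distrib]
      exact Finset.sum_congr rfl fun k _ => by ring
    have h3 := mul_nonneg hpow (H.s₁_nonneg N)
    rw [h2] at h1
    have h4 : (α - θ) * S₁ ≤ s₁ 0 + (4 * L * α * R + 2 * α * S₂) := by linarith
    have h5 := mul_le_mul_of_nonneg_right hκα hS₁0
    have h6 := mul_le_mul_of_nonneg_left h4 hκ
    refine le_of_mul_le_mul_left ?_ hα
    calc α * S₁ ≤ κ * (s₁ 0 + (4 * L * α * R + 2 * α * S₂)) := by linarith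
      _ = _ := by field_simp; ring
  · have h1 := weighted_sum_le hθ H.s₂_rec N
    have h2 : ∑ k ∈ Finset.range N, weight θ k * (2 * L * p * r k) = 2 * L * p * R := by
      rw [hR, Finset.mul_sum]
      exact Finset.sum_congr rfl fun k _ => by ring
    have h3 := mul_nonneg hpow (H.s₂_nonneg N)
    rw [h2] at h1
    have h4 : (p - θ) * S₂ ≤ s₂ 0 + 2 * L * p * R := by linarith
    have h5 := mul_le_mul_of_nonneg_right hκp hS₂0
    have h6 := mul_le_mul_of_nonneg_left h4 hκ
    refine le_of_mul_le_mul_left ?_ hp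
    calc p * S₂ ≤ κ * (s₂ 0 + 2 * L * p * R) := by linarith
      _ = _ := by field_simp
  · rw [hQ, hR, hS₁, hS₂, Finset.mul_sum, Finset.mul_sum, Finset.mul_sum,
      ← Finset.sum_add_distrib, ← Finset.sum_add_distrib]
    refine Finset.sum_le_sum fun k _ => ?_
    have := mul_le_mul_of_nonneg_left (H.q_le k) (hw k)
    linarith
  · calc ∑ k ∈ Finset.range N, weight θ k * E k
        ≤ ∑ k ∈ Finset.range N, γ ^ 2 * (weight θ k *
            ∑ t ∈ Finset.Ico (k - τ) k, (4 * L * τ * r t + 2 * q t)) := by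
          refine Finset.sum_le_sum fun k _ => ?_
          have := mul_le_mul_of_nonneg_left (H.E_le k) (hw k)
          linarith
      _ = γ ^ 2 * ∑ k ∈ Finset.range N, weight θ k *
            ∑ t ∈ Finset.Ico (k - τ) k, (4 * L * τ * r t + 2 * q t) := by rw [Finset.mul_sum]
      _ ≤ γ ^ 2 * (c * τ * ∑ t ∈ Finset.range N, weight θ t * (4 * L * τ * r t + 2 * q t)) := by
          gcongr
          refine weighted_window_sum_le hw (fun t => ?_) hc
            (fun t k => weight_le_mul_weight hθ0 hθ hc hcτ t k) N
          have := H.r_nonneg t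
          have := H.q_nonneg t
          positivity
      _ = _ := by
          have : ∑ t ∈ Finset.range N, weight θ t * (4 * L * τ * r t + 2 * q t)
              = 4 * L * τ * R + 2 * Q := by
            rw [hR, hQ, Finset.mul_sum, Finset.mul_sum, ← Finset.sum_add_distrib]
            exact Finset.sum_congr rfl fun k _ => by ring
          rw [this]; ring
  · have hD : ∀ k, D (k + 1) ≤ (1 - θ) * D k + (3 * L * γ * E k + γ ^ 2 * q k - γ * r k) := by
      intro k
      have := mul_le_mul_of_nonneg_right hθμ (H.D_nonneg k)
      have := H.D_rec k
      linarith
    have h1 := weighted_sum_le hθ hD N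
    have h2 : ∑ k ∈ Finset.range N, weight θ k * (3 * L * γ * E k + γ ^ 2 * q k - γ * r k)
        = 3 * L * γ * (∑ k ∈ Finset.range N, weight θ k * E k) + γ ^ 2 * Q - γ * R := by
      rw [hR, hQ, Finset.mul_sum, Finset.mul_sum, Finset.mul_sum, ← Finset.sum_add_distrib,
        ← Finset.sum_sub_distrib]
      exact Finset.sum_congr rfl fun k _ => by ring
    have h3 := mul_nonneg hpow (H.D_nonneg N)
    rw [h2] at h1
    linarith

/-- The unweighted sum of the optimality gaps, with the constants of the initial gap. -/
lemma MomentBounds.sum_gap_le {L μ γ α p a : ℝ} {τ : ℕ} {r s₁ s₂ E D q : ℕ → ℝ}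
    (H : MomentBounds L μ γ α p a τ r s₁ s₂ E D q) (hL : 0 < L) (hμ : 0 ≤ μ) (hγ : 0 < γ)
    (hα : 0 < α) (hp : 0 < p) (ha : 0 ≤ a) (hγ₁ : 8 * (γ * L) * (37 / 9 + 8 * a) ≤ 1)
    (hγ₂ : 64 * (γ * L) ^ 2 * (τ * (τ + 6 + 40 * a)) ≤ 1) (N : ℕ) :
    γ * ∑ k ∈ Finset.range N, r k ≤ 4 * (D 0
      + γ ^ 2 * (8 / 3 * a + 24 * (γ * L * τ) * a) * (s₁ 0 / α)
      + γ ^ 2 * ((56 + 48 * a) / 9 + 24 * (γ * L * τ) * (1 + 6 * a)) * (s₂ 0 / p)) := by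
  -- With `θ = 0` all weights are one, and nothing is lost to the contraction factors or the delay
  -- windows.
  obtain ⟨S₁, S₂, T, Q, h₁, h₂, h₃, h₄, h₅, h₆⟩ := H.weighted_sums hL hα hp (θ := 0) (κ := 1)
    (c := 1) le_rfl one_pos (by positivity) zero_le_one (by linarith) (by linarith) zero_le_one
    (by simp) N
  have hw : ∀ k, weight 0 k = 1 := fun k => by simp [weight]
  simp only [hw, one_mul] at h₁ h₂ h₃ h₄ h₅ h₆
  have hR : 0 ≤ ∑ k ∈ Finset.range N, r k := Finset.sum_nonneg fun k _ => H.r_nonneg k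
  set R := ∑ k ∈ Finset.range N, r k
  set Es := ∑ k ∈ Finset.range N, E k
  have hD := H.D_nonneg 0
  have hX₁ : 0 ≤ s₁ 0 / α := div_nonneg (H.s₁_nonneg 0) hα.le
  have hX₂ : 0 ≤ s₂ 0 / p := div_nonneg (H.s₂_nonneg 0) hp.le
  set X₁ := s₁ 0 / α
  set X₂ := s₂ 0 / p
  have hQ : Q ≤ L * R * (8 + 32 * a) + (2 * a * X₁ + (2 + 8 * a) * X₂) := by
    have e1 := mul_le_mul_of_nonneg_left h₁ ha
    have e2 := mul_le_mul_of_nonneg_left h₂ ha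
    linarith
  set V := 2 * a * X₁ + (2 + 8 * a) * X₂ with hV
  set u := γ * L * τ with hu
  set y := γ * L * (8 + 32 * a) with hy
  have hγL : 0 < γ * L := by positivity
  have hu0 : 0 ≤ u := by positivity
  have hy0 : 0 ≤ y := by positivity
  -- The two conditions on the stepsize enter here and in `hloss`: the gap terms of `γ²Q` cost at
  -- most `1/2`, those of the error at most `12/64 = 3/16`. This leaves `κ ≥ 5/16`.
  have hy2 : y ≤ 1 / 2 := by linarith only [hγ₁, hγL, hy]
  have hloss : 12 * u ^ 2 + 6 * u * y ≤ 3 / 16 := by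
    have : 12 * u ^ 2 + 6 * u * y = 12 * ((γ * L) ^ 2 * (τ * (τ + 4 + 16 * a))) := by
      rw [hu, hy]; ring
    rw [this]
    have : (γ * L) ^ 2 * (τ * (τ + 4 + 16 * a)) ≤ (γ * L) ^ 2 * (τ * (τ + 6 + 40 * a)) := by
      gcongr <;> linarith
    linarith
  have hmain : γ * R * (1 - 12 * u ^ 2 - 6 * u * y - y) ≤ D 0 + γ ^ 2 * (1 + 6 * u) * V := by
    have e1 : 3 * L * γ * Es ≤ 3 * L * γ * T := by gcongr
    have e2 : 3 * L * γ * T + γ ^ 2 * Q = 12 * u ^ 2 * (γ * R) + γ ^ 2 * (1 + 6 * u) * Q := by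
      rw [h₅, hu]; ring
    have e3 : γ ^ 2 * (1 + 6 * u) * Q ≤ γ ^ 2 * (1 + 6 * u) * (L * R * (8 + 32 * a) + V) := by
      gcongr
    have e4 : γ ^ 2 * (1 + 6 * u) * (L * R * (8 + 32 * a) + V)
        = γ * R * y + 6 * u * y * (γ * R) + γ ^ 2 * (1 + 6 * u) * V := by
      rw [hy]; ring
    linarith
  set κ := 1 - 12 * u ^ 2 - 6 * u * y - y with hκ
  have hκ1 : 5 / 16 ≤ κ := by linarith
  have c1 : (1 + 6 * u) * (2 * a) ≤ 4 * κ * (8 / 3 * a + 24 * u * a) := by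
    have : 4 * (5 / 16) * (8 / 3 * a + 24 * u * a) ≤ 4 * κ * (8 / 3 * a + 24 * u * a) := by
      gcongr
    have := mul_nonneg hu0 ha
    linarith
  have c2 : (1 + 6 * u) * (2 + 8 * a) ≤ 4 * κ * ((56 + 48 * a) / 9 + 24 * u * (1 + 6 * a)) := by
    have hua := mul_nonneg hu0 ha
    -- With `κ ≥ 5/16` alone the coefficient of `a` in `M₂` is too small: `5/4 · 48/9 < 8`. For
    -- small `u` the error loss is negligible and `κ ≥ 9/20`; otherwise the term in `u * a` makes up
    -- the deficit.
    rcases le_total u (1 / 90) with hu9 | hu9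
    · have hκ2 : 9 / 20 ≤ κ := by
        have f1 : u * y ≤ 1 / 90 * (1 / 2) := mul_le_mul hu9 hy2 hy0 (by norm_num)
        have f2 : u ^ 2 ≤ (1 / 90) ^ 2 := pow_le_pow_left₀ hu0 hu9 2
        rw [hκ]
        linarith
      have : 4 * (9 / 20) * ((56 + 48 * a) / 9 + 24 * u * (1 + 6 * a))
          ≤ 4 * κ * ((56 + 48 * a) / 9 + 24 * u * (1 + 6 * a)) := by gcongr
      linarith
    · have : 4 * (5 / 16) * ((56 + 48 * a) / 9 + 24 * u * (1 + 6 * a))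
          ≤ 4 * κ * ((56 + 48 * a) / 9 + 24 * u * (1 + 6 * a)) := by gcongr
      have := mul_le_mul_of_nonneg_right hu9 ha
      linarith
  have hκpos : 0 < κ := by linarith
  refine le_of_mul_le_mul_left ?_ hκpos
  have d1 := mul_le_mul_of_nonneg_left (mul_le_mul_of_nonneg_right c1 hX₁) (sq_nonneg γ)
  have d2 := mul_le_mul_of_nonneg_left (mul_le_mul_of_nonneg_right c2 hX₂) (sq_nonneg γ)
  have d3 := mul_le_mul_of_nonneg_right (show 1 ≤ 4 * κ by linarith) hD
  have d4 : γ ^ 2 * (1 + 6 * u) * V = γ ^ 2 * ((1 + 6 * u) * (2 * a) * X₁)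
      + γ ^ 2 * ((1 + 6 * u) * (2 + 8 * a) * X₂) := by rw [hV]; ring
  calc κ * (γ * R) ≤ D 0 + γ ^ 2 * (1 + 6 * u) * V := by linarith
    _ ≤ 4 * κ * D 0 + γ ^ 2 * (4 * κ * (8 / 3 * a + 24 * u * a) * X₁)
        + γ ^ 2 * (4 * κ * ((56 + 48 * a) / 9 + 24 * u * (1 + 6 * a)) * X₂) := by linarith
    _ = _ := by ring

/-- The weighted sum of the errors and of the optimality gaps. -/
lemma MomentBounds.weighted_error_and_gap_le {L μ γ α p a : ℝ} {τ : ℕ} {r s₁ s₂ E D q : ℕ → ℝ}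
    (H : MomentBounds L μ γ α p a τ r s₁ s₂ E D q) (hL : 0 < L) (hγ : 0 < γ)
    (hα : 0 < α) (hp : 0 < p) (ha : 0 ≤ a) (hγ₁ : 8 * (γ * L) * (37 / 9 + 8 * a) ≤ 1)
    (hγ₂ : 64 * (γ * L) ^ 2 * (τ * (τ + 6 + 40 * a)) ≤ 1) {θ : ℝ} (hθ0 : 0 ≤ θ)
    (hθμ : θ ≤ γ * μ / 2) (hθL : θ ≤ γ * L / 2) (hθα : θ ≤ α / 4) (hθp : θ ≤ p / 4) (N : ℕ) :
    3 * L * ∑ k ∈ Finset.range N, weight θ k * E k ≤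
        1 / 4 * ∑ k ∈ Finset.range N, weight θ k * r k
        + 24 * γ ^ 2 * L * τ * a * (s₁ 0 / α) + 24 * γ ^ 2 * L * τ * (1 + 6 * a) * (s₂ 0 / p) ∧
      γ * ∑ k ∈ Finset.range N, weight θ k * r k ≤ 50 * (D 0 + γ ^ 2 * (8 / 3 * a) * (s₁ 0 / α)
        + γ ^ 2 * ((56 + 48 * a) / 9) * (s₂ 0 / p)) := by
  have hγL : 0 < γ * L := by positivity
  have hγL1 : γ * L ≤ 1 / 30 := by linarith only [hγ₁, hγL, mul_nonneg hγL.le ha]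
  have hθ : θ < 1 := by linarith
  have hu0 : 0 ≤ γ * L * τ := by positivity
  -- Only the `τ²` part of the second stepsize condition is used.
  have hu8 : γ * L * τ ≤ 1 / 8 := by
    have h1 : (0 : ℝ) ≤ τ := by positivity
    have h2 : (8 * (γ * L * τ)) ^ 2 ≤ 1 ^ 2 := by
      have : 64 * (γ * L) ^ 2 * (τ * τ) ≤ 64 * (γ * L) ^ 2 * (τ * (τ + 6 + 40 * a)) := by
        gcongr; linarith
      nlinarith
    have := le_of_abs_le (abs_le_of_sq_le_sq h2 zero_le_one)
    linarith
  have hθτ : θ * τ ≤ 1 / 8 := by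
    have : θ * τ ≤ γ * L / 2 * τ := by gcongr
    linarith
  -- `κ = 4/3` comes from `θ ≤ α/4` and `θ ≤ p/4`, and `c = 8/7` from `θτ ≤ 1/8`.
  obtain ⟨S₁, S₂, T, Q, h₁, h₂, h₃, h₄, h₅, h₆⟩ := H.weighted_sums hL hα hp (θ := θ)
    (κ := 4 / 3) (c := 8 / 7) hθ0 hθ hθμ (by norm_num) (by linarith) (by linarith) (by norm_num)
    (by linarith) N
  have hR : 0 ≤ ∑ k ∈ Finset.range N, weight θ k * r k :=
    Finset.sum_nonneg fun k _ => mul_nonneg (weight_pos hθ k).le (H.r_nonneg k)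
  set R := ∑ k ∈ Finset.range N, weight θ k * r k
  set Es := ∑ k ∈ Finset.range N, weight θ k * E k
  have hD := H.D_nonneg 0
  have hX₁ : 0 ≤ s₁ 0 / α := div_nonneg (H.s₁_nonneg 0) hα.le
  have hX₂ : 0 ≤ s₂ 0 / p := div_nonneg (H.s₂_nonneg 0) hp.le
  set X₁ := s₁ 0 / α
  set X₂ := s₂ 0 / p
  have hQ : Q ≤ L * R * (28 / 3 + 392 / 9 * a)
      + (8 / 3 * a * X₁ + (8 / 3 + 112 / 9 * a) * X₂) := by
    have e1 := mul_le_mul_of_nonneg_left h₁ ha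
    have e2 := mul_le_mul_of_nonneg_left h₂ ha
    linarith
  set V := 8 / 3 * a * X₁ + (8 / 3 + 112 / 9 * a) * X₂ with hV
  have haX₁ := mul_nonneg ha hX₁
  have haX₂ := mul_nonneg ha hX₂
  have hV0 : 0 ≤ V := by positivity
  have hLT : 3 * L * T ≤ 3 / 14 * R + 48 / 7 * (γ ^ 2 * L * τ) * V := by
    have e1 : 3 * L * T ≤ 3 * L * (8 / 7 * γ ^ 2 * τ * (4 * L * τ * R
        + 2 * (L * R * (28 / 3 + 392 / 9 * a) + V))) := by
      rw [h₅]; gcongr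
    have e2 : 3 * L * (8 / 7 * γ ^ 2 * τ * (4 * L * τ * R
        + 2 * (L * R * (28 / 3 + 392 / 9 * a) + V)))
        = 96 / 7 * ((γ * L) ^ 2 * (τ * (τ + 14 / 3 + 196 / 9 * a))) * R
          + 48 / 7 * (γ ^ 2 * L * τ) * V := by ring
    have e3 : (γ * L) ^ 2 * (τ * (τ + 14 / 3 + 196 / 9 * a))
        ≤ (γ * L) ^ 2 * (τ * (τ + 6 + 40 * a)) := by
      gcongr <;> linarith
    -- `96/7 · 1/64 = 3/14`, which is below the `1/4` allowed in the error inequality.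
    have e4 : 96 / 7 * ((γ * L) ^ 2 * (τ * (τ + 14 / 3 + 196 / 9 * a))) ≤ 3 / 14 := by linarith
    have e5 := mul_le_mul_of_nonneg_right e4 hR
    linarith
  have hLE : 3 * L * Es ≤ 3 * L * T := by gcongr
  refine ⟨?_, ?_⟩
  · have hA : 0 ≤ γ ^ 2 * L * τ := by positivity
    have e1 : 48 / 7 * V ≤ 24 * a * X₁ + 24 * (1 + 6 * a) * X₂ := by rw [hV]; linarith
    have e2 := mul_le_mul_of_nonneg_left e1 hA
    linarith
  · have e1 : γ * (3 * L * Es) ≤ γ * (3 / 14 * R + 48 / 7 * (γ ^ 2 * L * τ) * V) := by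
      gcongr; linarith
    have e2 : γ ^ 2 * Q ≤ γ ^ 2 * (L * R * (28 / 3 + 392 / 9 * a) + V) := by gcongr
    -- Together with the `3/14` lost to the error, slightly less than `1/10` of `γ R` survives; this
    -- is why the final constant is as large as `50`.
    have e3 : γ * L * (28 / 3 + 392 / 9 * a) ≤ 7 / 10 - 7 / 500 := by linarith only [hγ₁, hγL, mul_nonneg hγL.le ha]
    have e4 := mul_le_mul_of_nonneg_right e3 (mul_nonneg hγ.le hR)
    have e5 : γ * (48 / 7 * (γ ^ 2 * L * τ) * V) ≤ 6 / 7 * (γ ^ 2 * V) := by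
      have : γ * (48 / 7 * (γ ^ 2 * L * τ) * V) = 48 / 7 * (γ * L * τ) * (γ ^ 2 * V) := by ring
      rw [this]
      gcongr
      linarith
    have hγV : 0 ≤ γ ^ 2 * V := by positivity
    have e6 : (1 - 3 / 14 - 7 / 10 + 7 / 500) * (γ * R) ≤ D 0 + 13 / 7 * (γ ^ 2 * V) := by
      linarith only [e1, e2, e4, e5, h₆]
    have e7 : 13 / 7 * V ≤ 9 / 2 * (8 / 3 * a * X₁ + (56 + 48 * a) / 9 * X₂) := by
      rw [hV]; linarith
    have e8 := mul_le_mul_of_nonneg_left e7 (sq_nonneg γ)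
    have e9 : 0 ≤ γ ^ 2 * (8 / 3 * a * X₁ + (56 + 48 * a) / 9 * X₂) := by positivity
    linarith only [e6, e8, e9, hD]

end Sequences

/-! ### Conditional expectations with an independent variable. -/

section Freezing

variable {Ω E 𝒰 : Type*} {m mΩ : MeasurableSpace Ω} [MeasurableSpace E] [MeasurableSpace 𝒰]
  {P : Measure Ω} [IsProbabilityMeasure P] {U : Ω → 𝒰} {Z : Ω → E}

/-- For `A` in `m`, the set `U⁻¹(s) ∩ A` is still in `m`, so independence factorizes the joint law
even after restriction. The restriction is what the characterization of conditional expectations by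
set integrals needs. -/
lemma map_restrict_prodMk_eq (hm : m ≤ mΩ) (hU : Measurable[m] U) (hZ : Measurable Z)
    (hind : Indep m (MeasurableSpace.comap Z inferInstance) P) {A : Set Ω}
    (hA : MeasurableSet[m] A) :
    (P.restrict A).map (fun o => (U o, Z o)) = ((P.restrict A).map U).prod (P.map Z) := by
  have hU' : Measurable U := hU.mono hm le_rfl
  have : IsProbabilityMeasure (P.map Z) := Measure.isProbabilityMeasure_map hZ.aemeasurable
  refine (Measure.prod_eq fun s t hs ht => ?_).symm
  rw [Measure.map_apply (hU'.prodMk hZ) (hs.prod ht), Measure.map_apply hU' hs,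
    Measure.map_apply hZ ht, Measure.restrict_apply ((hU'.prodMk hZ) (hs.prod ht)),
    Measure.restrict_apply (hU' hs)]
  have h1 := (Indep_iff _ _ _).1 hind (U ⁻¹' s ∩ A) (Z ⁻¹' t) ((hU hs).inter hA) ⟨t, ht, rfl⟩
  rw [← h1]
  congr 1
  ext o
  simp only [Set.mem_inter_iff, Set.mem_preimage, Set.mem_prod]
  tauto

lemma map_prodMk_eq (hm : m ≤ mΩ) (hU : Measurable[m] U) (hZ : Measurable Z)
    (hind : Indep m (MeasurableSpace.comap Z inferInstance) P) :
    P.map (fun o => (U o, Z o)) = (P.map U).prod (P.map Z) := by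
  simpa using map_restrict_prodMk_eq hm hU hZ hind MeasurableSet.univ

/-- The conditional expectation of a function of a measurable and an independent variable is obtained
by integrating out the latter. -/
lemma condExp_prodMk_ae_eq {V : Type*} [NormedAddCommGroup V] [NormedSpace ℝ V] [CompleteSpace V]
    [MeasurableSpace V] [BorelSpace V] [SecondCountableTopology V]
    (hm : m ≤ mΩ) (hU : Measurable[m] U) (hZ : Measurable Z)
    (hind : Indep m (MeasurableSpace.comap Z inferInstance) P) {Φ : 𝒰 × E → V}
    (hΦ : Measurable Φ) (hint : Integrable (fun o => Φ (U o, Z o)) P) :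
    P[fun o => Φ (U o, Z o) | m] =ᵐ[P] fun o => ∫ z, Φ (U o, z) ∂(P.map Z) := by
  have hU' : Measurable U := hU.mono hm le_rfl
  have hUZ : Measurable fun o => (U o, Z o) := hU'.prodMk hZ
  have : IsProbabilityMeasure (P.map Z) := Measure.isProbabilityMeasure_map hZ.aemeasurable
  have hφ : StronglyMeasurable fun u => ∫ z, Φ (u, z) ∂(P.map Z) :=
    hΦ.stronglyMeasurable.integral_prod_right'
  have hprod : ∀ A, MeasurableSet[m] A →
      Integrable Φ (((P.restrict A).map U).prod (P.map Z)) := fun A hA => by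
    rw [← map_restrict_prodMk_eq hm hU hZ hind hA]
    exact (integrable_map_measure hΦ.aestronglyMeasurable hUZ.aemeasurable).2 hint.integrableOn
  symm
  refine ae_eq_condExp_of_forall_setIntegral_eq hm hint (fun A hA _ => ?_) (fun A hA _ => ?_)
    (hφ.comp_measurable hU).aestronglyMeasurable
  · exact (integrable_map_measure (f := U) (μ := P.restrict A) hφ.aestronglyMeasurable
      hU'.aemeasurable).1 (hprod A hA).integral_prod_left
  · rw [← integral_map (φ := U) (μ := P.restrict A) hU'.aemeasurable hφ.aestronglyMeasurable,
      ← integral_map (φ := fun o => (U o, Z o)) (μ := P.restrict A) hUZ.aemeasurable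
        hΦ.aestronglyMeasurable, map_restrict_prodMk_eq hm hU hZ hind hA, integral_prod _ (hprod A hA)]

/-- A bound on the integral over the independent variable gives integrability and a bound on the
conditional expectation. -/
lemma integrable_and_condExp_le (hm : m ≤ mΩ) (hU : Measurable[m] U) (hZ : Measurable Z)
    (hind : Indep m (MeasurableSpace.comap Z inferInstance) P) {Φ : 𝒰 × E → ℝ} {ψ : 𝒰 → ℝ}
    (hΦ : Measurable Φ) (hΦ0 : ∀ q, 0 ≤ Φ q) (hψ : Measurable ψ)
    (hsec : ∀ u, Integrable (fun z => Φ (u, z)) (P.map Z))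
    (hle : ∀ u, ∫ z, Φ (u, z) ∂(P.map Z) ≤ ψ u) (hψU : Integrable (fun o => ψ (U o)) P) :
    Integrable (fun o => Φ (U o, Z o)) P ∧
      P[fun o => Φ (U o, Z o) | m] ≤ᵐ[P] fun o => ψ (U o) := by
  have hU' : Measurable U := hU.mono hm le_rfl
  have hUZ : Measurable fun o => (U o, Z o) := hU'.prodMk hZ
  have : IsProbabilityMeasure (P.map Z) := Measure.isProbabilityMeasure_map hZ.aemeasurable
  have hint : Integrable (fun o => Φ (U o, Z o)) P := by
    refine (integrable_map_measure (f := fun o => (U o, Z o)) hΦ.aestronglyMeasurable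
      hUZ.aemeasurable).1 ?_
    -- Nonnegativity of `Φ` identifies the integral of its norm over `z` with the quantity bounded
    -- by `ψ`, so integrability comes from the same estimate as the conditional bound.
    rw [map_prodMk_eq hm hU hZ hind, integrable_prod_iff hΦ.aestronglyMeasurable]
    refine ⟨Filter.Eventually.of_forall hsec, ?_⟩
    have h1 : Integrable ψ (P.map U) :=
      (integrable_map_measure hψ.aestronglyMeasurable hU'.aemeasurable).2 hψU
    refine h1.mono' (hΦ.norm.stronglyMeasurable.integral_prod_right').aestronglyMeasurable ?_
    refine Filter.Eventually.of_forall fun u => ?_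
    simp only [Real.norm_of_nonneg (hΦ0 _)]
    rw [Real.norm_of_nonneg (integral_nonneg fun z => hΦ0 _)]
    exact hle u
  refine ⟨hint, ?_⟩
  filter_upwards [condExp_prodMk_ae_eq hm hU hZ hind hΦ hint] with o ho
  rw [ho]
  exact hle _

end Freezing

/-! ### Orthogonality and bias-variance identities. -/

section SecondMoments

variable {Ω : Type*} [MeasurableSpace Ω] {P : Measure Ω} {d : ℕ}

lemma integrable_inner {X Y : Ω → Vec d} (hX : MemLp X 2 P) (hY : MemLp Y 2 P) :
    Integrable (fun o => inner ℝ (X o) (Y o)) P := by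
  refine Integrable.mono' (hX.norm.integrable_mul hY.norm)
    (hX.aestronglyMeasurable.inner hY.aestronglyMeasurable) (Filter.Eventually.of_forall fun o => ?_)
  exact norm_inner_le_norm _ _

lemma integral_norm_sum_sq {ι : Type*} (s : Finset ι) {X : ι → Ω → Vec d}
    (hX : ∀ i ∈ s, MemLp (X i) 2 P)
    (horth : ∀ i ∈ s, ∀ j ∈ s, i ≠ j → ∫ o, inner ℝ (X i o) (X j o) ∂P = 0) :
    ∫ o, ‖∑ i ∈ s, X i o‖ ^ 2 ∂P = ∑ i ∈ s, ∫ o, ‖X i o‖ ^ 2 ∂P := by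
  simp only [← real_inner_self_eq_norm_sq, sum_inner]
  simp only [inner_sum]
  rw [integral_finsetSum _ fun i hi => integrable_finsetSum _ fun j hj =>
    integrable_inner (hX i hi) (hX j hj)]
  refine Finset.sum_congr rfl fun i hi => ?_
  rw [integral_finsetSum _ fun j hj => integrable_inner (hX i hi) (hX j hj),
    Finset.sum_eq_single_of_mem i hi fun j hj hji => horth i hi j hj hji.symm]

lemma memLp_two_of_integrable_norm_sq {X : Ω → Vec d} (hX : AEStronglyMeasurable X P)
    (h : Integrable (fun o => ‖X o‖ ^ 2) P) : MemLp X 2 P :=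
  (memLp_two_iff_integrable_sq_norm hX).2 h

lemma integrable_norm_sq {X : Ω → Vec d} (h : MemLp X 2 P) :
    Integrable (fun o => ‖X o‖ ^ 2) P :=
  (memLp_two_iff_integrable_sq_norm h.aestronglyMeasurable).1 h

lemma integral_norm_const_add_sq [IsProbabilityMeasure P] (c : Vec d) {X : Ω → Vec d}
    (hX : MemLp X 2 P) (h0 : ∫ o, X o ∂P = 0) :
    ∫ o, ‖c + X o‖ ^ 2 ∂P = ‖c‖ ^ 2 + ∫ o, ‖X o‖ ^ 2 ∂P := by
  have hX1 : Integrable X P := hX.integrable (by norm_num)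
  simp only [norm_add_sq_real]
  have h1 : Integrable (fun o => 2 * inner ℝ c (X o)) P := (hX1.const_inner c).const_mul 2
  have h2 : Integrable (fun o => ‖c‖ ^ 2 + 2 * inner ℝ c (X o)) P := (integrable_const _).add h1
  rw [integral_add h2 (integrable_norm_sq hX),
    integral_add (integrable_const _) h1, integral_const_mul, integral_inner hX1, h0]
  simp

/-- The cross term vanishes because the deviations from the average sum to zero. -/
lemma average_norm_sub_sq {m : ℕ} (hm : 1 ≤ m) (u : Fin m → Vec d) (c : Vec d) :
    1 / (m : ℝ) * ∑ l, ‖u l - c‖ ^ 2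
      = ‖avg u - c‖ ^ 2 + 1 / (m : ℝ) * ∑ l, ‖u l - avg u‖ ^ 2 := by
  have hm' : (m : ℝ) ≠ 0 := by positivity
  have h1 : ∀ l, ‖u l - c‖ ^ 2
      = ‖avg u - c‖ ^ 2 + 2 * inner ℝ (avg u - c) (u l - avg u) + ‖u l - avg u‖ ^ 2 := fun l => by
    rw [← norm_add_sq_real]; congr 2; abel
  have h2 : ∑ l, (u l - avg u) = 0 := by
    rw [Finset.sum_sub_distrib, Finset.sum_const, Finset.card_univ, Fintype.card_fin, avg,
      ← Nat.cast_smul_eq_nsmul ℝ, smul_smul, mul_one_div_cancel hm', one_smul, sub_self]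
  simp only [h1, Finset.sum_add_distrib, ← Finset.mul_sum, ← inner_sum, h2, inner_zero_right,
    Finset.sum_const, Finset.card_univ, Fintype.card_fin, nsmul_eq_mul]
  field_simp
  ring

end SecondMoments

/-! ### Second moments of the quantization operator. -/

section Quantization

variable {d : ℕ} {Ξ : Type*} [MeasurableSpace Ξ] {ν : Measure Ξ} {Q : Vec d → Ξ → Vec d} {ω : ℝ}

lemma IsQuantization.measurable_apply (hQ : IsQuantization ν Q ω) (y : Vec d) :
    Measurable (Q y) := hQ.measurable.comp measurable_prodMk_left

variable [IsProbabilityMeasure ν]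

lemma IsQuantization.memLp (hQ : IsQuantization ν Q ω) (y : Vec d) : MemLp (Q y) 2 ν := by
  have h := memLp_two_of_integrable_norm_sq (P := ν)
    ((hQ.measurable_apply y).sub_const y).aestronglyMeasurable (hQ.sq_integrable y)
  exact (h.add (memLp_const y)).ae_eq (Filter.Eventually.of_forall fun s => sub_add_cancel _ _)

/-- The quantization error is centred, so it only adds its variance, scaled by `a ^ 2`. -/
lemma IsQuantization.integral_norm_add_smul_sq_le (hQ : IsQuantization ν Q ω) (c y : Vec d)
    (a : ℝ) :
    ∫ s, ‖c + a • Q y s‖ ^ 2 ∂ν ≤ ‖c + a • y‖ ^ 2 + a ^ 2 * (ω * ‖y‖ ^ 2) := by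
  have h1 : MemLp (fun s => a • (Q y s - y)) 2 ν :=
    ((hQ.memLp y).sub (memLp_const y)).const_smul a
  have h2 : ∫ s, a • (Q y s - y) ∂ν = 0 := by
    rw [integral_smul, integral_sub (hQ.integrable y) (integrable_const y), hQ.unbiased]
    simp
  have h3 := integral_norm_const_add_sq (c + a • y) h1 h2
  have h4 : ∀ s, c + a • y + a • (Q y s - y) = c + a • Q y s := fun s => by
    rw [smul_sub]; abel
  simp only [h4, norm_smul, mul_pow, Real.norm_eq_abs, sq_abs] at h3
  rw [h3, integral_const_mul]
  gcongr
  exact hQ.variance_le y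

end Quantization

/-! ### The randomness of one worker in one iteration. -/

section WorkerLaw

variable {d m : ℕ} {Ξ : Type*} [MeasurableSpace Ξ]

/-- The law of the randomness `(l, s, b)` used by one worker in one iteration. -/
noncomputable def workerLaw (m : ℕ) (ν : Measure Ξ) (p : ℝ) : Measure (Fin m × Ξ × Bool) :=
  (uniformOn (Set.univ : Set (Fin m))).prod (ν.prod (coinLaw p))

lemma isProbabilityMeasure_uniformOn_univ (hm : 1 ≤ m) :
    IsProbabilityMeasure (uniformOn (Set.univ : Set (Fin m))) :=
  have : Nonempty (Fin m) := ⟨⟨0, hm⟩⟩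
  isProbabilityMeasure_uniformOn Set.finite_univ Set.univ_nonempty

lemma isProbabilityMeasure_coinLaw {p : ℝ} (hp : 0 < p) (hp1 : p < 1) :
    IsProbabilityMeasure (coinLaw p) := by
  constructor
  simp only [coinLaw, Measure.add_apply, Measure.smul_apply, measure_univ, smul_eq_mul, mul_one]
  rw [← ENNReal.ofReal_add hp.le (by linarith)]
  simp

variable {ν : Measure Ξ} [IsProbabilityMeasure ν] {p : ℝ}

lemma isProbabilityMeasure_workerLaw (hm : 1 ≤ m) (hp : 0 < p) (hp1 : p < 1) :
    IsProbabilityMeasure (workerLaw m ν p) := by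
  have := isProbabilityMeasure_uniformOn_univ hm
  have := isProbabilityMeasure_coinLaw hp hp1
  unfold workerLaw
  infer_instance

lemma integral_uniformOn_univ {V : Type*} [NormedAddCommGroup V] [NormedSpace ℝ V]
    [CompleteSpace V] (f : Fin m → V) :
    ∫ l, f l ∂(uniformOn (Set.univ : Set (Fin m))) = (1 / (m : ℝ)) • ∑ l, f l := by
  rw [integral_fintype Integrable.of_finite, Finset.smul_sum]
  refine Finset.sum_congr rfl fun l _ => ?_
  simp [Measure.real, uniformOn_univ]

lemma integral_coinLaw (hp : 0 < p) (hp1 : p < 1) (f : Bool → ℝ) :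
    ∫ b, f b ∂(coinLaw p) = p * f true + (1 - p) * f false := by
  have := isProbabilityMeasure_coinLaw hp hp1
  rw [integral_fintype Integrable.of_finite]
  simp [Measure.real, coinLaw, ENNReal.toReal_ofReal hp.le,
    ENNReal.toReal_ofReal (show 0 ≤ 1 - p by linarith)]

lemma integrable_index_seed {V : Type*} [NormedAddCommGroup V] [NormedSpace ℝ V] [CompleteSpace V]
    [MeasurableSpace V] [BorelSpace V] [SecondCountableTopology V] (hm : 1 ≤ m) (hp : 0 < p)
    (hp1 : p < 1) {G : Fin m → Ξ → V} (hG : ∀ l, Measurable (G l)) (hG' : ∀ l, Integrable (G l) ν) :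
    Integrable (fun z : Fin m × Ξ × Bool => G z.1 z.2.1) (workerLaw m ν p) ∧
      ∫ z, G z.1 z.2.1 ∂(workerLaw m ν p) = (1 / (m : ℝ)) • ∑ l, ∫ s, G l s ∂ν := by
  have := isProbabilityMeasure_uniformOn_univ hm
  have := isProbabilityMeasure_coinLaw hp hp1
  have hmeas : Measurable fun z : Fin m × Ξ × Bool => G z.1 z.2.1 :=
    measurable_from_prod_countable_right fun l => (hG l).comp measurable_fst
  have hint : Integrable (fun z : Fin m × Ξ × Bool => G z.1 z.2.1) (workerLaw m ν p) := by
    unfold workerLaw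
    rw [integrable_prod_iff hmeas.aestronglyMeasurable]
    exact ⟨Filter.Eventually.of_forall fun l => (hG' l).comp_fst _, Integrable.of_finite⟩
  refine ⟨hint, ?_⟩
  unfold workerLaw at hint ⊢
  rw [integral_prod _ hint, integral_uniformOn_univ]
  congr 1
  refine Finset.sum_congr rfl fun l _ => ?_
  rw [integral_fun_fst (f := G l), probReal_univ, one_smul]

lemma integrable_coin (hm : 1 ≤ m) (hp : 0 < p) (hp1 : p < 1) (f : Bool → ℝ) :
    Integrable (fun z : Fin m × Ξ × Bool => f z.2.2) (workerLaw m ν p) ∧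
      ∫ z, f z.2.2 ∂(workerLaw m ν p) = p * f true + (1 - p) * f false := by
  have := isProbabilityMeasure_uniformOn_univ hm
  have := isProbabilityMeasure_coinLaw hp hp1
  unfold workerLaw
  refine ⟨((Integrable.of_finite (μ := coinLaw p) (f := f)).comp_snd ν).comp_snd _, ?_⟩
  rw [integral_fun_snd (f := fun q : Ξ × Bool => f q.2), integral_fun_snd (f := f),
    integral_coinLaw hp hp1]
  simp

variable {Q : Vec d → Ξ → Vec d} {ω : ℝ}

/-- Moments of one step of a worker whose stochastic gradient is `u l` before compression. -/
lemma IsQuantization.integral_shifted (hQ : IsQuantization ν Q ω) (hm : 1 ≤ m) (hp : 0 < p)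
    (hp1 : p < 1) (u : Fin m → Vec d) (h : Vec d) :
    Integrable (fun z : Fin m × Ξ × Bool => h + Q (u z.1 - h) z.2.1) (workerLaw m ν p) ∧
      ∫ z, (h + Q (u z.1 - h) z.2.1) ∂(workerLaw m ν p) = avg u := by
  have h1 := integrable_index_seed (m := m) (ν := ν) hm hp hp1
    (G := fun l s => h + Q (u l - h) s)
    (fun l => measurable_const.add (hQ.measurable_apply _))
    (fun l => (integrable_const h).add (hQ.integrable _))
  refine ⟨h1.1, h1.2.trans ?_⟩
  rw [avg]
  congr 1
  refine Finset.sum_congr rfl fun l _ => ?_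
  rw [integral_add (integrable_const h) (hQ.integrable _), hQ.unbiased]
  simp

lemma IsQuantization.integral_norm_shifted_sq_le (hQ : IsQuantization ν Q ω) (hm : 1 ≤ m)
    (hp : 0 < p) (hp1 : p < 1) (u : Fin m → Vec d) (h c : Vec d) (a : ℝ) :
    Integrable (fun z : Fin m × Ξ × Bool => ‖c + a • Q (u z.1 - h) z.2.1‖ ^ 2) (workerLaw m ν p) ∧
      ∫ z, ‖c + a • Q (u z.1 - h) z.2.1‖ ^ 2 ∂(workerLaw m ν p) ≤
        1 / (m : ℝ) * ∑ l, (‖c + a • (u l - h)‖ ^ 2 + a ^ 2 * (ω * ‖u l - h‖ ^ 2)) := by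
  have h1 := integrable_index_seed (m := m) (ν := ν) hm hp hp1
    (G := fun l s => ‖c + a • Q (u l - h) s‖ ^ 2)
    (fun l => ((measurable_const.add ((hQ.measurable_apply _).const_smul a)).norm.pow_const 2))
    (fun l => integrable_norm_sq ((memLp_const c).add ((hQ.memLp _).const_smul a)))
  refine ⟨h1.1, h1.2.le.trans ?_⟩
  rw [smul_eq_mul]
  gcongr with l _
  exact hQ.integral_norm_add_smul_sq_le _ _ _

/-- Contraction of the shift `h ↦ h + α Q(u - h)` towards any point `c`. -/
lemma IsQuantization.integral_norm_shift_update_sq_le (hQ : IsQuantization ν Q ω) (hm : 1 ≤ m)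
    (hp : 0 < p) (hp1 : p < 1) (u : Fin m → Vec d) (h c : Vec d) {α : ℝ} (hα : 0 < α)
    (hαω : α ≤ 1 / (ω + 1)) :
    ∫ z, ‖h - c + α • Q (u z.1 - h) z.2.1‖ ^ 2 ∂(workerLaw m ν p) ≤
      (1 - α) * ‖h - c‖ ^ 2 + α * (1 / (m : ℝ) * ∑ l, ‖u l - c‖ ^ 2) := by
  have hω := hQ.omega_pos
  have hαω' : α * (ω + 1) ≤ 1 := by rwa [le_div_iff₀ (by linarith)] at hαω
  have hm' : (m : ℝ) ≠ 0 := by positivity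
  refine (hQ.integral_norm_shifted_sq_le hm hp hp1 u h (h - c) α).2.trans ?_
  -- The right side minus the left side is exactly `α (1 - α(ω + 1)) ‖u l - h‖²`.
  have h1 : ∀ l, ‖h - c + α • (u l - h)‖ ^ 2 + α ^ 2 * (ω * ‖u l - h‖ ^ 2) ≤
      (1 - α) * ‖h - c‖ ^ 2 + α * ‖u l - c‖ ^ 2 := by
    intro l
    have e1 : ‖u l - c‖ ^ 2
        = ‖h - c‖ ^ 2 + 2 * inner ℝ (h - c) (u l - h) + ‖u l - h‖ ^ 2 := by
      rw [← norm_add_sq_real]; congr 2; abel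
    rw [norm_add_sq_real, norm_smul, inner_smul_right, mul_pow, Real.norm_eq_abs, sq_abs, e1]
    have e2 := mul_nonneg (mul_nonneg hα.le (sub_nonneg.2 hαω')) (sq_nonneg ‖u l - h‖)
    linarith
  calc 1 / (m : ℝ) * ∑ l, (‖h - c + α • (u l - h)‖ ^ 2 + α ^ 2 * (ω * ‖u l - h‖ ^ 2))
      ≤ 1 / (m : ℝ) * ∑ l, ((1 - α) * ‖h - c‖ ^ 2 + α * ‖u l - c‖ ^ 2) := by
        gcongr ?_ * ?_
        exact Finset.sum_le_sum fun l _ => h1 l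
    _ = _ := by
        rw [Finset.sum_add_distrib, ← Finset.mul_sum Finset.univ (fun l => ‖u l - c‖ ^ 2) α,
          Finset.sum_const, Finset.card_univ, Fintype.card_fin, nsmul_eq_mul]
        field_simp

end WorkerLaw

/-! ### Averages over independent workers. -/

section IndependentAverage

variable {d n : ℕ} {E : Type*} [MeasurableSpace E] {π : Measure E} [IsProbabilityMeasure π]

lemma memLp_comp_eval {G : E → Vec d} (hG : MemLp G 2 π) (i : Fin n) :
    MemLp (fun z : Fin n → E => G (z i)) 2 (Measure.pi fun _ => π) :=
  hG.comp_measurePreserving (measurePreserving_eval (fun _ : Fin n => π) i)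

lemma memLp_avg {Ω : Type*} [MeasurableSpace Ω] {P : Measure Ω} {X : Fin n → Ω → Vec d}
    (hX : ∀ i, MemLp (X i) 2 P) : MemLp (fun o => avg fun i => X i o) 2 P := by
  unfold avg
  exact (memLp_finsetSum _ fun i _ => hX i).const_smul (1 / (n : ℝ))

/-- The second moment of an average of independent vectors. -/
lemma integral_norm_avg_sq {G : Fin n → E → Vec d} (hG : ∀ i, MemLp (G i) 2 π) :
    ∫ z, ‖avg fun i => G i (z i)‖ ^ 2 ∂(Measure.pi fun _ : Fin n => π) =
      ‖avg fun i => ∫ z, G i z ∂π‖ ^ 2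
        + (1 / (n : ℝ)) ^ 2 * ∑ i, ∫ z, ‖G i z - ∫ z, G i z ∂π‖ ^ 2 ∂π := by
  set M : Fin n → Vec d := fun i => ∫ z, G i z ∂π with hM
  have hX : ∀ i, MemLp (fun z => G i z - M i) 2 π := fun i => (hG i).sub (memLp_const _)
  have hX' : ∀ i, MemLp (fun z : Fin n → E => G i (z i) - M i) 2 (Measure.pi fun _ => π) :=
    fun i => memLp_comp_eval (hX i) i
  have hG1 : ∀ i, Integrable (G i) π := fun i => (hG i).integrable (by norm_num)
  have hX0 : ∀ i, ∫ z, (G i z - M i) ∂π = 0 := fun i => by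
    rw [integral_sub (hG1 i) (integrable_const _)]; simp [hM]
  have hX0' : ∀ i, ∫ z : Fin n → E, (G i (z i) - M i) ∂(Measure.pi fun _ => π) = 0 := fun i => by
    rw [integral_comp_eval (μ := fun _ : Fin n => π) (f := fun y => G i y - M i)
      (hX i).aestronglyMeasurable, hX0]
  -- Distinct coordinates of a product measure are independent, so the expected inner product is
  -- that of the means, both zero.
  have horth : ∀ i ∈ Finset.univ, ∀ j ∈ Finset.univ, i ≠ j →
      ∫ z : Fin n → E, inner ℝ (G i (z i) - M i) (G j (z j) - M j) ∂(Measure.pi fun _ => π) = 0 := by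
    intro i _ j _ hij
    have hind := (iIndepFun_pi (μ := fun _ : Fin n => π) (X := fun i z => G i z - M i)
      fun i => (hX i).aestronglyMeasurable.aemeasurable).indepFun hij
    have := hind.integral_bilin ((hX' i).integrable (by norm_num))
      ((hX' j).integrable (by norm_num)) (innerSL ℝ)
    refine this.trans ?_
    rw [hX0', map_zero]
    rfl
  have hsum := integral_norm_sum_sq Finset.univ (fun i _ => hX' i) horth
  have hdec : ∀ z : Fin n → E, (avg fun i => G i (z i))
      = avg M + (1 / (n : ℝ)) • ∑ i, (G i (z i) - M i) := fun z => by
    rw [Finset.sum_sub_distrib, smul_sub, avg, avg]; abel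
  have hmem : MemLp (fun z : Fin n → E => (1 / (n : ℝ)) • ∑ i, (G i (z i) - M i)) 2
      (Measure.pi fun _ => π) := (memLp_finsetSum _ fun i _ => hX' i).const_smul (1 / (n : ℝ))
  simp only [hdec]
  rw [integral_norm_const_add_sq (avg M) hmem]
  · congr 1
    simp only [norm_smul, mul_pow]
    rw [integral_const_mul, hsum]
    congr 1
    · rw [Real.norm_eq_abs, sq_abs]
    · exact Finset.sum_congr rfl fun i _ =>
        integral_comp_eval (μ := fun _ : Fin n => π) (f := fun y => ‖G i y - M i‖ ^ 2)
          ((hX i).aestronglyMeasurable.norm.pow 2)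
  · rw [integral_smul, integral_finsetSum _ fun i _ => (hX' i).integrable (by norm_num)]
    simp [hX0']

end IndependentAverage

/-! ### Conditional moments of one iteration from a fixed state. -/

section OneStep

variable {d n m : ℕ} {Ξ : Type*} {A : Input d n m Ξ} {xs : Vec d} {L μ ω p : ℝ}

/-- The variance reduced stochastic gradient of worker `i`, with index `l`. -/
noncomputable def Input.reducedGradient (A : Input d n m Ξ) (S : State d n) (i : Fin n)
    (l : Fin m) : Vec d :=
  gradient (A.F i l) S.x - gradient (A.F i l) (S.w i) + gradient (localObj A.F i) (S.w i)

/-- The two snapshot terms cancel on averaging over the index: the correction is a control variate.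
-/
lemma Input.avg_reducedGradient (hm : 1 ≤ m) (hs : ∀ i j, LSmooth L (A.F i j)) (S : State d n)
    (i : Fin n) : avg (A.reducedGradient S i) = gradient (localObj A.F i) S.x := by
  have hm' : (m : ℝ) ≠ 0 := by positivity
  simp only [avg, Input.reducedGradient, Finset.sum_add_distrib, Finset.sum_sub_distrib, smul_add,
    smul_sub, Finset.sum_const, Finset.card_univ, Fintype.card_fin]
  rw [← Nat.cast_smul_eq_nsmul ℝ, smul_smul, one_div_mul_cancel hm', one_smul,
    gradient_localObj hs, gradient_localObj hs]
  simp only [avg]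
  abel

lemma norm_sub_add_sq_le (a b c : Vec d) : ‖a - b + c‖ ^ 2 ≤ 2 * ‖a‖ ^ 2 + 2 * ‖b - c‖ ^ 2 := by
  rw [show a - b + c = a - (b - c) by abel, norm_sub_sq_real]
  have := norm_add_sq_real a (b - c)
  have := sq_nonneg ‖a + (b - c)‖
  linarith

/-- The mean squared deviation of the variance reduced gradients. -/
lemma Input.reducedGradient_deviation_le (hn : 1 ≤ n) (hm : 1 ≤ m) (hL : 0 < L)
    (hc : ∀ i j, ConvexOn ℝ Set.univ (A.F i j)) (hs : ∀ i j, LSmooth L (A.F i j))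
    (hq : QuasiStronglyConvex μ (objective A.F) xs) (S : State d n) :
    1 / (n : ℝ) * ∑ i, (1 / (m : ℝ) * ∑ l,
        ‖A.reducedGradient S i l - gradient (localObj A.F i) xs‖ ^ 2) ≤
      4 * L * (objective A.F S.x - objective A.F xs) + 2 * sigma2Sq A.F xs S.w := by
  have hn' : (n : ℝ) ≠ 0 := by positivity
  have hm' : (m : ℝ) ≠ 0 := by positivity
  have hi : ∀ i, 1 / (m : ℝ) * ∑ l,
      ‖A.reducedGradient S i l - gradient (localObj A.F i) xs‖ ^ 2 ≤
      2 * (1 / (m : ℝ) * ∑ l, ‖gradient (A.F i l) S.x - gradient (A.F i l) xs‖ ^ 2)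
      + 2 * (1 / (m : ℝ) * ∑ l, ‖gradient (A.F i l) (S.w i) - gradient (A.F i l) xs‖ ^ 2) := by
    intro i
    set b : Fin m → Vec d := fun l => gradient (A.F i l) (S.w i) - gradient (A.F i l) xs with hb
    have hbavg : avg b = gradient (localObj A.F i) (S.w i) - gradient (localObj A.F i) xs := by
      rw [gradient_localObj hs, gradient_localObj hs]
      simp only [avg, hb, Finset.sum_sub_distrib, smul_sub]
    -- The snapshot deviations enter centred at their average, and centring can only decrease the
    -- second moment; no separate term for `‖avg b‖²` remains.
    have h1 := average_norm_sub_sq hm b 0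
    simp only [sub_zero] at h1
    have h2 : ∀ l, ‖A.reducedGradient S i l - gradient (localObj A.F i) xs‖ ^ 2 ≤
        2 * ‖gradient (A.F i l) S.x - gradient (A.F i l) xs‖ ^ 2 + 2 * ‖b l - avg b‖ ^ 2 := by
      intro l
      have : A.reducedGradient S i l - gradient (localObj A.F i) xs
          = (gradient (A.F i l) S.x - gradient (A.F i l) xs) - b l + avg b := by
        rw [hbavg, Input.reducedGradient]; simp only [hb]; abel
      rw [this]
      exact norm_sub_add_sq_le _ _ _
    have h3 := Finset.sum_le_sum fun l (_ : l ∈ Finset.univ) => h2 l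
    rw [Finset.sum_add_distrib, ← Finset.mul_sum, ← Finset.mul_sum] at h3
    have h4 := mul_le_mul_of_nonneg_left h3 (show 0 ≤ 1 / (m : ℝ) by positivity)
    have h5 := sq_nonneg ‖avg b‖
    linarith
  have h1 := average_gradient_deviation_le hL hc hs hq S.x
  calc _ ≤ 1 / (n : ℝ) * ∑ i,
        (2 * (1 / (m : ℝ) * ∑ l, ‖gradient (A.F i l) S.x - gradient (A.F i l) xs‖ ^ 2)
        + 2 * (1 / (m : ℝ) * ∑ l, ‖gradient (A.F i l) (S.w i) - gradient (A.F i l) xs‖ ^ 2)) := by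
        gcongr ?_ * ?_
        exact Finset.sum_le_sum fun i _ => hi i
    _ = 2 * (1 / ((n : ℝ) * m) * ∑ i, ∑ j, ‖gradient (A.F i j) S.x - gradient (A.F i j) xs‖ ^ 2)
        + 2 * sigma2Sq A.F xs S.w := by
        rw [sigma2Sq, Finset.sum_add_distrib]
        simp only [← Finset.mul_sum]
        field_simp
    _ ≤ _ := by linarith

variable [MeasurableSpace Ξ] {ν : Measure Ξ} [IsProbabilityMeasure ν]

/-- The law of the randomness of one iteration. -/
noncomputable def iterationLaw (n m : ℕ) (ν : Measure Ξ) (p : ℝ) :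
    Measure (Fin n → Fin m × Ξ × Bool) := Measure.pi fun _ => workerLaw m ν p

lemma Input.memLp_worker (hm : 1 ≤ m) (hp : 0 < p) (hp1 : p < 1) (hQ : IsQuantization ν A.Q ω)
    (S : State d n) (i : Fin n) : MemLp (fun z : Fin m × Ξ × Bool =>
      S.h i + A.Q (A.reducedGradient S i z.1 - S.h i) z.2.1) 2 (workerLaw m ν p) := by
  have h := (hQ.integral_norm_shifted_sq_le hm hp hp1 (A.reducedGradient S i) (S.h i) (S.h i) 1).1
  simp only [one_smul] at h
  exact memLp_two_of_integrable_norm_sq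
    (hQ.integral_shifted hm hp hp1 (A.reducedGradient S i) (S.h i)).1.aestronglyMeasurable h

lemma Input.memLp_avg_gLocal (hm : 1 ≤ m) (hp : 0 < p) (hp1 : p < 1)
    (hQ : IsQuantization ν A.Q ω) (S : State d n) :
    MemLp (fun z => avg (A.gLocal S z)) 2 (iterationLaw n m ν p) := by
  have := isProbabilityMeasure_workerLaw (ν := ν) hm hp hp1
  exact memLp_avg fun i => memLp_comp_eval (A.memLp_worker hm hp hp1 hQ S i) i

lemma Input.integral_avg_gLocal (hm : 1 ≤ m) (hp : 0 < p) (hp1 : p < 1)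
    (hs : ∀ i j, LSmooth L (A.F i j)) (hQ : IsQuantization ν A.Q ω) (S : State d n) :
    ∫ z, avg (A.gLocal S z) ∂(iterationLaw n m ν p) = gradient (objective A.F) S.x := by
  have := isProbabilityMeasure_workerLaw (ν := ν) hm hp hp1
  have h1 : ∀ i, Integrable (fun z => A.gLocal S z i) (iterationLaw n m ν p) := fun i =>
    (memLp_comp_eval (A.memLp_worker hm hp hp1 hQ S i) i).integrable (by norm_num)
  unfold avg
  rw [integral_smul, integral_finsetSum _ fun i _ => h1 i, gradient_objective hs, avg]
  congr 1
  refine Finset.sum_congr rfl fun i _ => ?_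
  have h2 := hQ.integral_shifted hm hp hp1 (A.reducedGradient S i) (S.h i)
  rw [A.avg_reducedGradient hm hs] at h2
  exact (integral_comp_eval (μ := fun _ : Fin n => workerLaw m ν p)
    h2.1.aestronglyMeasurable).trans h2.2

/-- Independence of the workers leaves the squared mean plus `1/n` times the average variance. Each
variance is the dispersion over the index plus at most `ω` times the mean square of the quantized
vector `ĝ_i - h_i`, so the compression costs only `ω / n`. -/
lemma Input.integral_norm_avg_gLocal_sq_le (hn : 1 ≤ n) (hm : 1 ≤ m) (hp : 0 < p) (hp1 : p < 1)
    (hL : 0 < L) (hc : ∀ i j, ConvexOn ℝ Set.univ (A.F i j)) (hs : ∀ i j, LSmooth L (A.F i j))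
    (hq : QuasiStronglyConvex μ (objective A.F) xs) (hQ : IsQuantization ν A.Q ω)
    (S : State d n) :
    ∫ z, ‖avg (A.gLocal S z)‖ ^ 2 ∂(iterationLaw n m ν p) ≤
      4 * L * (1 + 2 * (ω / n)) * (objective A.F S.x - objective A.F xs)
        + 2 * (ω / n) * sigma1Sq A.F xs S.h + 2 * (1 + 2 * (ω / n)) * sigma2Sq A.F xs S.w := by
  have := isProbabilityMeasure_workerLaw (ν := ν) hm hp hp1
  have hω := hQ.omega_pos
  have hn' : (n : ℝ) ≠ 0 := by positivity
  have hn1 : (1 : ℝ) ≤ n := by exact_mod_cast hn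
  have hm' : (m : ℝ) ≠ 0 := by positivity
  set u := A.reducedGradient S with hu
  set c : Fin n → Vec d := fun i => gradient (localObj A.F i) xs with hcdef
  set M : Fin n → Vec d := fun i => gradient (localObj A.F i) S.x with hM
  have hMu : ∀ i, avg (u i) = M i := A.avg_reducedGradient hm hs S
  set B : Fin n → ℝ := fun i => 1 / (m : ℝ) * ∑ l, ‖u i l - c i‖ ^ 2 with hB
  have hmean : ∀ i, ∫ z : Fin m × Ξ × Bool, (S.h i + A.Q (u i z.1 - S.h i) z.2.1)
      ∂(workerLaw m ν p) = M i := fun i => by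
    rw [(hQ.integral_shifted hm hp hp1 (u i) (S.h i)).2, hMu]
  have hvar : ∀ i, ‖M i - c i‖ ^ 2 + 1 / (n : ℝ) * ∫ z : Fin m × Ξ × Bool,
      ‖S.h i + A.Q (u i z.1 - S.h i) z.2.1 - M i‖ ^ 2 ∂(workerLaw m ν p) ≤
      (1 + 2 * (ω / n)) * B i + 2 * (ω / n) * ‖S.h i - c i‖ ^ 2 := by
    intro i
    have h1 := (hQ.integral_norm_shifted_sq_le hm hp hp1 (u i) (S.h i) (S.h i - M i) 1).2
    simp only [one_smul, one_pow, one_mul] at h1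
    have e1 : ∀ z : Fin m × Ξ × Bool, S.h i - M i + A.Q (u i z.1 - S.h i) z.2.1
        = S.h i + A.Q (u i z.1 - S.h i) z.2.1 - M i := fun z => by abel
    have e2 : ∀ l, S.h i - M i + (u i l - S.h i) = u i l - M i := fun l => by abel
    simp only [e1, e2] at h1
    rw [Finset.sum_add_distrib, ← Finset.mul_sum, mul_add] at h1
    have h2 := average_norm_sub_sq hm (u i) (c i)
    rw [hMu] at h2
    have h3 : ∀ l, ‖u i l - S.h i‖ ^ 2 ≤ 2 * ‖u i l - c i‖ ^ 2 + 2 * ‖S.h i - c i‖ ^ 2 := by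
      intro l
      have := norm_sub_add_sq_le (u i l - c i) (S.h i - c i) 0
      simpa using this
    have h4 : 1 / (m : ℝ) * ∑ l, ‖u i l - S.h i‖ ^ 2 ≤ 2 * B i + 2 * ‖S.h i - c i‖ ^ 2 := by
      calc _ ≤ 1 / (m : ℝ) * ∑ l, (2 * ‖u i l - c i‖ ^ 2 + 2 * ‖S.h i - c i‖ ^ 2) := by
            gcongr ?_ * ?_
            exact Finset.sum_le_sum fun l _ => h3 l
        _ = _ := by
            rw [Finset.sum_add_distrib, ← Finset.mul_sum, Finset.sum_const, Finset.card_univ,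
              Fintype.card_fin, nsmul_eq_mul, hB]
            field_simp
    have h5 : 0 ≤ 1 / (m : ℝ) * ∑ l, ‖u i l - M i‖ ^ 2 := by positivity
    -- The factor `1/n` on the index dispersion is given up, so that it recombines with `‖M i - c
    -- i‖²` into `B i`.
    have h6 : 1 / (n : ℝ) * (1 / (m : ℝ) * ∑ l, ‖u i l - M i‖ ^ 2) ≤
        1 / (m : ℝ) * ∑ l, ‖u i l - M i‖ ^ 2 := by
      refine mul_le_of_le_one_left h5 ?_
      rw [div_le_one (by linarith)]; exact hn1
    have h7 := mul_le_mul_of_nonneg_left h1 (show 0 ≤ 1 / (n : ℝ) by positivity)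
    have h8 := mul_le_mul_of_nonneg_left h4 (show 0 ≤ ω / n by positivity)
    have h9 : 1 / (n : ℝ) * (1 / (m : ℝ) * (ω * ∑ l, ‖u i l - S.h i‖ ^ 2))
        = ω / n * (1 / (m : ℝ) * ∑ l, ‖u i l - S.h i‖ ^ 2) := by ring
    have h10 : B i = ‖M i - c i‖ ^ 2 + 1 / (m : ℝ) * ∑ l, ‖u i l - M i‖ ^ 2 := h2
    linarith
  -- The local gradients at `x*` average to zero and may be subtracted before Jensen's inequality.
  have hbar : ‖avg M‖ ^ 2 ≤ 1 / (n : ℝ) * ∑ i, ‖M i - c i‖ ^ 2 := by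
    have h1 : avg c = 0 := by
      rw [hcdef, ← gradient_objective hs, gradient_objective_minimizer hq]
    have h2 : avg M = avg fun i => M i - c i := by
      have : (avg fun i => M i - c i) = avg M - avg c := by
        simp only [avg, Finset.sum_sub_distrib, smul_sub]
      rw [this, h1, sub_zero]
    rw [h2]
    exact norm_avg_sq_le hn _
  have hG := integral_norm_avg_sq (n := n) (fun i => A.memLp_worker hm hp hp1 hQ S i)
  rw [← hu] at hG
  simp only [hmean] at hG
  have hdev := A.reducedGradient_deviation_le hn hm hL hc hs hq S
  have hnn : 0 ≤ 1 + 2 * (ω / n) := by positivity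
  calc ∫ z, ‖avg (A.gLocal S z)‖ ^ 2 ∂(iterationLaw n m ν p) = _ := hG
    _ ≤ 1 / (n : ℝ) * ∑ i, ‖M i - c i‖ ^ 2 + (1 / (n : ℝ)) ^ 2 * ∑ i, ∫ z : Fin m × Ξ × Bool,
      ‖S.h i + A.Q (u i z.1 - S.h i) z.2.1 - M i‖ ^ 2 ∂(workerLaw m ν p) := by
        gcongr
    _ = 1 / (n : ℝ) * ∑ i, (‖M i - c i‖ ^ 2 + 1 / (n : ℝ) * ∫ z : Fin m × Ξ × Bool,
      ‖S.h i + A.Q (u i z.1 - S.h i) z.2.1 - M i‖ ^ 2 ∂(workerLaw m ν p)) := by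
        rw [Finset.sum_add_distrib, ← Finset.mul_sum]; ring
    _ ≤ 1 / (n : ℝ) * ∑ i, ((1 + 2 * (ω / n)) * B i + 2 * (ω / n) * ‖S.h i - c i‖ ^ 2) := by
        gcongr ?_ * ?_
        exact Finset.sum_le_sum fun i _ => hvar i
    _ = (1 + 2 * (ω / n)) * (1 / (n : ℝ) * ∑ i, B i) + 2 * (ω / n) * sigma1Sq A.F xs S.h := by
        rw [Finset.sum_add_distrib, ← Finset.mul_sum Finset.univ B,
          ← Finset.mul_sum Finset.univ fun i => ‖S.h i - c i‖ ^ 2, sigma1Sq]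
        ring
    _ ≤ (1 + 2 * (ω / n)) * (4 * L * (objective A.F S.x - objective A.F xs)
          + 2 * sigma2Sq A.F xs S.w) + 2 * (ω / n) * sigma1Sq A.F xs S.h := by gcongr
    _ = _ := by ring

/-- The shift contracts towards `∇f_i(x*)`, up to `α` times the mean squared deviation of the
reduced gradients. The coefficient `4Lα` is sharper than `2C₁ = 6Lα` and is kept for the moment
bounds. -/
lemma Input.integral_sigma1Sq_le (hn : 1 ≤ n) (hm : 1 ≤ m) (hp : 0 < p) (hp1 : p < 1)
    (hL : 0 < L) (hc : ∀ i j, ConvexOn ℝ Set.univ (A.F i j)) (hs : ∀ i j, LSmooth L (A.F i j))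
    (hq : QuasiStronglyConvex μ (objective A.F) xs) (hQ : IsQuantization ν A.Q ω)
    (hα : 0 < A.α) (hαω : A.α ≤ 1 / (ω + 1)) (S : State d n) (k : ℕ) :
    Integrable (fun z => sigma1Sq A.F xs (A.step k S z).h) (iterationLaw n m ν p) ∧
    ∫ z, sigma1Sq A.F xs (A.step k S z).h ∂(iterationLaw n m ν p) ≤
      (1 - A.α) * sigma1Sq A.F xs S.h
        + (4 * L * A.α * (objective A.F S.x - objective A.F xs)
          + 2 * A.α * sigma2Sq A.F xs S.w) := by
  have := isProbabilityMeasure_workerLaw (ν := ν) hm hp hp1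
  set c : Fin n → Vec d := fun i => gradient (localObj A.F i) xs with hcdef
  have hw : ∀ i, Integrable (fun z : Fin m × Ξ × Bool =>
      ‖S.h i + A.α • A.Q (A.reducedGradient S i z.1 - S.h i) z.2.1 - c i‖ ^ 2) (workerLaw m ν p) ∧
      ∫ z : Fin m × Ξ × Bool, ‖S.h i + A.α • A.Q (A.reducedGradient S i z.1 - S.h i) z.2.1 - c i‖ ^ 2
        ∂(workerLaw m ν p) ≤ (1 - A.α) * ‖S.h i - c i‖ ^ 2
          + A.α * (1 / (m : ℝ) * ∑ l, ‖A.reducedGradient S i l - c i‖ ^ 2) := by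
    intro i
    have e1 : ∀ v : Vec d, S.h i - c i + v = S.h i + v - c i := fun v => by abel
    have h1 := (hQ.integral_norm_shifted_sq_le hm hp hp1 (A.reducedGradient S i) (S.h i)
      (S.h i - c i) A.α).1
    have h2 := hQ.integral_norm_shift_update_sq_le hm hp hp1 (A.reducedGradient S i) (S.h i) (c i)
      hα hαω
    simp only [e1] at h1 h2
    exact ⟨h1, h2⟩
  have hint : ∀ i, Integrable (fun z => ‖(A.step k S z).h i - c i‖ ^ 2) (iterationLaw n m ν p) :=
    fun i => integrable_comp_eval (μ := fun _ : Fin n => workerLaw m ν p) (hw i).1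
  refine ⟨(integrable_finsetSum _ fun i _ => hint i).const_mul _, ?_⟩
  have hdev := A.reducedGradient_deviation_le hn hm hL hc hs hq S
  unfold sigma1Sq
  rw [integral_const_mul, integral_finsetSum _ fun i _ => hint i]
  calc _ ≤ 1 / (n : ℝ) * ∑ i, ((1 - A.α) * ‖S.h i - c i‖ ^ 2
          + A.α * (1 / (m : ℝ) * ∑ l, ‖A.reducedGradient S i l - c i‖ ^ 2)) := by
        gcongr ?_ * ?_
        refine Finset.sum_le_sum fun i _ => ?_
        exact (integral_comp_eval (μ := fun _ : Fin n => workerLaw m ν p)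
          (hw i).1.aestronglyMeasurable).trans_le (hw i).2
    _ = (1 - A.α) * (1 / (n : ℝ) * ∑ i, ‖S.h i - c i‖ ^ 2) + A.α * (1 / (n : ℝ) *
          ∑ i, (1 / (m : ℝ) * ∑ l, ‖A.reducedGradient S i l - c i‖ ^ 2)) := by
        rw [Finset.sum_add_distrib, ← Finset.mul_sum, ← Finset.mul_sum]; ring
    _ ≤ (1 - A.α) * (1 / (n : ℝ) * ∑ i, ‖S.h i - c i‖ ^ 2) + A.α *
          (4 * L * (objective A.F S.x - objective A.F xs) + 2 * sigma2Sq A.F xs S.w) := by gcongr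
    _ = _ := by ring

lemma Input.integral_sigma2Sq_le (hm : 1 ≤ m) (hp : 0 < p) (hp1 : p < 1)
    (hL : 0 < L) (hc : ∀ i j, ConvexOn ℝ Set.univ (A.F i j)) (hs : ∀ i j, LSmooth L (A.F i j))
    (hq : QuasiStronglyConvex μ (objective A.F) xs) (S : State d n) (k : ℕ) :
    Integrable (fun z => sigma2Sq A.F xs (A.step k S z).w) (iterationLaw n m ν p) ∧
    ∫ z, sigma2Sq A.F xs (A.step k S z).w ∂(iterationLaw n m ν p) ≤
      (1 - p) * sigma2Sq A.F xs S.w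
        + 2 * L * p * (objective A.F S.x - objective A.F xs) := by
  have := isProbabilityMeasure_workerLaw (ν := ν) hm hp hp1
  have hw : ∀ i j, Integrable (fun z : Fin m × Ξ × Bool =>
      ‖gradient (A.F i j) (if z.2.2 then S.x else S.w i) - gradient (A.F i j) xs‖ ^ 2)
        (workerLaw m ν p) ∧ ∫ z : Fin m × Ξ × Bool,
      ‖gradient (A.F i j) (if z.2.2 then S.x else S.w i) - gradient (A.F i j) xs‖ ^ 2
        ∂(workerLaw m ν p) = p * ‖gradient (A.F i j) S.x - gradient (A.F i j) xs‖ ^ 2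
          + (1 - p) * ‖gradient (A.F i j) (S.w i) - gradient (A.F i j) xs‖ ^ 2 := by
    intro i j
    have := integrable_coin (ν := ν) hm hp hp1
      fun b => ‖gradient (A.F i j) (if b then S.x else S.w i) - gradient (A.F i j) xs‖ ^ 2
    simpa using this
  have hint : ∀ i j, Integrable (fun z =>
      ‖gradient (A.F i j) ((A.step k S z).w i) - gradient (A.F i j) xs‖ ^ 2)
      (iterationLaw n m ν p) :=
    fun i j => integrable_comp_eval (μ := fun _ : Fin n => workerLaw m ν p) (hw i j).1
  have hint' : ∀ i, Integrable (fun z => ∑ j,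
      ‖gradient (A.F i j) ((A.step k S z).w i) - gradient (A.F i j) xs‖ ^ 2)
      (iterationLaw n m ν p) := fun i => integrable_finsetSum _ fun j _ => hint i j
  refine ⟨(integrable_finsetSum _ fun i _ => hint' i).const_mul _, ?_⟩
  have hdev := average_gradient_deviation_le hL hc hs hq S.x
  have hval : ∀ i j, ∫ z, ‖gradient (A.F i j) ((A.step k S z).w i) - gradient (A.F i j) xs‖ ^ 2
      ∂(iterationLaw n m ν p) = p * ‖gradient (A.F i j) S.x - gradient (A.F i j) xs‖ ^ 2
          + (1 - p) * ‖gradient (A.F i j) (S.w i) - gradient (A.F i j) xs‖ ^ 2 := fun i j =>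
    (integral_comp_eval (μ := fun _ : Fin n => workerLaw m ν p)
      (hw i j).1.aestronglyMeasurable).trans (hw i j).2
  unfold sigma2Sq
  rw [integral_const_mul, integral_finsetSum _ fun i _ => hint' i]
  simp only [integral_finsetSum _ fun j _ => hint _ j, hval, Finset.sum_add_distrib,
    ← Finset.mul_sum]
  have := mul_le_mul_of_nonneg_left hdev hp.le
  linarith

end OneStep

/-! ### Closed forms for the iterate, the virtual iterate and the error. -/

section ClosedForms

variable {d n m : ℕ} {Ξ Ω : Type*} (A : Input d n m Ξ) (ζ : ℕ → Fin n → Ω → Fin m × Ξ × Bool)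

lemma avg_add (u v : Fin n → Vec d) : (avg fun i => u i + v i) = avg u + avg v := by
  simp only [avg, Finset.sum_add_distrib, smul_add]

lemma avg_sub (u v : Fin n → Vec d) : (avg fun i => u i - v i) = avg u - avg v := by
  simp only [avg, Finset.sum_sub_distrib, smul_sub]

lemma avg_smul (c : ℝ) (u : Fin n → Vec d) : (avg fun i => c • u i) = c • avg u := by
  simp only [avg, ← Finset.smul_sum, smul_smul, mul_comm]

lemma Input.run_succ (k : ℕ) (o : Ω) :
    A.run ζ (k + 1) o = A.step k (A.run ζ k o) fun i => ζ k i o := rfl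

lemma Input.past_run (k t : ℕ) (ht : t < k) (o : Ω) :
    (A.run ζ k o).past t = A.gLocal (A.run ζ t o) fun i => ζ t i o := by
  induction k with
  | zero => omega
  | succ k ih =>
    rw [Input.run_succ]
    change Function.update (A.run ζ k o).past k (A.gLocal (A.run ζ k o) fun i => ζ k i o) t = _
    rcases Nat.lt_succ_iff_lt_or_eq.1 ht with h | rfl
    · rw [Function.update_of_ne h.ne, ih h]
    · rw [Function.update_self]

lemma Input.avg_v_run (k : ℕ) (o : Ω) :
    avg (A.v k (A.run ζ k o) fun i => ζ k i o) =
      if A.τ ≤ k then A.γ • A.gProc ζ (k - A.τ) o else 0 := by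
  split_ifs with h
  -- The memory used at iteration `k` is the past of state `k + 1`: it already contains `g^k`, which
  -- matters when `τ = 0`.
  · have h1 : A.memory k (A.run ζ k o) (fun i => ζ k i o) (k - A.τ)
        = A.gLocal (A.run ζ (k - A.τ) o) fun i => ζ (k - A.τ) i o :=
      A.past_run ζ (k + 1) (k - A.τ) (by omega) o
    have h2 : (A.v k (A.run ζ k o) fun i => ζ k i o)
        = fun i => A.γ • A.gLocal (A.run ζ (k - A.τ) o) (fun i => ζ (k - A.τ) i o) i := by
      funext i
      rw [Input.v, if_pos h, h1]
    rw [h2, avg_smul, Input.gProc]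
  · have h2 : (A.v k (A.run ζ k o) fun i => ζ k i o) = fun _ => 0 := by
      funext i
      rw [Input.v, if_neg h]
    rw [h2]
    simp [avg]

/-- Truncated subtraction covers the initial phase: for `k ≤ τ` the sum is empty and the iterate has
not moved. -/
lemma Input.xProc_eq (k : ℕ) (o : Ω) :
    A.xProc ζ k o = A.x₀ - A.γ • ∑ t ∈ Finset.range (k - A.τ), A.gProc ζ t o := by
  induction k with
  | zero => simp [Input.xProc, Input.run, Input.state, Input.init]
  | succ k ih =>
    have h1 : A.xProc ζ (k + 1) o
        = A.xProc ζ k o - avg (A.v k (A.run ζ k o) fun i => ζ k i o) := rfl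
    rw [h1, ih, A.avg_v_run]
    split_ifs with h
    · rw [show k + 1 - A.τ = k - A.τ + 1 by omega, Finset.sum_range_succ, smul_add]
      abel
    · rw [show k + 1 - A.τ = k - A.τ by omega, sub_zero]

/-- What the iterate has not yet applied is stored in the error, so the delayed contributions cancel
and an undelayed stochastic gradient step remains. -/
lemma Input.xTilde_succ (k : ℕ) (o : Ω) :
    A.xProc ζ (k + 1) o - A.eProc ζ (k + 1) o
      = A.xProc ζ k o - A.eProc ζ k o - A.γ • A.gProc ζ k o := by
  have h1 : A.xProc ζ (k + 1) o
      = A.xProc ζ k o - avg (A.v k (A.run ζ k o) fun i => ζ k i o) := rfl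
  have h2 : A.eProc ζ (k + 1) o = A.eProc ζ k o + A.γ • A.gProc ζ k o
      - avg (A.v k (A.run ζ k o) fun i => ζ k i o) := by
    rw [Input.gProc, ← avg_smul]
    exact (avg_sub _ _).trans (congrArg (· - _) (avg_add _ _))
  rw [h1, h2]
  abel

lemma Input.xTilde_eq (k : ℕ) (o : Ω) :
    A.xProc ζ k o - A.eProc ζ k o = A.x₀ - A.γ • ∑ t ∈ Finset.range k, A.gProc ζ t o := by
  induction k with
  | zero => simp [Input.xProc, Input.eProc, Input.run, Input.state, Input.init, avg]
  | succ k ih =>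
    rw [A.xTilde_succ, ih, Finset.sum_range_succ, smul_add]
    abel

lemma Input.eProc_eq (k : ℕ) (o : Ω) :
    A.eProc ζ k o = A.γ • ∑ t ∈ Finset.Ico (k - A.τ) k, A.gProc ζ t o := by
  have h1 := A.xTilde_eq ζ k o
  rw [A.xProc_eq] at h1
  rw [Finset.sum_Ico_eq_sub _ (Nat.sub_le k A.τ), smul_sub]
  have h2 : A.eProc ζ k o = A.x₀ - A.γ • ∑ t ∈ Finset.range (k - A.τ), A.gProc ζ t o
      - (A.x₀ - A.γ • ∑ t ∈ Finset.range (k - A.τ), A.gProc ζ t o - A.eProc ζ k o) := by abel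
  rw [h2, h1]
  abel

end ClosedForms

/-! ### Measurability of one iteration as a function of its core and its randomness. -/

section Core

variable {d n m : ℕ} {Ξ : Type*}

/-- The part `(x, h, w)` of a state on which the next stochastic gradients depend. -/
abbrev Core (d n : ℕ) : Type := Vec d × (Fin n → Vec d) × (Fin n → Vec d)

/-- A state with given core. -/
def Core.toState (u : Core d n) : State d n where
  x := u.1
  e := fun _ => 0
  h := u.2.1
  w := u.2.2
  past := fun _ _ => 0

/-- The core of a state. -/
def State.core (S : State d n) : Core d n := (S.x, S.h, S.w)

variable {A : Input d n m Ξ} {L ω : ℝ}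

lemma measurable_gradient_localObj (hL : 0 < L) (hs : ∀ i j, LSmooth L (A.F i j)) (i : Fin n) :
    Measurable (gradient (localObj A.F i)) := by
  have : gradient (localObj A.F i) = fun x => (1 / (m : ℝ)) • ∑ j, gradient (A.F i j) x := by
    funext x
    rw [gradient_localObj hs, avg]
  rw [this]
  exact (Finset.measurable_sum _ fun j _ =>
    ((hs i j).continuous_gradient hL).measurable).const_smul (1 / (m : ℝ))

lemma measurable_gradient_index (hL : 0 < L) (hs : ∀ i j, LSmooth L (A.F i j)) (i : Fin n) :
    Measurable fun q : Fin m × Vec d => gradient (A.F i q.1) q.2 :=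
  measurable_from_prod_countable_right fun l => ((hs i l).continuous_gradient hL).measurable

lemma measurable_sigma1Sq (F : Fin n → Fin m → Vec d → ℝ) (xs : Vec d) :
    Measurable (sigma1Sq F xs) := by
  unfold sigma1Sq
  exact (Finset.measurable_sum _ fun i _ =>
    ((measurable_pi_apply i).sub_const _).norm.pow_const 2).const_mul _

lemma measurable_sigma2Sq (hL : 0 < L) (hs : ∀ i j, LSmooth L (A.F i j)) (xs : Vec d) :
    Measurable (sigma2Sq A.F xs) := by
  unfold sigma2Sq
  exact (Finset.measurable_sum _ fun i _ => Finset.measurable_sum _ fun j _ =>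
    (((((hs i j).continuous_gradient hL).measurable).comp
      (measurable_pi_apply i)).sub_const _).norm.pow_const 2).const_mul _

lemma sigma1Sq_nonneg (F : Fin n → Fin m → Vec d → ℝ) (xs : Vec d) (h : Fin n → Vec d) :
    0 ≤ sigma1Sq F xs h := by unfold sigma1Sq; positivity

lemma sigma2Sq_nonneg (F : Fin n → Fin m → Vec d → ℝ) (xs : Vec d) (w : Fin n → Vec d) :
    0 ≤ sigma2Sq F xs w := by unfold sigma2Sq; positivity

lemma continuous_gradient_objective (hL : 0 < L) (hs : ∀ i j, LSmooth L (A.F i j)) :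
    Continuous (gradient (objective A.F)) := by
  have : gradient (objective A.F)
      = fun x => (1 / (n : ℝ)) • ∑ i, (1 / (m : ℝ)) • ∑ j, gradient (A.F i j) x := by
    funext x
    rw [gradient_objective hs, avg]
    simp only [gradient_localObj hs, avg]
  rw [this]
  exact (continuous_finsetSum _ fun i _ => (continuous_finsetSum _ fun j _ =>
    (hs i j).continuous_gradient hL).const_smul (1 / (m : ℝ))).const_smul (1 / (n : ℝ))

variable [MeasurableSpace Ξ] {ν : Measure Ξ}

lemma measurable_delta (hL : 0 < L) (hs : ∀ i j, LSmooth L (A.F i j))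
    (hQ : IsQuantization ν A.Q ω) (i : Fin n) :
    Measurable fun q : Core d n × (Fin n → Fin m × Ξ × Bool) => A.delta q.1.toState q.2 i := by
  have hz : Measurable fun q : Core d n × (Fin n → Fin m × Ξ × Bool) => q.2 i :=
    (measurable_pi_apply i).comp measurable_snd
  have hx : Measurable fun q : Core d n × (Fin n → Fin m × Ξ × Bool) => q.1.1 :=
    measurable_fst.comp measurable_fst
  have hw : Measurable fun q : Core d n × (Fin n → Fin m × Ξ × Bool) => q.1.2.2 i :=
    (measurable_pi_apply i).comp (measurable_snd.comp (measurable_snd.comp measurable_fst))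
  have hh : Measurable fun q : Core d n × (Fin n → Fin m × Ξ × Bool) => q.1.2.1 i :=
    (measurable_pi_apply i).comp (measurable_fst.comp (measurable_snd.comp measurable_fst))
  have h1 := (measurable_gradient_index hL hs i).comp (hz.fst.prodMk hx)
  have h2 := (measurable_gradient_index hL hs i).comp (hz.fst.prodMk hw)
  have h3 := (measurable_gradient_localObj hL hs i).comp hw
  exact hQ.measurable.comp ((((h1.sub h2).add h3).sub hh).prodMk hz.snd.fst)

lemma measurable_avg {X : Type*} [MeasurableSpace X] {u : X → Fin n → Vec d}
    (hu : ∀ i, Measurable fun q => u q i) : Measurable fun q => avg (u q) := by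
  unfold avg
  exact (Finset.measurable_sum _ fun i _ => hu i).const_smul (1 / (n : ℝ))

lemma measurable_avg_gLocal (hL : 0 < L) (hs : ∀ i j, LSmooth L (A.F i j))
    (hQ : IsQuantization ν A.Q ω) :
    Measurable fun q : Core d n × (Fin n → Fin m × Ξ × Bool) => avg (A.gLocal q.1.toState q.2) := by
  refine measurable_avg fun i => ?_
  have hh : Measurable fun q : Core d n × (Fin n → Fin m × Ξ × Bool) => q.1.2.1 i :=
    (measurable_pi_apply i).comp (measurable_fst.comp (measurable_snd.comp measurable_fst))
  exact hh.add (measurable_delta hL hs hQ i)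

lemma measurable_step_h (hL : 0 < L) (hs : ∀ i j, LSmooth L (A.F i j))
    (hQ : IsQuantization ν A.Q ω) (k : ℕ) :
    Measurable fun q : Core d n × (Fin n → Fin m × Ξ × Bool) => (A.step k q.1.toState q.2).h := by
  refine measurable_pi_lambda _ fun i => ?_
  have hh : Measurable fun q : Core d n × (Fin n → Fin m × Ξ × Bool) => q.1.2.1 i :=
    (measurable_pi_apply i).comp (measurable_fst.comp (measurable_snd.comp measurable_fst))
  exact hh.add ((measurable_delta hL hs hQ i).const_smul A.α)

lemma measurable_step_w (A : Input d n m Ξ) (k : ℕ) :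
    Measurable fun q : Core d n × (Fin n → Fin m × Ξ × Bool) => (A.step k q.1.toState q.2).w := by
  refine measurable_pi_lambda _ fun i => ?_
  have hz : Measurable fun q : Core d n × (Fin n → Fin m × Ξ × Bool) => q.2 i :=
    (measurable_pi_apply i).comp measurable_snd
  have hx : Measurable fun q : Core d n × (Fin n → Fin m × Ξ × Bool) => q.1.1 :=
    measurable_fst.comp measurable_fst
  have hw : Measurable fun q : Core d n × (Fin n → Fin m × Ξ × Bool) => q.1.2.2 i :=
    (measurable_pi_apply i).comp (measurable_snd.comp (measurable_snd.comp measurable_fst))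
  exact Measurable.ite (hz.snd.snd (measurableSet_singleton true)) hx hw

end Core

/-! ### The history filtration and the independence of fresh randomness. -/

section History

variable {n m : ℕ} {Ξ Ω : Type*} [MeasurableSpace Ξ]

lemma history_mono (ζ : ℕ → Fin n → Ω → Fin m × Ξ × Bool) : Monotone (history ζ) := by
  intro k l hkl
  exact iSup_le fun t => le_iSup_of_le (⟨t.1, t.2.trans_le hkl⟩ : {t : ℕ // t < l}) le_rfl

lemma measurable_history (ζ : ℕ → Fin n → Ω → Fin m × Ξ × Bool) {k t : ℕ} (ht : t < k) :
    Measurable[history ζ k] fun o i => ζ t i o := by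
  refine @measurable_pi_lambda _ _ _ (history ζ k) _ _ fun i => ?_
  refine Measurable.of_comap_le ?_
  exact le_iSup_of_le (⟨t, ht⟩ : {t : ℕ // t < k})
    (le_iSup (fun i => MeasurableSpace.comap (ζ t i) inferInstance) i)

variable [mΩ : MeasurableSpace Ω] {P : Measure Ω} {ν : Measure Ξ} {p : ℝ}
  {ζ : ℕ → Fin n → Ω → Fin m × Ξ × Bool}

lemma history_le (hζ : ∀ k i, Measurable (ζ k i)) (k : ℕ) : history ζ k ≤ mΩ :=
  iSup_le fun t => iSup_le fun i => (hζ t i).comap_le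

lemma IsSampling.measurable_iteration (hζ : IsSampling P ν p ζ) (k : ℕ) :
    Measurable fun o i => ζ k i o :=
  measurable_pi_lambda _ fun i => hζ.measurable k i

lemma IsSampling.map_iteration [IsProbabilityMeasure P] (hζ : IsSampling P ν p ζ) (k : ℕ) :
    P.map (fun o i => ζ k i o) = iterationLaw n m ν p := by
  have hind : iIndepFun (fun i : Fin n => ζ k i) P :=
    hζ.indep.precomp (g := fun i : Fin n => (k, i)) fun i j h => (Prod.mk.inj h).2
  rw [(iIndepFun_iff_map_fun_eq_pi_map fun i => (hζ.measurable k i).aemeasurable).1 hind]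
  simp only [hζ.law]
  rfl

/-- The index sets `q.1 < k` and `q.1 = k` are disjoint, and grouping an independent family along
disjoint sets preserves independence. -/
lemma IsSampling.indep_history (hζ : IsSampling P ν p ζ) (k : ℕ) :
    Indep (history ζ k) (MeasurableSpace.comap (fun o i => ζ k i o) inferInstance) P := by
  have h := indep_iSup_of_disjoint (m := fun q : ℕ × Fin n =>
    MeasurableSpace.comap (ζ q.1 q.2) inferInstance) (fun q => (hζ.measurable q.1 q.2).comap_le)
    hζ.indep (S := {q | q.1 < k}) (T := {q | q.1 = k})
    (Set.disjoint_left.2 fun q h1 h2 => (lt_irrefl k) (h2 ▸ h1 : k < k))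
  refine indep_of_indep_of_le_left (indep_of_indep_of_le_right h ?_) ?_
  · refine Measurable.comap_le ?_
    refine @measurable_pi_lambda _ _ _ (_) _ _ fun i => Measurable.of_comap_le ?_
    exact le_iSup₂_of_le (f := fun (q : ℕ × Fin n) (_ : q ∈ {q : ℕ × Fin n | q.1 = k}) =>
      MeasurableSpace.comap (ζ q.1 q.2) inferInstance) (k, i) rfl le_rfl
  · exact iSup_le fun t => iSup_le fun i =>
      le_iSup₂_of_le (f := fun (q : ℕ × Fin n) (_ : q ∈ {q : ℕ × Fin n | q.1 < k}) =>
      MeasurableSpace.comap (ζ q.1 q.2) inferInstance) (t.1, i) t.2 le_rfl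

end History

/-! ### Adaptedness, integrability and conditional moments along the trajectory. -/

section Trajectory

/-- The standing assumptions on the problem, the quantization, the sampling and the parameters, except
for the bound on the stepsize. -/
structure StandingAssumptions {d n m : ℕ} {Ξ Ω : Type*} [MeasurableSpace Ω] [MeasurableSpace Ξ]
    (P : Measure Ω) (ν : Measure Ξ) (A : Input d n m Ξ) (ζ : ℕ → Fin n → Ω → Fin m × Ξ × Bool)
    (xs : Vec d) (L μ ω p : ℝ) : Prop where
  hn : 1 ≤ n
  hm : 1 ≤ m
  hL : 0 < L
  hμ : 0 ≤ μ
  hp : 0 < p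
  hp1 : p < 1
  hconv : ∀ i j, ConvexOn ℝ Set.univ (A.F i j)
  hsmooth : ∀ i j, LSmooth L (A.F i j)
  hqsc : QuasiStronglyConvex μ (objective A.F) xs
  hQ : IsQuantization ν A.Q ω
  hζ : IsSampling P ν p ζ
  hα : 0 < A.α
  hαω : A.α ≤ 1 / (ω + 1)
  hγ : 0 < A.γ

lemma measurable_sub_smul_sum {d : ℕ} {X : Type*} [MeasurableSpace X] (c : Vec d) (a : ℝ)
    (s : Finset ℕ) {g : ℕ → X → Vec d} (hg : ∀ t ∈ s, Measurable (g t)) :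
    Measurable fun o => c - a • ∑ t ∈ s, g t o :=
  measurable_const.sub ((Finset.measurable_sum s hg).const_smul a)

variable {d n m : ℕ} {Ξ Ω : Type*}

/-- The closed form makes measurability of the memory unnecessary: only the earlier stochastic
gradients matter. -/
lemma measurable_xProc_of_gProc (A : Input d n m Ξ) (ζ : ℕ → Fin n → Ω → Fin m × Ξ × Bool)
    {m₀ : MeasurableSpace Ω} {k : ℕ} (hg : ∀ t < k, Measurable[m₀] (A.gProc ζ t)) :
    Measurable[m₀] (A.xProc ζ k) := by
  have h := @measurable_sub_smul_sum d Ω m₀ A.x₀ A.γ (Finset.range (k - A.τ)) (A.gProc ζ)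
    fun t ht => hg t (by rw [Finset.mem_range] at ht; omega)
  simpa only [← A.xProc_eq ζ k] using h

lemma measurable_eProc_of_gProc (A : Input d n m Ξ) (ζ : ℕ → Fin n → Ω → Fin m × Ξ × Bool)
    {m₀ : MeasurableSpace Ω} {k : ℕ} (hg : ∀ t < k, Measurable[m₀] (A.gProc ζ t)) :
    Measurable[m₀] (A.eProc ζ k) := by
  have h := @measurable_sub_smul_sum d Ω m₀ 0 (-A.γ) (Finset.Ico (k - A.τ) k) (A.gProc ζ)
    fun t ht => hg t (Finset.mem_Ico.1 ht).2
  simpa only [zero_sub, neg_smul, neg_neg, ← A.eProc_eq ζ k] using h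

lemma Input.gProc_eq_core (A : Input d n m Ξ) (ζ : ℕ → Fin n → Ω → Fin m × Ξ × Bool) (k : ℕ) :
    A.gProc ζ k = fun o => avg (A.gLocal (A.run ζ k o).core.toState fun i => ζ k i o) := rfl

variable [mΩ : MeasurableSpace Ω] {P : Measure Ω} {A : Input d n m Ξ}
  {ζ : ℕ → Fin n → Ω → Fin m × Ξ × Bool}

lemma Input.memLp_xProc [IsProbabilityMeasure P] {k : ℕ} (hg : ∀ t < k, MemLp (A.gProc ζ t) 2 P) :
    MemLp (A.xProc ζ k) 2 P := by
  have h : MemLp (fun o => A.x₀ - A.γ • ∑ t ∈ Finset.range (k - A.τ), A.gProc ζ t o) 2 P :=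
    (memLp_const _).sub ((memLp_finsetSum _ fun t ht => hg t
      (by rw [Finset.mem_range] at ht; omega)).const_smul A.γ)
  simpa only [← A.xProc_eq ζ k] using h

lemma Input.memLp_eProc {k : ℕ} (hg : ∀ t < k, MemLp (A.gProc ζ t) 2 P) :
    MemLp (A.eProc ζ k) 2 P := by
  have h : MemLp (fun o => A.γ • ∑ t ∈ Finset.Ico (k - A.τ) k, A.gProc ζ t o) 2 P :=
    (memLp_finsetSum _ fun t ht => hg t (Finset.mem_Ico.1 ht).2).const_smul A.γ
  simpa only [← A.eProc_eq ζ k] using h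

variable [MeasurableSpace Ξ] {ν : Measure Ξ} {xs : Vec d} {L μ ω p : ℝ}

namespace StandingAssumptions

variable (H : StandingAssumptions P ν A ζ xs L μ ω p)
include H

/-- The three claims need one joint induction: earlier gradients make `x^k`, hence the core,
measurable, and the core with the fresh randomness determines `g^k`, `h^{k+1}` and `w^{k+1}`. -/
lemma measurable_run (k : ℕ) : Measurable[history ζ k] (fun o => (A.run ζ k o).h) ∧
    Measurable[history ζ k] (fun o => (A.run ζ k o).w) ∧
    ∀ t < k, Measurable[history ζ k] (A.gProc ζ t) := by
  induction k with
  | zero => exact ⟨measurable_const, measurable_const, fun t ht => absurd ht (by omega)⟩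
  | succ k ih =>
    obtain ⟨h1, h2, h3⟩ := ih
    have hx := measurable_xProc_of_gProc A ζ h3
    have hU : Measurable[history ζ k] fun o => (A.run ζ k o).core := hx.prodMk (h1.prodMk h2)
    have hUZ : Measurable[history ζ (k + 1)] fun o => ((A.run ζ k o).core, fun i => ζ k i o) :=
      (hU.mono (history_mono ζ k.le_succ) le_rfl).prodMk (measurable_history ζ k.lt_succ_self)
    have hg : Measurable[history ζ (k + 1)] (A.gProc ζ k) := by
      have h := (measurable_avg_gLocal H.hL H.hsmooth H.hQ).comp hUZ
      rw [A.gProc_eq_core]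
      exact h
    refine ⟨(measurable_step_h H.hL H.hsmooth H.hQ k).comp hUZ, (measurable_step_w A k).comp hUZ,
      fun t ht => ?_⟩
    rcases Nat.lt_succ_iff_lt_or_eq.1 ht with h | rfl
    · exact (h3 t h).mono (history_mono ζ k.le_succ) le_rfl
    · exact hg

lemma measurable_xProc (k : ℕ) : Measurable[history ζ k] (A.xProc ζ k) :=
  measurable_xProc_of_gProc A ζ (H.measurable_run k).2.2

lemma measurable_eProc (k : ℕ) : Measurable[history ζ k] (A.eProc ζ k) :=
  measurable_eProc_of_gProc A ζ (H.measurable_run k).2.2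

lemma measurable_core (k : ℕ) : Measurable[history ζ k] fun o => (A.run ζ k o).core :=
  (H.measurable_xProc k).prodMk ((H.measurable_run k).1.prodMk (H.measurable_run k).2.1)

lemma measurable_gProc (k : ℕ) : Measurable[history ζ (k + 1)] (A.gProc ζ k) :=
  (H.measurable_run (k + 1)).2.2 k k.lt_succ_self

lemma history_le (k : ℕ) : history ζ k ≤ mΩ := DLSVRGDiana.history_le H.hζ.measurable k

lemma aestronglyMeasurable_gProc (k : ℕ) : AEStronglyMeasurable (A.gProc ζ k) P :=
  ((H.measurable_gProc k).mono (H.history_le _) le_rfl).aestronglyMeasurable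

lemma gap_nonneg (x : Vec d) : 0 ≤ objective A.F x - objective A.F xs :=
  sub_nonneg.2 (H.hqsc.1 x)

lemma continuous_objective : Continuous (objective A.F) :=
  (differentiable_objective H.hsmooth).continuous

lemma integrable_gap_of_memLp [IsProbabilityMeasure P] {X : Ω → Vec d} (hX : MemLp X 2 P) :
    Integrable (fun o => objective A.F (X o) - objective A.F xs) P := by
  have h1 := (integrable_norm_sq (hX.sub (memLp_const xs))).const_mul (L / 2)
  refine h1.mono' ((H.continuous_objective.comp_aestronglyMeasurable
    hX.aestronglyMeasurable).sub aestronglyMeasurable_const) (Filter.Eventually.of_forall fun o => ?_)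
  rw [Real.norm_of_nonneg (H.gap_nonneg _)]
  exact objective_sub_le H.hn H.hm H.hsmooth H.hqsc _

variable [IsProbabilityMeasure P] [IsProbabilityMeasure ν]

/-- One iteration, conditionally on the history. -/
lemma step_bounds {k : ℕ} (hx : Integrable (fun o => objective A.F (A.xProc ζ k o) - objective A.F xs) P)
    (h₁ : Integrable (A.sigma1Proc ζ xs k) P) (h₂ : Integrable (A.sigma2Proc ζ xs k) P) :
    (Integrable (fun o => ‖A.gProc ζ k o‖ ^ 2) P ∧
      P[fun o => ‖A.gProc ζ k o‖ ^ 2 | history ζ k] ≤ᵐ[P] fun o =>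
        4 * L * (1 + 2 * (ω / n)) * (objective A.F (A.xProc ζ k o) - objective A.F xs)
        + 2 * (ω / n) * A.sigma1Proc ζ xs k o + 2 * (1 + 2 * (ω / n)) * A.sigma2Proc ζ xs k o) ∧
    (Integrable (A.sigma1Proc ζ xs (k + 1)) P ∧
      P[A.sigma1Proc ζ xs (k + 1) | history ζ k] ≤ᵐ[P] fun o =>
        (1 - A.α) * A.sigma1Proc ζ xs k o
        + (4 * L * A.α * (objective A.F (A.xProc ζ k o) - objective A.F xs)
          + 2 * A.α * A.sigma2Proc ζ xs k o)) ∧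
    (Integrable (A.sigma2Proc ζ xs (k + 1)) P ∧
      P[A.sigma2Proc ζ xs (k + 1) | history ζ k] ≤ᵐ[P] fun o =>
        (1 - p) * A.sigma2Proc ζ xs k o
        + 2 * L * p * (objective A.F (A.xProc ζ k o) - objective A.F xs)) := by
  have hle := H.history_le k
  have hU := H.measurable_core k
  have hZ := H.hζ.measurable_iteration k
  have hind := H.hζ.indep_history k
  have hlaw := H.hζ.map_iteration k
  have hf : Measurable fun u : Core d n => objective A.F u.1 - objective A.F xs :=
    (H.continuous_objective.measurable.comp measurable_fst).sub_const _
  have hσ₁ : Measurable fun u : Core d n => sigma1Sq A.F xs u.2.1 :=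
    (measurable_sigma1Sq A.F xs).comp (measurable_fst.comp measurable_snd)
  have hσ₂ : Measurable fun u : Core d n => sigma2Sq A.F xs u.2.2 :=
    (measurable_sigma2Sq H.hL H.hsmooth xs).comp (measurable_snd.comp measurable_snd)
  refine ⟨?_, ?_, ?_⟩
  · refine integrable_and_condExp_le hle hU hZ hind
      (Φ := fun q => ‖avg (A.gLocal q.1.toState q.2)‖ ^ 2)
      (ψ := fun u => 4 * L * (1 + 2 * (ω / n)) * (objective A.F u.1 - objective A.F xs)
        + 2 * (ω / n) * sigma1Sq A.F xs u.2.1 + 2 * (1 + 2 * (ω / n)) * sigma2Sq A.F xs u.2.2)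
      ((measurable_avg_gLocal H.hL H.hsmooth H.hQ).norm.pow_const 2) (fun q => sq_nonneg _)
      (((hf.const_mul _).add (hσ₁.const_mul _)).add (hσ₂.const_mul _)) (fun u => ?_) (fun u => ?_)
      (((hx.const_mul _).add (h₁.const_mul _)).add (h₂.const_mul _))
    · rw [hlaw]
      exact integrable_norm_sq (A.memLp_avg_gLocal H.hm H.hp H.hp1 H.hQ u.toState)
    · rw [hlaw]
      exact A.integral_norm_avg_gLocal_sq_le H.hn H.hm H.hp H.hp1 H.hL H.hconv H.hsmooth H.hqsc
        H.hQ u.toState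
  · refine integrable_and_condExp_le hle hU hZ hind
      (Φ := fun q => sigma1Sq A.F xs (A.step k q.1.toState q.2).h)
      (ψ := fun u => (1 - A.α) * sigma1Sq A.F xs u.2.1
        + (4 * L * A.α * (objective A.F u.1 - objective A.F xs)
          + 2 * A.α * sigma2Sq A.F xs u.2.2))
      ((measurable_sigma1Sq A.F xs).comp (measurable_step_h H.hL H.hsmooth H.hQ k))
      (fun q => sigma1Sq_nonneg _ _ _)
      ((hσ₁.const_mul _).add ((hf.const_mul _).add (hσ₂.const_mul _))) (fun u => ?_) (fun u => ?_)
      ((h₁.const_mul _).add ((hx.const_mul _).add (h₂.const_mul _)))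
    · rw [hlaw]
      exact (A.integral_sigma1Sq_le H.hn H.hm H.hp H.hp1 H.hL H.hconv H.hsmooth H.hqsc H.hQ H.hα
        H.hαω u.toState k).1
    · rw [hlaw]
      exact (A.integral_sigma1Sq_le H.hn H.hm H.hp H.hp1 H.hL H.hconv H.hsmooth H.hqsc H.hQ H.hα
        H.hαω u.toState k).2
  · refine integrable_and_condExp_le hle hU hZ hind
      (Φ := fun q => sigma2Sq A.F xs (A.step k q.1.toState q.2).w)
      (ψ := fun u => (1 - p) * sigma2Sq A.F xs u.2.2
        + 2 * L * p * (objective A.F u.1 - objective A.F xs))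
      ((measurable_sigma2Sq H.hL H.hsmooth xs).comp (measurable_step_w A k))
      (fun q => sigma2Sq_nonneg _ _ _)
      ((hσ₂.const_mul _).add (hf.const_mul _)) (fun u => ?_) (fun u => ?_)
      ((h₂.const_mul _).add (hx.const_mul _))
    · rw [hlaw]
      exact (A.integral_sigma2Sq_le H.hm H.hp H.hp1 H.hL H.hconv H.hsmooth H.hqsc u.toState k).1
    · rw [hlaw]
      exact (A.integral_sigma2Sq_le H.hm H.hp H.hp1 H.hL H.hconv H.hsmooth H.hqsc u.toState k).2

/-- Again a joint induction: square integrable earlier gradients make the gap at `x^k` integrable,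
which with the two variances bounds the moments of the next step. -/
lemma integrable_processes (k : ℕ) : (∀ t < k, MemLp (A.gProc ζ t) 2 P) ∧
    Integrable (A.sigma1Proc ζ xs k) P ∧ Integrable (A.sigma2Proc ζ xs k) P := by
  induction k with
  | zero => exact ⟨fun t ht => absurd ht (by omega), integrable_const (sigma1Sq A.F xs A.h₀),
      integrable_const (sigma2Sq A.F xs A.w₀)⟩
  | succ k ih =>
    obtain ⟨h1, h2, h3⟩ := ih
    obtain ⟨b1, b2, b3⟩ := H.step_bounds (H.integrable_gap_of_memLp (A.memLp_xProc h1)) h2 h3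
    refine ⟨fun t ht => ?_, b2.1, b3.1⟩
    rcases Nat.lt_succ_iff_lt_or_eq.1 ht with h | rfl
    · exact h1 t h
    · exact memLp_two_of_integrable_norm_sq (H.aestronglyMeasurable_gProc t) b1.1

lemma memLp_gProc (k : ℕ) : MemLp (A.gProc ζ k) 2 P :=
  (H.integrable_processes (k + 1)).1 k k.lt_succ_self

lemma memLp_x (k : ℕ) : MemLp (A.xProc ζ k) 2 P := A.memLp_xProc fun t _ => H.memLp_gProc t

lemma memLp_e (k : ℕ) : MemLp (A.eProc ζ k) 2 P := A.memLp_eProc fun t _ => H.memLp_gProc t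

lemma integrable_gap (k : ℕ) :
    Integrable (fun o => objective A.F (A.xProc ζ k o) - objective A.F xs) P :=
  H.integrable_gap_of_memLp (H.memLp_x k)

lemma condExp_gProc (k : ℕ) :
    P[A.gProc ζ k | history ζ k] =ᵐ[P] fun o => gradient (objective A.F) (A.xProc ζ k o) := by
  have h := condExp_prodMk_ae_eq (H.history_le k) (H.measurable_core k)
    (H.hζ.measurable_iteration k) (H.hζ.indep_history k)
    (Φ := fun q => avg (A.gLocal q.1.toState q.2)) (measurable_avg_gLocal H.hL H.hsmooth H.hQ)
    ((H.memLp_gProc k).integrable (by norm_num))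
  refine h.trans (Filter.Eventually.of_forall fun o => ?_)
  simp only [H.hζ.map_iteration k]
  exact A.integral_avg_gLocal H.hm H.hp H.hp1 H.hsmooth H.hQ _

lemma memLp_gradient (k : ℕ) : MemLp (fun o => gradient (objective A.F) (A.xProc ζ k o)) 2 P := by
  have hmeas : AEStronglyMeasurable (fun o => gradient (objective A.F) (A.xProc ζ k o)) P :=
    (continuous_gradient_objective H.hL H.hsmooth).comp_aestronglyMeasurable
      (H.memLp_x k).aestronglyMeasurable
  refine memLp_two_of_integrable_norm_sq hmeas
    (((H.integrable_gap k).const_mul (2 * L)).mono' (hmeas.norm.pow 2)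
      (Filter.Eventually.of_forall fun o => ?_))
  rw [Real.norm_of_nonneg (sq_nonneg _)]
  exact norm_gradient_objective_sq_le H.hn H.hm H.hL H.hconv H.hsmooth H.hqsc _

/-- The tower property: the conditional mean given the history is already a function of `x^k`. -/
lemma condExp_gProc_iterate (k : ℕ) :
    P[A.gProc ζ k | MeasurableSpace.comap (A.xProc ζ k) inferInstance] =ᵐ[P]
      fun o => gradient (objective A.F) (A.xProc ζ k o) := by
  have hle : MeasurableSpace.comap (A.xProc ζ k) inferInstance ≤ history ζ k :=
    (H.measurable_xProc k).comap_le
  have h1 := condExp_condExp_of_le (μ := P) (f := A.gProc ζ k) hle (H.history_le k)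
  have h2 := condExp_congr_ae (m := MeasurableSpace.comap (A.xProc ζ k) inferInstance)
    (H.condExp_gProc k)
  refine h1.symm.trans (h2.trans ?_)
  rw [condExp_of_stronglyMeasurable (hle.trans (H.history_le k)) _
    ((H.memLp_gradient k).integrable (by norm_num))]
  exact ((continuous_gradient_objective H.hL H.hsmooth).measurable.comp
    (comap_measurable (A.xProc ζ k))).stronglyMeasurable

/-- The noise of iteration `k` is orthogonal to everything known before. -/
lemma integral_inner_gProc {k : ℕ} {Y : Ω → Vec d} (hY : Measurable[history ζ k] Y)
    (hY2 : MemLp Y 2 P) :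
    ∫ o, inner ℝ (Y o) (A.gProc ζ k o) ∂P =
      ∫ o, inner ℝ (Y o) (gradient (objective A.F) (A.xProc ζ k o)) ∂P := by
  have h1 := condExp_bilin_of_stronglyMeasurable_left (m := history ζ k) (μ := P) (innerSL ℝ)
    hY.stronglyMeasurable (integrable_inner hY2 (H.memLp_gProc k))
    ((H.memLp_gProc k).integrable (by norm_num))
  have h2 := integral_condExp (μ := P) (f := fun o => inner ℝ (Y o) (A.gProc ζ k o))
    (H.history_le k)
  rw [← h2]
  refine integral_congr_ae (h1.trans ?_)
  filter_upwards [H.condExp_gProc k] with o ho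
  rw [ho]
  rfl

end StandingAssumptions

end Trajectory

/-! ### Recursions for the expectations. -/

section Moments

variable {d n m : ℕ} {Ξ Ω : Type*} [mΩ : MeasurableSpace Ω] {P : Measure Ω} {A : Input d n m Ξ}
  {ζ : ℕ → Fin n → Ω → Fin m × Ξ × Bool} [MeasurableSpace Ξ] {ν : Measure Ξ} {xs : Vec d}
  {L μ ω p : ℝ}

namespace StandingAssumptions

variable (H : StandingAssumptions P ν A ζ xs L μ ω p)
include H

/-- The coefficient `3L` of `‖e‖²` is `2L + L`. The first part comes from Young's inequality `2⟨e,
∇f⟩ ≤ 2L‖e‖² + ‖∇f‖²/(2L)`, whose last term is at most the gap. The second comes from replacing `‖x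
- x*‖²` by `‖x̃ - x*‖²/2 - ‖e‖²` and using `μ‖e‖² ≤ L‖e‖²`. -/
lemma descent_pointwise (x e : Vec d) :
    ‖x - e - xs‖ ^ 2 - 2 * A.γ * inner ℝ (x - e - xs) (gradient (objective A.F) x) ≤
      (1 - A.γ * μ / 2) * ‖x - e - xs‖ ^ 2
        + (3 * L * A.γ * ‖e‖ ^ 2 - A.γ * (objective A.F x - objective A.F xs)) := by
  have h1 := H.hqsc.2 x
  have h2 := norm_gradient_objective_sq_le H.hn H.hm H.hL H.hconv H.hsmooth H.hqsc x
  have h3 := modulus_mul_norm_sq_le H.hn H.hm H.hL H.hconv H.hsmooth H.hqsc e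
  set G := gradient (objective A.F) x
  have h4 : inner ℝ (x - e - xs) G = -inner ℝ G (xs - x) - inner ℝ e G := by
    rw [show x - e - xs = -(xs - x) - e by abel, inner_sub_left, inner_neg_left,
      real_inner_comm G (xs - x)]
  have h5 : 2 * inner ℝ e G ≤ 2 * L * ‖e‖ ^ 2 + (objective A.F x - objective A.F xs) := by
    have e1 := real_inner_le_norm e G
    have e2 := sq_nonneg (2 * L * ‖e‖ - ‖G‖)
    have hL := H.hL
    refine le_of_mul_le_mul_left ?_ (show 0 < 2 * L by linarith)
    nlinarith
  have h6 : ‖x - e - xs‖ ^ 2 ≤ 2 * ‖x - xs‖ ^ 2 + 2 * ‖e‖ ^ 2 := by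
    have := norm_sub_add_sq_le (x - xs) e 0
    rwa [add_zero, sub_zero, sub_right_comm] at this
  have h7 := mul_le_mul_of_nonneg_left h6 (mul_nonneg H.hγ.le H.hμ)
  have h8 := mul_le_mul_of_nonneg_left h5 H.hγ.le
  have h9 := mul_le_mul_of_nonneg_left h1 H.hγ.le
  have h10 := mul_le_mul_of_nonneg_left h3 H.hγ.le
  rw [h4]
  linarith

variable [IsProbabilityMeasure P]

lemma integral_le_of_condExp_le {k : ℕ} {f g : Ω → ℝ}
    (h : P[f | history ζ k] ≤ᵐ[P] g) (hg : Integrable g P) : ∫ o, f o ∂P ≤ ∫ o, g o ∂P := by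
  rw [← integral_condExp (H.history_le k)]
  exact integral_mono_ae integrable_condExp hg h

variable [IsProbabilityMeasure ν]

/-- Each `g^t` in the window is its conditional mean `∇f(x^t)` plus noise. The means are summed by
Cauchy-Schwarz, at the price of a factor `τ`; the noises are martingale differences, so their second
moments simply add. -/
lemma integral_norm_eProc_sq_le (k : ℕ) :
    ∫ o, ‖A.eProc ζ k o‖ ^ 2 ∂P ≤ A.γ ^ 2 * ∑ t ∈ Finset.Ico (k - A.τ) k,
      (4 * L * A.τ * (∫ o, (objective A.F (A.xProc ζ t o) - objective A.F xs) ∂P)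
        + 2 * ∫ o, ‖A.gProc ζ t o‖ ^ 2 ∂P) := by
  set J := Finset.Ico (k - A.τ) k with hJ
  have hcard : (J.card : ℝ) ≤ A.τ := by
    rw [hJ, Nat.card_Ico]
    exact_mod_cast (by omega : k - (k - A.τ) ≤ A.τ)
  let G : ℕ → Ω → Vec d := fun t o => gradient (objective A.F) (A.xProc ζ t o)
  let X : ℕ → Ω → Vec d := fun t o => A.gProc ζ t o - G t o
  have hG : ∀ t, MemLp (G t) 2 P := H.memLp_gradient
  have hX : ∀ t, MemLp (X t) 2 P := fun t => (H.memLp_gProc t).sub (hG t)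
  have hGm : ∀ t, Measurable[history ζ t] (G t) := fun t =>
    (continuous_gradient_objective H.hL H.hsmooth).measurable.comp (H.measurable_xProc t)
  have hXm : ∀ t, Measurable[history ζ (t + 1)] (X t) := fun t =>
    (H.measurable_gProc t).sub ((hGm t).mono (history_mono ζ t.le_succ) le_rfl)
  have hzero : ∀ (t : ℕ) (Y : Ω → Vec d), Measurable[history ζ t] Y → MemLp Y 2 P →
      ∫ o, inner ℝ (Y o) (X t o) ∂P = 0 := by
    intro t Y hY hY2
    simp only [X, inner_sub_right]
    rw [integral_sub (integrable_inner hY2 (H.memLp_gProc t)) (integrable_inner hY2 (hG t)),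
      H.integral_inner_gProc hY hY2, sub_self]
  have horth : ∀ s ∈ J, ∀ t ∈ J, s ≠ t → ∫ o, inner ℝ (X s o) (X t o) ∂P = 0 := by
    intro s _ t _ hst
    rcases lt_or_gt_of_ne hst with h | h
    · exact hzero t (X s) ((hXm s).mono (history_mono ζ h) le_rfl) (hX s)
    · exact (integral_congr_ae (Filter.Eventually.of_forall fun o => real_inner_comm _ _)).trans
        (hzero s (X t) ((hXm t).mono (history_mono ζ h) le_rfl) (hX t))
  -- Noise and conditional mean are orthogonal, so subtracting the mean does not increase the second
  -- moment.
  have hXle : ∀ t, ∫ o, ‖X t o‖ ^ 2 ∂P ≤ ∫ o, ‖A.gProc ζ t o‖ ^ 2 ∂P := by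
    intro t
    have h0 := hzero t (G t) (hGm t) (hG t)
    have h1 : ∀ o, ‖X t o‖ ^ 2
        = ‖A.gProc ζ t o‖ ^ 2 - 2 * inner ℝ (G t o) (X t o) - ‖G t o‖ ^ 2 := by
      intro o
      have : A.gProc ζ t o = G t o + X t o := by simp [X]
      rw [this, norm_add_sq_real]
      ring
    have i1 := integrable_norm_sq (H.memLp_gProc t)
    have i2 := (integrable_inner (hG t) (hX t)).const_mul 2
    have i12 : Integrable (fun o => ‖A.gProc ζ t o‖ ^ 2 - 2 * inner ℝ (G t o) (X t o)) P :=
      i1.sub i2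
    simp only [h1]
    rw [integral_sub i12 (integrable_norm_sq (hG t)), integral_sub i1 i2, integral_const_mul, h0]
    have : 0 ≤ ∫ o, ‖G t o‖ ^ 2 ∂P := integral_nonneg fun o => sq_nonneg _
    linarith
  have hGle : ∀ t, ∫ o, ‖G t o‖ ^ 2 ∂P ≤
      2 * L * ∫ o, (objective A.F (A.xProc ζ t o) - objective A.F xs) ∂P := by
    intro t
    rw [← integral_const_mul]
    exact integral_mono (integrable_norm_sq (hG t)) ((H.integrable_gap t).const_mul _) fun o =>
      norm_gradient_objective_sq_le H.hn H.hm H.hL H.hconv H.hsmooth H.hqsc _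
  have hpt : ∀ o, ‖A.eProc ζ k o‖ ^ 2 ≤ A.γ ^ 2 * (2 * (A.τ * ∑ t ∈ J, ‖G t o‖ ^ 2)
      + 2 * ‖∑ t ∈ J, X t o‖ ^ 2) := by
    intro o
    have h1 : ∑ t ∈ J, A.gProc ζ t o = ∑ t ∈ J, G t o - 0 + ∑ t ∈ J, X t o := by
      rw [sub_zero, ← Finset.sum_add_distrib]
      exact Finset.sum_congr rfl fun t _ => by simp [X]
    have h2 := norm_sub_add_sq_le (∑ t ∈ J, G t o) 0 (∑ t ∈ J, X t o)
    rw [zero_sub, norm_neg] at h2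
    have h3 := norm_sum_sq_le J fun t => G t o
    have h4 : (J.card : ℝ) * ∑ t ∈ J, ‖G t o‖ ^ 2 ≤ A.τ * ∑ t ∈ J, ‖G t o‖ ^ 2 := by gcongr
    rw [A.eProc_eq, norm_smul, mul_pow, Real.norm_eq_abs, sq_abs, h1]
    gcongr
    linarith
  have iG : Integrable (fun o => 2 * (A.τ * ∑ t ∈ J, ‖G t o‖ ^ 2)) P :=
    ((integrable_finsetSum _ fun t _ => integrable_norm_sq (hG t)).const_mul _).const_mul _
  have iX : Integrable (fun o => 2 * ‖∑ t ∈ J, X t o‖ ^ 2) P :=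
    (integrable_norm_sq (memLp_finsetSum _ fun t _ => hX t)).const_mul _
  calc ∫ o, ‖A.eProc ζ k o‖ ^ 2 ∂P
      ≤ ∫ o, A.γ ^ 2 * (2 * (A.τ * ∑ t ∈ J, ‖G t o‖ ^ 2) + 2 * ‖∑ t ∈ J, X t o‖ ^ 2) ∂P :=
        integral_mono (integrable_norm_sq (H.memLp_e k)) ((iG.add iX).const_mul _) hpt
    _ = A.γ ^ 2 * (2 * (A.τ * ∑ t ∈ J, ∫ o, ‖G t o‖ ^ 2 ∂P)
          + 2 * ∑ t ∈ J, ∫ o, ‖X t o‖ ^ 2 ∂P) := by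
        rw [integral_const_mul, integral_add iG iX, integral_const_mul, integral_const_mul,
          integral_const_mul, integral_finsetSum _ fun t _ => integrable_norm_sq (hG t),
          integral_norm_sum_sq J (fun t _ => hX t) horth]
    _ ≤ A.γ ^ 2 * (2 * (A.τ * ∑ t ∈ J,
          2 * L * ∫ o, (objective A.F (A.xProc ζ t o) - objective A.F xs) ∂P)
          + 2 * ∑ t ∈ J, ∫ o, ‖A.gProc ζ t o‖ ^ 2 ∂P) := by
        have a1 := Finset.sum_le_sum fun t (_ : t ∈ J) => hGle t
        have a2 := Finset.sum_le_sum fun t (_ : t ∈ J) => hXle t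
        have a3 := mul_le_mul_of_nonneg_left a1 (Nat.cast_nonneg (α := ℝ) A.τ)
        refine mul_le_mul_of_nonneg_left ?_ (sq_nonneg _)
        linarith
    _ = _ := by
        rw [Finset.sum_add_distrib, ← Finset.mul_sum, ← Finset.mul_sum, ← Finset.mul_sum]
        ring

lemma integral_norm_xTilde_sq_succ_le (k : ℕ) :
    ∫ o, ‖A.xProc ζ (k + 1) o - A.eProc ζ (k + 1) o - xs‖ ^ 2 ∂P ≤
      (1 - A.γ * μ / 2) * ∫ o, ‖A.xProc ζ k o - A.eProc ζ k o - xs‖ ^ 2 ∂P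
      + (3 * L * A.γ * (∫ o, ‖A.eProc ζ k o‖ ^ 2 ∂P) + A.γ ^ 2 * (∫ o, ‖A.gProc ζ k o‖ ^ 2 ∂P)
        - A.γ * ∫ o, (objective A.F (A.xProc ζ k o) - objective A.F xs) ∂P) := by
  let Y : Ω → Vec d := fun o => A.xProc ζ k o - A.eProc ζ k o - xs
  have hY : MemLp Y 2 P := ((H.memLp_x k).sub (H.memLp_e k)).sub (memLp_const xs)
  have hYm : Measurable[history ζ k] Y :=
    ((H.measurable_xProc k).sub (H.measurable_eProc k)).sub_const xs
  have h0 := H.integral_inner_gProc hYm hY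
  have iY := integrable_norm_sq hY
  have iYg := (integrable_inner hY (H.memLp_gProc k)).const_mul (2 * A.γ)
  have iYG := (integrable_inner hY (H.memLp_gradient k)).const_mul (2 * A.γ)
  have ig := (integrable_norm_sq (H.memLp_gProc k)).const_mul (A.γ ^ 2)
  have ie := (integrable_norm_sq (H.memLp_e k)).const_mul (3 * L * A.γ)
  have ir := (H.integrable_gap k).const_mul A.γ
  have h1 : ∀ o, ‖A.xProc ζ (k + 1) o - A.eProc ζ (k + 1) o - xs‖ ^ 2
      = ‖Y o‖ ^ 2 - 2 * A.γ * inner ℝ (Y o) (A.gProc ζ k o) + A.γ ^ 2 * ‖A.gProc ζ k o‖ ^ 2 := by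
    intro o
    rw [A.xTilde_succ, show A.xProc ζ k o - A.eProc ζ k o - A.γ • A.gProc ζ k o - xs
      = Y o - A.γ • A.gProc ζ k o by simp only [Y]; abel, norm_sub_sq_real, inner_smul_right,
      norm_smul, mul_pow, Real.norm_eq_abs, sq_abs]
    ring
  have i1 : Integrable (fun o => ‖Y o‖ ^ 2 - 2 * A.γ * inner ℝ (Y o) (A.gProc ζ k o)) P :=
    iY.sub iYg
  have h2 : ∫ o, (‖Y o‖ ^ 2 - 2 * A.γ * inner ℝ (Y o) (gradient (objective A.F) (A.xProc ζ k o))) ∂P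
      ≤ ∫ o, ((1 - A.γ * μ / 2) * ‖Y o‖ ^ 2 + (3 * L * A.γ * ‖A.eProc ζ k o‖ ^ 2
        - A.γ * (objective A.F (A.xProc ζ k o) - objective A.F xs))) ∂P :=
    integral_mono (iY.sub iYG) ((iY.const_mul _).add (ie.sub ir)) fun o =>
      H.descent_pointwise (A.xProc ζ k o) (A.eProc ζ k o)
  have ier : Integrable (fun o => 3 * L * A.γ * ‖A.eProc ζ k o‖ ^ 2
      - A.γ * (objective A.F (A.xProc ζ k o) - objective A.F xs)) P := ie.sub ir
  rw [integral_sub iY iYG, integral_add (iY.const_mul _) ier, integral_sub ie ir,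
    integral_const_mul, integral_const_mul, integral_const_mul, integral_const_mul] at h2
  simp only [h1]
  rw [integral_add i1 ig, integral_sub iY iYg, integral_const_mul, integral_const_mul, h0]
  change _ ≤ (1 - A.γ * μ / 2) * ∫ o, ‖Y o‖ ^ 2 ∂P + _
  linarith

lemma momentBounds : MomentBounds L μ A.γ A.α p (ω / n) A.τ
    (fun k => ∫ o, (objective A.F (A.xProc ζ k o) - objective A.F xs) ∂P)
    (fun k => ∫ o, A.sigma1Proc ζ xs k o ∂P) (fun k => ∫ o, A.sigma2Proc ζ xs k o ∂P)
    (fun k => ∫ o, ‖A.eProc ζ k o‖ ^ 2 ∂P)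
    (fun k => ∫ o, ‖A.xProc ζ k o - A.eProc ζ k o - xs‖ ^ 2 ∂P)
    (fun k => ∫ o, ‖A.gProc ζ k o‖ ^ 2 ∂P) where
  r_nonneg k := integral_nonneg fun o => H.gap_nonneg _
  s₁_nonneg k := integral_nonneg fun o => sigma1Sq_nonneg _ _ _
  s₂_nonneg k := integral_nonneg fun o => sigma2Sq_nonneg _ _ _
  D_nonneg k := integral_nonneg fun o => sq_nonneg _
  q_nonneg k := integral_nonneg fun o => sq_nonneg _
  q_le k := by
    obtain ⟨-, i1, i2⟩ := H.integrable_processes k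
    have i0 := H.integrable_gap k
    have h := (H.step_bounds i0 i1 i2).1.2
    have j1 := i0.const_mul (4 * L * (1 + 2 * (ω / n)))
    have j2 := i1.const_mul (2 * (ω / n))
    have j3 := i2.const_mul (2 * (1 + 2 * (ω / n)))
    have j12 := j1.add j2
    simp only [Pi.add_def] at j12
    have := H.integral_le_of_condExp_le h (j12.add j3)
    rwa [integral_add j12 j3, integral_add j1 j2, integral_const_mul, integral_const_mul,
      integral_const_mul] at this
  s₁_rec k := by
    obtain ⟨-, i1, i2⟩ := H.integrable_processes k
    have i0 := H.integrable_gap k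
    have h := (H.step_bounds i0 i1 i2).2.1.2
    have j1 := i1.const_mul (1 - A.α)
    have j2 := i0.const_mul (4 * L * A.α)
    have j3 := i2.const_mul (2 * A.α)
    have j23 := j2.add j3
    simp only [Pi.add_def] at j23
    have := H.integral_le_of_condExp_le h (j1.add j23)
    rwa [integral_add j1 j23, integral_add j2 j3, integral_const_mul, integral_const_mul,
      integral_const_mul] at this
  s₂_rec k := by
    obtain ⟨-, i1, i2⟩ := H.integrable_processes k
    have i0 := H.integrable_gap k
    have h := (H.step_bounds i0 i1 i2).2.2.2
    have j1 := i2.const_mul (1 - p)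
    have j2 := i0.const_mul (2 * L * p)
    have := H.integral_le_of_condExp_le h (j1.add j2)
    rwa [integral_add j1 j2, integral_const_mul, integral_const_mul] at this
  E_le k := H.integral_norm_eProc_sq_le k
  D_rec k := H.integral_norm_xTilde_sq_succ_le k

end StandingAssumptions

end Moments

/-! ### From sums of gaps to a rate for the weighted average. -/

section Rates

lemma mul_weightSum {η : ℝ} (hη : η < 1) (K : ℕ) : η * weightSum η K = weight η K - 1 := by
  have h0 : (1 - η) ≠ 0 := by linarith
  induction K with
  | zero =>
    simp only [weightSum, weight, zero_add, Finset.sum_range_one, pow_one]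
    field_simp
    ring
  | succ K ih =>
    have h1 : weightSum η (K + 1) = weightSum η K + weight η (K + 1) :=
      Finset.sum_range_succ _ _
    have h2 : (1 - η) * weight η (K + 1) = weight η K := one_sub_mul_weight hη (K + 1)
    rw [h1, mul_add, ih]
    linarith

lemma weightSum_pos {η : ℝ} (hη : η < 1) (K : ℕ) : 0 < weightSum η K :=
  Finset.sum_pos (fun k _ => weight_pos hη k) ⟨0, Finset.mem_range.2 K.succ_pos⟩

/-- Combination of an unweighted bound, effective for few iterations, with a weighted bound, effective
for many iterations. -/
lemma weighted_average_le {η Φ : ℝ} (hη0 : 0 < η) (hη : η ≤ 1 / 15) {r : ℕ → ℝ}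
    (hr : ∀ k, 0 ≤ r k) (K : ℕ) (h₁ : ∑ k ∈ Finset.range (K + 1), r k ≤ Φ)
    (h₂ : ∑ k ∈ Finset.range (K + 1), weight η k * r k ≤ 25 / 2 * Φ) :
    1 / weightSum η K * ∑ k ∈ Finset.range (K + 1), weight η k * r k ≤ (1 - η) ^ K * Φ := by
  have hη1 : η < 1 := by linarith
  have hΦ : 0 ≤ Φ := (Finset.sum_nonneg fun k _ => hr k).trans h₁
  have hW := weightSum_pos hη1 K
  have hηW := mul_weightSum hη1 K
  have hs0 : 0 < (1 - η) ^ K := pow_pos (by linarith) K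
  have hs1 : (1 - η) ^ K ≤ 1 := pow_le_one₀ (by linarith) (by linarith)
  have hw : weight η K * ((1 - η) ^ K * (1 - η)) = 1 := by
    rw [weight, ← pow_succ]
    exact inv_mul_cancel₀ (pow_pos (by linarith) _).ne'
  set s := (1 - η) ^ K
  set W := weightSum η K
  set w := weight η K with hwdef
  have hw0 : 0 < w := weight_pos hη1 K
  rw [one_div_mul_eq_div, div_le_iff₀ hW]
  -- For `s ≥ 2η` each weight is bounded by the last one, and `w ≤ s * W` reduces to `(1 - s)((1 -
  -- η)s - η) ≥ 0`. For `s < 2η` one has `η s W ≥ 1 - 2η`, which is at least `25/2 · η` since `η ≤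
  -- 1/15`.
  rcases le_or_gt (2 * η) s with hs | hs
  · have h3 : ∑ k ∈ Finset.range (K + 1), weight η k * r k ≤ w * Φ := by
      calc _ ≤ ∑ k ∈ Finset.range (K + 1), w * r k := by
            refine Finset.sum_le_sum fun k hk => mul_le_mul_of_nonneg_right ?_ (hr k)
            refine inv_anti₀ (pow_pos (by linarith) _) ?_
            exact pow_le_pow_of_le_one (by linarith) (by linarith)
              (by rw [Finset.mem_range] at hk; omega)
        _ = w * ∑ k ∈ Finset.range (K + 1), r k := by rw [Finset.mul_sum]
        _ ≤ w * Φ := by gcongr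
    have h4 : 0 ≤ (1 - s) * ((1 - η) * s - η) :=
      mul_nonneg (by linarith) (by nlinarith)
    have h5 : η * w ≤ η * (s * W) := by
      have e1 : 0 ≤ w * ((1 - s) * ((1 - η) * s - η)) := mul_nonneg hw0.le h4
      have e2 : w * ((1 - s) * ((1 - η) * s - η))
          = (w * (s * (1 - η))) * (1 - s) - η * w + η * w * s := by ring
      have e3 : η * (s * W) = s * (w - 1) := by rw [← hηW]; ring
      rw [e2, hw] at e1
      have e4 : s * w = w * (s * (1 - η)) + η * w * s := by ring
      rw [e3, mul_sub, e4, hw]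
      linarith
    have h6 : w ≤ s * W := le_of_mul_le_mul_left h5 hη0
    calc _ ≤ w * Φ := h3
      _ ≤ s * W * Φ := by gcongr
      _ = _ := by ring
  · have h5 : η * (25 / 2) ≤ η * (s * W) := by
      have e3 : η * (s * W) = s * (w - 1) := by rw [← hηW]; ring
      have e4 : s * w = w * (s * (1 - η)) + η * w * s := by ring
      have e5 : 0 ≤ η * w * s := by positivity
      rw [e3, mul_sub, e4, hw]
      linarith
    have h6 : 25 / 2 ≤ s * W := le_of_mul_le_mul_left h5 hη0
    calc _ ≤ 25 / 2 * Φ := h₂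
      _ ≤ s * W * Φ := by gcongr
      _ = _ := by ring

end Rates

/-! ### Consequences of the stepsize bound and of the constants `F₁`, `F₂`. -/

section Stepsize

variable {L ω α p γ : ℝ} {n τ : ℕ}

/-- Both `1/(1 - α)` and `1/(1 - p)` are at least one, so the bracket under the root is at least `τ
+ (2 + 4) + 4(1 + 3 + 2 + 4) ω/n`. -/
lemma stepBound_consequences (hn : 1 ≤ n) (hL : 0 < L) (hω : 0 < ω) (hα : 0 < α)
    (hα1 : α < 1) (hp : 0 < p) (hp1 : p < 1) (hγ : 0 < γ) (h : γ ≤ stepBound L ω α p n τ) :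
    8 * (γ * L) * (37 / 9 + 8 * (ω / n)) ≤ 1 ∧
      64 * (γ * L) ^ 2 * (τ * (τ + 6 + 40 * (ω / n))) ≤ 1 := by
  have hn' : (0 : ℝ) < n := by exact_mod_cast hn
  have ha : 0 ≤ ω / n := by positivity
  set X : ℝ := τ * (2 + τ + 4 / (1 - p) + 4 * ω / n *
      (1 + 3 / (1 - α) + 2 / (1 - p) + 4 / ((1 - α) * (1 - p)))) with hX
  have hM : 37 / 9 + 24 * ω / (3 * n) = 37 / 9 + 8 * (ω / n) := by field_simp; ring
  rw [stepBound, ← hX, hM] at h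
  have hmax : 0 < max (37 / 9 + 8 * (ω / n)) √X := lt_max_of_lt_left (by positivity)
  rw [le_div_iff₀ (by positivity)] at h
  have hγL : 0 < γ * L := by positivity
  refine ⟨?_, ?_⟩
  · have := mul_le_mul_of_nonneg_left (le_max_left (37 / 9 + 8 * (ω / n)) √X) hγL.le
    linarith
  · have h1 : (8 * (γ * L)) * √X ≤ 1 := by
      have := mul_le_mul_of_nonneg_left (le_max_right (37 / 9 + 8 * (ω / n)) √X) hγL.le
      linarith
    have h1p : 1 ≤ 1 / (1 - p) := by rw [le_div_iff₀ (by linarith)]; linarith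
    have h1a : 1 ≤ 1 / (1 - α) := by rw [le_div_iff₀ (by linarith)]; linarith
    have h1ap : 1 ≤ 1 / ((1 - α) * (1 - p)) := by
      rw [← one_div_mul_one_div]
      nlinarith
    have hle : τ * (τ + 6 + 40 * (ω / n)) ≤ X := by
      rw [hX]
      refine mul_le_mul_of_nonneg_left ?_ (Nat.cast_nonneg τ)
      have e1 : 40 * (ω / n) ≤ 4 * ω / n *
          (1 + 3 / (1 - α) + 2 / (1 - p) + 4 / ((1 - α) * (1 - p))) := by
        have : 4 * ω / n * 10 ≤ 4 * ω / n *
            (1 + 3 / (1 - α) + 2 / (1 - p) + 4 / ((1 - α) * (1 - p))) := by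
          refine mul_le_mul_of_nonneg_left ?_ (by positivity)
          rw [← mul_one_div 3, ← mul_one_div 2, ← mul_one_div 4]
          linarith
        have e : 4 * ω / n * 10 = 40 * (ω / n) := by ring
        linarith
      rw [← mul_one_div 4 (1 - p)]
      linarith
    have hX0 : 0 ≤ X := le_trans (by positivity) hle
    have h2 := mul_le_one₀ h1 (by positivity) h1
    have h3 : 8 * (γ * L) * √X * (8 * (γ * L) * √X) = 64 * (γ * L) ^ 2 * X := by
      calc _ = 64 * (γ * L) ^ 2 * (√X * √X) := by ring
        _ = _ := by rw [Real.mul_self_sqrt hX0]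
    rw [h3] at h2
    exact (mul_le_mul_of_nonneg_left hle (by positivity)).trans h2

lemma F₁_ge (hL : 0 < L) (hω : 0 < ω) (hα : 0 < α) {s : ℝ} (hs : 0 ≤ s) :
    24 * γ ^ 2 * L * τ * (ω / n) * (s / α) ≤ (constants L ω γ α p n τ).F₁ * s := by
  have h : (constants L ω γ α p n τ).F₁ * s
      = 12 * γ ^ 2 * L * τ * (ω / n) * (s / α) * (2 + α) := by
    simp only [constants]
    rcases eq_or_ne (n : ℝ) 0 with hn | hn
    · simp [hn]
    · field_simp
  rw [h]
  have : 0 ≤ 12 * γ ^ 2 * L * τ * (ω / n) * (s / α) := by positivity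
  nlinarith

lemma F₂_ge (hL : 0 < L) (hω : 0 < ω) (hα : 0 < α) (hα1 : α < 1) (hp : 0 < p) {s : ℝ}
    (hs : 0 ≤ s) :
    24 * γ ^ 2 * L * τ * (1 + 6 * (ω / n)) * (s / p) ≤ (constants L ω γ α p n τ).F₂ * s := by
  have h : (constants L ω γ α p n τ).F₂ * s
      = 12 * γ ^ 2 * L * τ * (s / p) * ((2 + p) * (4 * (ω / n) * (1 / (1 - α)) + 1 + 2 * (ω / n))) := by
    have : (4 * ω / (n * (1 - α)) + 1 + 2 * ω / n)
        = 4 * (ω / n) * (1 / (1 - α)) + 1 + 2 * (ω / n) := by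
      rw [mul_div_assoc 2, mul_assoc 4, div_mul_div_comm, mul_one, mul_div_assoc]
    simp only [constants, this]
    field_simp
  rw [h]
  have h1a : 1 ≤ 1 / (1 - α) := by rw [le_div_iff₀ (by linarith)]; linarith
  have ha : 0 ≤ ω / n := by positivity
  have h1 : 2 * (1 + 6 * (ω / n)) ≤ (2 + p) * (4 * (ω / n) * (1 / (1 - α)) + 1 + 2 * (ω / n)) := by
    have e1 : 1 + 6 * (ω / n) ≤ 4 * (ω / n) * (1 / (1 - α)) + 1 + 2 * (ω / n) := by nlinarith
    exact mul_le_mul (by linarith) e1 (by positivity) (by linarith)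
  have h2 : 0 ≤ 12 * γ ^ 2 * L * τ * (s / p) := by positivity
  have h3 := mul_le_mul_of_nonneg_left h1 h2
  linarith

end Stepsize

/-! ### The parametric assumption and the convergence rates. -/

section Convergence

variable {d n m : ℕ} {Ξ Ω : Type*} [mΩ : MeasurableSpace Ω] {P : Measure Ω}

lemma Input.integral_initial [IsProbabilityMeasure P] (A : Input d n m Ξ)
    (ζ : ℕ → Fin n → Ω → Fin m × Ξ × Bool) (xs : Vec d) :
    ∫ o, A.sigma1Proc ζ xs 0 o ∂P = sigma1Sq A.F xs A.h₀ ∧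
    ∫ o, A.sigma2Proc ζ xs 0 o ∂P = sigma2Sq A.F xs A.w₀ ∧
    ∫ o, ‖A.xProc ζ 0 o - A.eProc ζ 0 o - xs‖ ^ 2 ∂P = ‖A.x₀ - xs‖ ^ 2 := by
  refine ⟨?_, ?_, ?_⟩
  · change ∫ _, sigma1Sq A.F xs A.h₀ ∂P = _
    simp
  · change ∫ _, sigma2Sq A.F xs A.w₀ ∂P = _
    simp
  · simp [A.xTilde_eq]

variable [MeasurableSpace Ξ] {ν : Measure Ξ} {A : Input d n m Ξ}
  {ζ : ℕ → Fin n → Ω → Fin m × Ξ × Bool} {xs : Vec d} {L μ ω p : ℝ}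

namespace StandingAssumptions

variable (H : StandingAssumptions P ν A ζ xs L μ ω p)
include H

lemma α_lt_one : A.α < 1 := by
  have hω := H.hQ.omega_pos
  refine H.hαω.trans_lt ?_
  rw [div_lt_one (by linarith)]
  linarith

/-- If `d = 0` nothing bounds `μ` by `L`, but then every gap and every error is zero. The weighted
estimates need `μ ≤ L`, so the two cases are treated apart. -/
lemma modulus_le_or_subsingleton : μ ≤ L ∨ Subsingleton (Vec d) := by
  rcases subsingleton_or_nontrivial (Vec d) with h | h
  · exact Or.inr h
  · obtain ⟨v, hv⟩ := exists_ne (0 : Vec d)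
    have h1 := modulus_mul_norm_sq_le H.hn H.hm H.hL H.hconv H.hsmooth H.hqsc v
    exact Or.inl (le_of_mul_le_mul_right h1 (by positivity))

lemma eta_nonneg : 0 ≤ eta A.γ μ A.α p := by
  have h1 := H.hγ
  have h2 := H.hα
  have h3 := H.hp
  have h4 := H.hμ
  exact le_min (by positivity) (le_min (by positivity) (by positivity))

lemma eta_lt_one : eta A.γ μ A.α p < 1 := by
  have h1 : eta A.γ μ A.α p ≤ p / 4 := (min_le_right _ _).trans (min_le_right _ _)
  have h2 := H.hp1
  linarith

lemma initialGap_nonneg : 0 ≤ A.initialGap xs L ω p := by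
  have hγ := H.hγ
  have hα := H.hα
  have hp := H.hp
  have hL := H.hL
  have hω := H.hQ.omega_pos
  have hα1 : 0 < 1 - A.α := sub_pos.2 H.α_lt_one
  have h1 := sigma1Sq_nonneg A.F xs A.h₀
  have h2 := sigma2Sq_nonneg A.F xs A.w₀
  have h3 : 0 ≤ A.lyapunov xs (M₁ ω A.α n) (M₂ ω p n) A.init := by
    change 0 ≤ _ + _ * _ * sigma1Sq A.F xs A.h₀ + _ * _ * sigma2Sq A.F xs A.w₀
    unfold M₁ M₂
    positivity
  unfold Input.initialGap constants
  positivity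

/-- The initial gap dominates the initial terms of the moment bounds. -/
lemma le_mul_initialGap :
    4 * (‖A.x₀ - xs‖ ^ 2
      + A.γ ^ 2 * (8 / 3 * (ω / n) + 24 * (A.γ * L * A.τ) * (ω / n)) * (sigma1Sq A.F xs A.h₀ / A.α)
      + A.γ ^ 2 * ((56 + 48 * (ω / n)) / 9 + 24 * (A.γ * L * A.τ) * (1 + 6 * (ω / n)))
        * (sigma2Sq A.F xs A.w₀ / p)) ≤ A.γ * A.initialGap xs L ω p := by
  have hγ := H.hγ
  have hn' : (n : ℝ) ≠ 0 := by have := H.hn; positivity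
  have hα := H.hα
  have hp := H.hp
  have h1 := mul_le_mul_of_nonneg_left (F₁_ge (γ := A.γ) (p := p) (n := n) (τ := A.τ) H.hL
    H.hQ.omega_pos H.hα (sigma1Sq_nonneg A.F xs A.h₀)) hγ.le
  have h2 := mul_le_mul_of_nonneg_left (F₂_ge (γ := A.γ) (n := n) (τ := A.τ) H.hL
    H.hQ.omega_pos H.hα H.α_lt_one H.hp (sigma2Sq_nonneg A.F xs A.w₀)) hγ.le
  have h3 : A.lyapunov xs (M₁ ω A.α n) (M₂ ω p n) A.init = ‖A.x₀ - xs‖ ^ 2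
      + A.γ ^ 2 * (8 / 3 * (ω / n)) * (sigma1Sq A.F xs A.h₀ / A.α)
      + A.γ ^ 2 * ((56 + 48 * (ω / n)) / 9) * (sigma2Sq A.F xs A.w₀ / p) := by
    have e1 : A.init.xTilde = A.x₀ := by simp [State.xTilde, Input.init, avg]
    rw [Input.lyapunov, e1]
    change _ + _ * _ * sigma1Sq A.F xs A.h₀ + _ * _ * sigma2Sq A.F xs A.w₀ = _
    unfold M₁ M₂
    congr 1
    · congr 1
      field_simp
    · field_simp
      ring
  rw [Input.initialGap, mul_div_cancel₀ _ hγ.ne', h3]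
  linarith

lemma objective_xBar_sub_le (K : ℕ) (o : Ω) :
    objective A.F (xBar (eta A.γ μ A.α p) (A.xProc ζ) K o) - objective A.F xs ≤
      1 / weightSum (eta A.γ μ A.α p) K * ∑ k ∈ Finset.range (K + 1),
        weight (eta A.γ μ A.α p) k * (objective A.F (A.xProc ζ k o) - objective A.F xs) := by
  set η := eta A.γ μ A.α p
  have hW := weightSum_pos H.eta_lt_one K
  have hsum : ∑ k ∈ Finset.range (K + 1), 1 / weightSum η K * weight η k = 1 := by
    rw [← Finset.mul_sum]
    exact one_div_mul_cancel hW.ne'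
  have h := (convexOn_objective H.hconv).map_sum_le (t := Finset.range (K + 1))
    (w := fun k => 1 / weightSum η K * weight η k) (p := fun k => A.xProc ζ k o)
    (fun k _ => mul_nonneg (one_div_pos.2 hW).le (weight_pos H.eta_lt_one k).le) hsum
    (fun k _ => Set.mem_univ _)
  have h1 : xBar η (A.xProc ζ) K o
      = ∑ k ∈ Finset.range (K + 1), (1 / weightSum η K * weight η k) • A.xProc ζ k o := by
    simp only [xBar, Finset.smul_sum, smul_smul]
  have h2 : 1 / weightSum η K * ∑ k ∈ Finset.range (K + 1),
      weight η k * (objective A.F (A.xProc ζ k o) - objective A.F xs)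
      = ∑ k ∈ Finset.range (K + 1), (1 / weightSum η K * weight η k) • objective A.F (A.xProc ζ k o)
        - (∑ k ∈ Finset.range (K + 1), 1 / weightSum η K * weight η k) * objective A.F xs := by
    rw [Finset.mul_sum, Finset.sum_mul, ← Finset.sum_sub_distrib]
    exact Finset.sum_congr rfl fun k _ => by rw [smul_eq_mul]; ring
  rw [h2, hsum, h1]
  linarith

variable [IsProbabilityMeasure P] [IsProbabilityMeasure ν]

lemma integrable_gap_xBar (K : ℕ) : Integrable
    (fun o => objective A.F (xBar (eta A.γ μ A.α p) (A.xProc ζ) K o) - objective A.F xs) P := by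
  have h1 : MemLp (fun o => ∑ k ∈ Finset.range (K + 1),
      weight (eta A.γ μ A.α p) k • A.xProc ζ k o) 2 P :=
    memLp_finsetSum _ fun k _ => (H.memLp_x k).const_smul (weight (eta A.γ μ A.α p) k)
  exact H.integrable_gap_of_memLp (h1.const_smul (1 / weightSum (eta A.γ μ A.α p) K))

lemma integral_gap_xBar_le (K : ℕ) :
    ∫ o, (objective A.F (xBar (eta A.γ μ A.α p) (A.xProc ζ) K o) - objective A.F xs) ∂P ≤
      1 / weightSum (eta A.γ μ A.α p) K * ∑ k ∈ Finset.range (K + 1),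
        weight (eta A.γ μ A.α p) k *
          ∫ o, (objective A.F (A.xProc ζ k o) - objective A.F xs) ∂P := by
  have hi := fun k => (H.integrable_gap k).const_mul (weight (eta A.γ μ A.α p) k)
  calc _ ≤ ∫ o, 1 / weightSum (eta A.γ μ A.α p) K * ∑ k ∈ Finset.range (K + 1),
        weight (eta A.γ μ A.α p) k * (objective A.F (A.xProc ζ k o) - objective A.F xs) ∂P :=
        integral_mono (H.integrable_gap_xBar K)
          ((integrable_finsetSum _ fun k _ => hi k).const_mul _) (H.objective_xBar_sub_le K)
    _ = _ := by
        rw [integral_const_mul, integral_finsetSum _ fun k _ => hi k]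
        simp only [integral_const_mul]

variable (hγle : A.γ ≤ stepBound L ω A.α p n A.τ)
include hγle

lemma sum_gap_le_initialGap (N : ℕ) :
    ∑ k ∈ Finset.range N, ∫ o, (objective A.F (A.xProc ζ k o) - objective A.F xs) ∂P ≤
      A.initialGap xs L ω p := by
  obtain ⟨hγ₁, hγ₂⟩ := stepBound_consequences H.hn H.hL H.hQ.omega_pos H.hα H.α_lt_one H.hp H.hp1
    H.hγ hγle
  have ha : 0 ≤ ω / n := by have := H.hQ.omega_pos; positivity
  have h := H.momentBounds.sum_gap_le H.hL H.hμ H.hγ H.hα H.hp ha hγ₁ hγ₂ N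
  simp only [(A.integral_initial ζ xs).1, (A.integral_initial ζ xs).2.1, (A.integral_initial ζ xs).2.2] at h
  exact le_of_mul_le_mul_left (h.trans H.le_mul_initialGap) H.hγ

lemma weighted_bounds (hμL : μ ≤ L) (N : ℕ) :
    (3 * L * ∑ k ∈ Finset.range N, weight (eta A.γ μ A.α p) k * ∫ o, ‖A.eProc ζ k o‖ ^ 2 ∂P ≤
      1 / 4 * ∑ k ∈ Finset.range N, weight (eta A.γ μ A.α p) k *
        ∫ o, (objective A.F (A.xProc ζ k o) - objective A.F xs) ∂P
      + (constants L ω A.γ A.α p n A.τ).F₁ * sigma1Sq A.F xs A.h₀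
      + (constants L ω A.γ A.α p n A.τ).F₂ * sigma2Sq A.F xs A.w₀) ∧
    ∑ k ∈ Finset.range N, weight (eta A.γ μ A.α p) k *
        ∫ o, (objective A.F (A.xProc ζ k o) - objective A.F xs) ∂P ≤
      25 / 2 * A.initialGap xs L ω p := by
  obtain ⟨hγ₁, hγ₂⟩ := stepBound_consequences H.hn H.hL H.hQ.omega_pos H.hα H.α_lt_one H.hp H.hp1
    H.hγ hγle
  have hγ := H.hγ
  have hL := H.hL
  have hα := H.hα
  have hp := H.hp
  have ha : 0 ≤ ω / n := by have := H.hQ.omega_pos; positivity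
  have hθμ : eta A.γ μ A.α p ≤ A.γ * μ / 2 := min_le_left _ _
  have hθL : eta A.γ μ A.α p ≤ A.γ * L / 2 := hθμ.trans (by gcongr)
  have h := H.momentBounds.weighted_error_and_gap_le H.hL H.hγ H.hα H.hp ha hγ₁ hγ₂
    H.eta_nonneg hθμ hθL ((min_le_right _ _).trans (min_le_left _ _))
    ((min_le_right _ _).trans (min_le_right _ _)) N
  simp only [(A.integral_initial ζ xs).1, (A.integral_initial ζ xs).2.1, (A.integral_initial ζ xs).2.2] at h
  have h1 := F₁_ge (γ := A.γ) (p := p) (n := n) (τ := A.τ) H.hL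
    H.hQ.omega_pos H.hα (sigma1Sq_nonneg A.F xs A.h₀)
  have h2 := F₂_ge (γ := A.γ) (n := n) (τ := A.τ) H.hL
    H.hQ.omega_pos H.hα H.α_lt_one H.hp (sigma2Sq_nonneg A.F xs A.w₀)
  refine ⟨by linarith [h.1], le_of_mul_le_mul_left (h.2.trans ?_) H.hγ⟩
  have h3 := H.le_mul_initialGap
  have h4 : 0 ≤ A.γ ^ 2 * (24 * (A.γ * L * A.τ) * (ω / n)) * (sigma1Sq A.F xs A.h₀ / A.α) :=
    mul_nonneg (by positivity) (div_nonneg (sigma1Sq_nonneg _ _ _) H.hα.le)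
  have h5 : 0 ≤ A.γ ^ 2 * (24 * (A.γ * L * A.τ) * (1 + 6 * (ω / n)))
      * (sigma2Sq A.F xs A.w₀ / p) :=
    mul_nonneg (by positivity) (div_nonneg (sigma2Sq_nonneg _ _ _) H.hp.le)
  linarith

lemma parametricAssumption : ParametricAssumption P (history ζ) (objective A.F) xs L μ A.γ
    (A.xProc ζ) (A.gProc ζ) (A.eProc ζ) (A.sigma1Proc ζ xs) (A.sigma2Proc ζ xs)
    (constants L ω A.γ A.α p n A.τ) where
  nonneg := by
    have hα := H.hα
    have hp := H.hp
    have hL := H.hL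
    have hω := H.hQ.omega_pos
    have hα1 : 0 < 1 - A.α := sub_pos.2 H.α_lt_one
    simp only [constants]
    refine ⟨?_, ?_, ?_, ?_, ?_, ?_, ?_, ?_, le_rfl, le_rfl, le_rfl⟩ <;> positivity
  rho_mem := ⟨⟨H.hα.le, H.α_lt_one.le⟩, ⟨H.hp.le, H.hp1.le⟩⟩
  filtration := ⟨history_mono ζ, H.history_le⟩
  adapted k := ⟨(H.measurable_xProc k).stronglyMeasurable, (H.measurable_eProc k).stronglyMeasurable,
    ((measurable_sigma1Sq A.F xs).comp (H.measurable_run k).1).stronglyMeasurable,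
    ((measurable_sigma2Sq H.hL H.hsmooth xs).comp (H.measurable_run k).2.1).stronglyMeasurable⟩
  sigma_nonneg k o := ⟨sigma1Sq_nonneg _ _ _, sigma2Sq_nonneg _ _ _⟩
  integrable k := by
    refine ⟨(H.memLp_gProc k).integrable (by norm_num), integrable_norm_sq (H.memLp_gProc k),
      integrable_norm_sq (H.memLp_e k), ?_, (H.integrable_processes k).2.1,
      (H.integrable_processes k).2.2⟩
    exact ((H.integrable_gap k).add (integrable_const (objective A.F xs))).congr
      (Filter.Eventually.of_forall fun o => sub_add_cancel _ _)
  unbiased := H.condExp_gProc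
  unbiased_iterate := H.condExp_gProc_iterate
  second_moment k := by
    have h := (H.step_bounds (H.integrable_gap k) (H.integrable_processes k).2.1
      (H.integrable_processes k).2.2).1.2
    filter_upwards [h] with o ho
    refine ho.trans_eq ?_
    simp only [constants]
    ring
  sigma1_rec k := by
    have h := (H.step_bounds (H.integrable_gap k) (H.integrable_processes k).2.1
      (H.integrable_processes k).2.2).2.1.2
    filter_upwards [h] with o ho
    refine ho.trans ?_
    simp only [constants]
    have := mul_nonneg (mul_nonneg H.hL.le H.hα.le) (H.gap_nonneg (A.xProc ζ k o))
    linarith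
  sigma2_rec k := by
    have h := (H.step_bounds (H.integrable_gap k) (H.integrable_processes k).2.1
      (H.integrable_processes k).2.2).2.2.2
    filter_upwards [h] with o ho
    refine ho.trans_eq ?_
    simp only [constants]
    ring
  error_sum K := by
    rw [(A.integral_initial ζ xs).1, (A.integral_initial ζ xs).2.1]
    change _ ≤ _ + _ + _ + A.γ * 0 * _
    rw [mul_zero, zero_mul, add_zero]
    rcases H.modulus_le_or_subsingleton with hμL | hsub
    · exact (H.weighted_bounds hγle hμL (K + 1)).1
    · have h1 : ∀ v : Vec d, ‖v‖ = 0 := fun v => by rw [Subsingleton.elim v 0, norm_zero]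
      have h2 : ∀ v : Vec d, objective A.F v - objective A.F xs = 0 := fun v => by
        rw [Subsingleton.elim v xs, sub_self]
      simp only [h1, h2]
      have h3 := (F₁_ge (γ := A.γ) (p := p) (n := n) (τ := A.τ) H.hL H.hQ.omega_pos H.hα
        (sigma1Sq_nonneg A.F xs A.h₀))
      have h4 := (F₂_ge (γ := A.γ) (n := n) (τ := A.τ) H.hL H.hQ.omega_pos H.hα H.α_lt_one H.hp
        (sigma2Sq_nonneg A.F xs A.w₀))
      have h5 := sigma1Sq_nonneg A.F xs A.h₀
      have h6 := sigma2Sq_nonneg A.F xs A.w₀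
      have hα := H.hα
      have hp := H.hp
      have hL := H.hL
      have hω := H.hQ.omega_pos
      have h7 := le_trans (by positivity) h3
      have h8 := le_trans (by positivity) h4
      simpa using add_nonneg h7 h8

lemma linear_rate (hμ : 0 < μ) (K : ℕ) :
    ∫ o, (objective A.F (xBar (eta A.γ μ A.α p) (A.xProc ζ) K o) - objective A.F xs) ∂P ≤
      (1 - eta A.γ μ A.α p) ^ K * A.initialGap xs L ω p := by
  rcases H.modulus_le_or_subsingleton with hμL | hsub
  · obtain ⟨hγ₁, -⟩ := stepBound_consequences H.hn H.hL H.hQ.omega_pos H.hα H.α_lt_one H.hp H.hp1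
      H.hγ hγle
    have hγ := H.hγ
    have hL := H.hL
    have hα := H.hα
    have hp := H.hp
    have ha : 0 ≤ ω / n := by have := H.hQ.omega_pos; positivity
    have hη0 : 0 < eta A.γ μ A.α p :=
      lt_min (by positivity) (lt_min (by positivity) (by positivity))
    -- `η ≤ γL/2`, and the first stepsize condition gives `γL ≤ 9/296`.
    have hη : eta A.γ μ A.α p ≤ 1 / 15 := by
      have h1 : eta A.γ μ A.α p ≤ A.γ * μ / 2 := min_le_left _ _
      have h2 : A.γ * μ ≤ A.γ * L := by gcongr
      have h3 := mul_nonneg (mul_pos hγ hL).le ha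
      linarith [mul_pos hγ hL]
    exact (H.integral_gap_xBar_le K).trans (weighted_average_le hη0 hη H.momentBounds.r_nonneg K
      (H.sum_gap_le_initialGap hγle (K + 1)) (H.weighted_bounds hγle hμL (K + 1)).2)
  · have h2 : ∀ v : Vec d, objective A.F v - objective A.F xs = 0 := fun v => by
      rw [Subsingleton.elim v xs, sub_self]
    simp only [h2, integral_zero]
    exact mul_nonneg (pow_nonneg (by linarith [H.eta_lt_one]) _) H.initialGap_nonneg

lemma sublinear_rate (hμ : μ = 0) (K : ℕ) (hK : 1 ≤ K) :
    ∫ o, (objective A.F (xBar (eta A.γ μ A.α p) (A.xProc ζ) K o) - objective A.F xs) ∂P ≤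
      A.initialGap xs L ω p / K := by
  -- For `μ = 0` all weights are one and the average runs over `K + 1` iterates, so the unweighted
  -- bound gives slightly more than the claim.
  have hη : eta A.γ μ A.α p = 0 := by
    refine le_antisymm ?_ H.eta_nonneg
    exact (min_le_left _ _).trans (by rw [hμ]; simp)
  have h := H.integral_gap_xBar_le K
  have hw : ∀ k, weight 0 k = 1 := fun k => by simp [weight]
  have hW : weightSum 0 K = K + 1 := by simp [weightSum, hw]
  refine h.trans ?_
  simp only [hη, hW, hw, one_mul]
  have hK' : (0 : ℝ) < K := by exact_mod_cast hK
  rw [one_div_mul_eq_div]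
  have h1 := H.initialGap_nonneg
  have h2 := H.sum_gap_le_initialGap hγle (K + 1)
  gcongr
  linarith

end StandingAssumptions

end Convergence

/-! ### Iteration complexity with an absolute constant. -/

section Complexity

lemma eta_mul_ge {L μ ω α p : ℝ} {n m τ : ℕ} (hn : 1 ≤ n) (hL : 0 < L) (hμ : 0 < μ) (hω : 0 < ω)
    (hm : 2 ≤ m) (hp : p = 1 / (m : ℝ)) (hα : α = min (1 / (ω + 1)) (1 / 2)) :
    1 ≤ eta (stepBound L ω α p n τ) μ α p *
      (200 * (ω + m + L / μ * (1 + ω / n) + L / μ * √(τ * (τ + ω / n)))) := by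
  have hn' : (0 : ℝ) < n := by exact_mod_cast hn
  have hm' : (2 : ℝ) ≤ m := by exact_mod_cast hm
  have ha : 0 ≤ ω / n := by positivity
  set a := ω / n with hadef
  set B := ω + m + L / μ * (1 + a) + L / μ * √(τ * (τ + a)) with hB
  have hB1 : ω + m ≤ B := by
    have : 0 ≤ L / μ * (1 + a) := by positivity
    have : 0 ≤ L / μ * √(τ * (τ + a)) := by positivity
    linarith
  have hBpos : 0 < 200 * B := by linarith
  rw [← div_le_iff₀ hBpos]
  have hp2 : p ≤ 1 / 2 := by
    rw [hp]
    exact one_div_le_one_div_of_le (by norm_num) hm'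
  have hα2 : α ≤ 1 / 2 := hα ▸ min_le_right _ _
  refine le_min ?_ (le_min ?_ ?_)
  · set X : ℝ := τ * (2 + τ + 4 / (1 - p) + 4 * ω / n *
      (1 + 3 / (1 - α) + 2 / (1 - p) + 4 / ((1 - α) * (1 - p)))) with hX
    have hM : 37 / 9 + 24 * ω / (3 * n) = 37 / 9 + 8 * a := by
      rw [hadef]; field_simp; ring
    have h1p : 1 / (1 - p) ≤ 2 := by rw [div_le_iff₀ (by linarith)]; linarith
    have h1a : 1 / (1 - α) ≤ 2 := by rw [div_le_iff₀ (by linarith)]; linarith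
    have h1a0 : 0 ≤ 1 / (1 - α) := by
      have : 0 < 1 - α := by linarith
      positivity
    have h1p0 : 0 ≤ 1 / (1 - p) := by
      have : 0 < 1 - p := by linarith
      positivity
    have h1ap : 1 / ((1 - α) * (1 - p)) ≤ 4 := by
      rw [← one_div_mul_one_div]
      have := mul_le_mul h1a h1p h1p0 (by norm_num : (0 : ℝ) ≤ 2)
      linarith
    -- As `α, p ≤ 1/2`, the bracket multiplying `4ω/n` is at most `1 + 6 + 4 + 16 = 27`, and `2 +
    -- 4/(1 - p) ≤ 10`. Since `τ` is an integer, `τ ≤ τ²` absorbs the constant.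
    have hXle : X ≤ 108 * (τ * (τ + a)) := by
      have e1 : 4 * ω / n * (1 + 3 / (1 - α) + 2 / (1 - p) + 4 / ((1 - α) * (1 - p)))
          ≤ 4 * ω / n * 27 := by
        refine mul_le_mul_of_nonneg_left ?_ (by positivity)
        rw [← mul_one_div 3, ← mul_one_div 2, ← mul_one_div 4]
        linarith
      have e2 : 4 * ω / n * 27 = 108 * a := by rw [hadef]; ring
      have e3 : (τ : ℝ) ≤ τ * τ := by exact_mod_cast Nat.le_mul_self τ
      have e4 : X ≤ τ * (10 + τ + 108 * a) := by
        rw [hX]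
        refine mul_le_mul_of_nonneg_left ?_ (Nat.cast_nonneg τ)
        rw [← mul_one_div 4 (1 - p)]
        linarith
      have e5 : (0 : ℝ) ≤ τ * τ := by positivity
      linarith
    have hsqrt : √X ≤ 11 * √(τ * (τ + a)) := by
      rw [Real.sqrt_le_left (by positivity), mul_pow, Real.sq_sqrt (by positivity)]
      have : (0 : ℝ) ≤ τ * (τ + a) := by positivity
      linarith
    have hs0 : 0 ≤ √(τ * (τ + a)) := Real.sqrt_nonneg _
    -- `25/2` dominates `37/9`, `8` and `11`; then `8 · 25/2 · 2 = 200` is the constant of the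
    -- statement.
    have hmaxle : max (37 / 9 + 8 * a) √X ≤ 25 / 2 * (1 + a + √(τ * (τ + a))) :=
      max_le (by linarith) (by linarith)
    have hmax : 0 < max (37 / 9 + 8 * a) √X := lt_max_of_lt_left (by positivity)
    rw [stepBound, ← hX, hM, div_mul_eq_mul_div, one_mul, div_div,
      div_le_div_iff₀ hBpos (by positivity), one_mul]
    have h1 : 8 * L * max (37 / 9 + 8 * a) √X * 2
        ≤ 8 * L * (25 / 2 * (1 + a + √(τ * (τ + a)))) * 2 := by gcongr
    have h2 : μ * (200 * B) = 200 * (μ * (ω + m)) + 200 * L * (1 + a + √(τ * (τ + a))) := by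
      rw [hB]
      field_simp
      ring
    have h3 : 0 ≤ μ * (ω + m) := by positivity
    linarith
  -- A lower bound for both entries of the minimum; `4(ω + 2) ≤ 200 B` because `m ≥ 2`.
  · have h1 : 1 / (ω + 2) ≤ α := by
      rw [hα]
      exact le_min (one_div_le_one_div_of_le (by linarith) (by linarith))
        (one_div_le_one_div_of_le (by linarith) (by linarith))
    have h2 : 1 / (200 * B) ≤ 1 / (ω + 2) / 4 := by
      rw [div_div]
      exact one_div_le_one_div_of_le (by positivity) (by linarith)
    linarith
  · rw [hp, div_div]
    exact one_div_le_one_div_of_le (by positivity) (by linarith)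

/-- The bound `1 - η ≤ exp(-η)` settles `ε < 1`. For `ε ≥ 1` the logarithm is nonpositive and the
power is at most one anyway. -/
lemma one_sub_pow_le {η B ε : ℝ} (hη1 : η < 1) (hη0 : 0 ≤ η) (hηB : 1 ≤ η * B) (hε : 0 < ε)
    {K : ℕ} (hK : B * Real.log (1 / ε) ≤ K) : (1 - η) ^ K ≤ ε := by
  rcases le_or_gt 1 ε with h | h
  · exact (pow_le_one₀ (by linarith) (by linarith)).trans h
  · have hlog : 0 < Real.log (1 / ε) := Real.log_pos (by rw [lt_div_iff₀ hε]; linarith)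
    have h1 : Real.log (1 / ε) ≤ η * K := by
      calc Real.log (1 / ε) ≤ η * B * Real.log (1 / ε) := le_mul_of_one_le_left hlog.le hηB
        _ = η * (B * Real.log (1 / ε)) := by ring
        _ ≤ η * K := by gcongr
    have h2 : (1 - η) ^ K ≤ Real.exp (-η) ^ K :=
      pow_le_pow_left₀ (by linarith) (Real.one_sub_le_exp_neg η) K
    rw [← Real.exp_nat_mul] at h2
    refine h2.trans ?_
    rw [← Real.le_log_iff_exp_le hε]
    rw [one_div, Real.log_inv] at h1
    linarith

end Complexity

end DLSVRGDiana

theorem mainTheorem12 :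
    ∃ C : ℝ, 0 < C ∧
      ∀ {Ω Ξ : Type*} [MeasurableSpace Ω] [MeasurableSpace Ξ]
        (P : Measure Ω) [IsProbabilityMeasure P] (ν : Measure Ξ) [IsProbabilityMeasure ν]
        (d n m : ℕ) (_hn : 1 ≤ n) (_hm : 1 ≤ m)
        (A : Input d n m Ξ) (ζ : ℕ → Fin n → Ω → Fin m × Ξ × Bool)
        (xs : Vec d) (L μ ω p : ℝ)
        (_hL : 0 < L) (_hμ : 0 ≤ μ) (_hp : 0 < p) (_hp1 : p < 1)
        (_hconv : ∀ i j, ConvexOn ℝ Set.univ (A.F i j))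
        (_hsmooth : ∀ i j, LSmooth L (A.F i j))
        (_hqsc : QuasiStronglyConvex μ (objective A.F) xs)
        (_hQ : IsQuantization ν A.Q ω)
        (_hζ : IsSampling P ν p ζ)
        (_hα : 0 < A.α) (_hαω : A.α ≤ 1 / (ω + 1))
        (_hγ : 0 < A.γ) (_hγle : A.γ ≤ stepBound L ω A.α p n A.τ),
        -- the parametric assumption
        ParametricAssumption P (history ζ) (objective A.F) xs L μ A.γ
          (A.xProc ζ) (A.gProc ζ) (A.eProc ζ) (A.sigma1Proc ζ xs) (A.sigma2Proc ζ xs)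
          (constants L ω A.γ A.α p n A.τ) ∧
        -- convergence of the weighted averages
        (∀ K : ℕ, Integrable
          (fun o => objective A.F (xBar (eta A.γ μ A.α p) (A.xProc ζ) K o) - objective A.F xs) P) ∧
        (0 < μ → ∀ K : ℕ,
          ∫ o, (objective A.F (xBar (eta A.γ μ A.α p) (A.xProc ζ) K o) - objective A.F xs) ∂P ≤
            (1 - min (A.γ * μ / 2) (min (A.α / 4) (p / 4))) ^ K * A.initialGap xs L ω p) ∧
        (μ = 0 → ∀ K : ℕ, 1 ≤ K →
          ∫ o, (objective A.F (xBar (eta A.γ μ A.α p) (A.xProc ζ) K o) - objective A.F xs) ∂P ≤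
            A.initialGap xs L ω p / K) ∧
        -- iteration complexity, with an absolute constant
        (0 < μ → 2 ≤ m → p = 1 / (m : ℝ) → A.α = min (1 / (ω + 1)) (1 / 2) →
          A.γ = stepBound L ω A.α p n A.τ →
          ∀ ε : ℝ, 0 < ε → ∀ K : ℕ,
            C * (ω + m + L / μ * (1 + ω / n) + L / μ * √(A.τ * (A.τ + ω / n)))
              * Real.log (1 / ε) ≤ K →
            ∫ o, (objective A.F (xBar (eta A.γ μ A.α p) (A.xProc ζ) K o) - objective A.F xs) ∂P ≤
              ε * A.initialGap xs L ω p) := by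
  refine ⟨200, by norm_num, ?_⟩
  intro Ω Ξ _ _ P _ ν _ d n m hn hm A ζ xs L μ ω p hL hμ hp hp1 hconv hsmooth hqsc hQ hζ hα hαω hγ hγle
  have H : StandingAssumptions P ν A ζ xs L μ ω p :=
    ⟨hn, hm, hL, hμ, hp, hp1, hconv, hsmooth, hqsc, hQ, hζ, hα, hαω, hγ⟩
  refine ⟨H.parametricAssumption hγle, H.integrable_gap_xBar, H.linear_rate hγle,
    H.sublinear_rate hγle, ?_⟩
  intro hμ0 hm2 hpm hαeq hγeq ε hε K hK
  refine (H.linear_rate hγle hμ0 K).trans (mul_le_mul_of_nonneg_right ?_ H.initialGap_nonneg)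
  have h := eta_mul_ge (n := n) (τ := A.τ) hn hL hμ0 hQ.omega_pos hm2 hpm hαeq
  rw [← hγeq] at h
  exact one_sub_pow_le H.eta_lt_one H.eta_nonneg h hε hK
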